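/- **Setting.** Let $\beta,m,m_n>0$, let $d_0<d_1<d_2<\cdots$ be nonnegative integers, and for each $N\in\mathbb N=\{0,1,2,\dots\}$ let $V_N\subset\mathbb R^{d_N}$ be a nonempty open set such that the projection of $V_{N+1}$ onto the first $d_N$ coordinates is $V_N$. Let $U_N\in C^2(V_N;\mathbb R)$ be such that the Hamiltonian system $\dot q=p/m$, $\dot p=-\nabla U_N(q)$ on $V_N\times\mathbb R^{d_N}$ has a solution for all times $t\in\mathbb R$ from every initial point, and suppose $Z=\sum_N\int_{V_N}e^{-\beta U_N(q)}\,dq<\infty$. Write $K(p)=\|p\|^2/(2m)$, $K_n(p_n)=|p_n|/m_n$, and $H_N(q,p)=U_N(q)+K(p)+\frac{d_N}{2\beta}\log\frac{2\pi m}{\beta}$. For each $N$ and $(q,p)\in V_N\times\mathbb R^{d_N}$ let $\rho_N(\cdot,\cdot\,;q,p)$ be a probability density on $\mathbb R^{d_{N+1}-d_N}\times\mathbb R^{d_{N+1}-d_N}$, jointly measurable in all its arguments, vanishing at $(q_{\rm new},p_{\rm new})$ whenever $[q,q_{\rm new}]\notin V_{N+1}$, and even: $\rho_N(q_{\rm new},-p_{\rm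 new};q,-p)=\rho_N(q_{\rm new},p_{\rm new};q,p)$. **Target.** $\hat\pi$ is the measure on $\bigcup_N V_N\times[N,N+1)$ with density $\hat\pi(q,n)=Z^{-1}e^{-\beta U_N(q)}$ for $q\in V_N$, $N\le n<N+1$, with respect to Lebesgue measure. **Trans-dimensional dynamics.** As long as $n\in(N,N+1)$, the point $(q,p,n,p_n)$ with $(q,p)\in V_N\times\mathbb R^{d_N}$ follows $\dot q=p/m$, $\dot p=-\nabla U_N(q)$, $\dot n=\operatorname{sign}(p_n)/m_n$ (with $\operatorname{sign}(0)=1$), $\dot p_n=0$. When $n$ hits $N+1$ from the left, $(q_{\rm new},p_{\rm new})$ is sampled from $\rho_N(\cdot,\cdot\,;q,p)$, the index $N+1$ and the point $\tilde q=[q,q_{\rm new}]$, $\tilde p=[p,p_{\rm new}]$ are proposed, and $$\delta H=H_{N+1}(\tilde q,\tilde p)-H_N(q,p)+\tfrac1\beta\log\rho_N(q_{\rm new},p_{\rm new};q,p).$$ When $n$ hits $N\ge1$ from the right, the index $N-1$ is proposed, with $\tilde q,\tilde p$ the first $d_{N-1}$ coordinates of $q,p$, and $$\delta H=H_{N-1}(\tilde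 q,\tilde p)-H_N(q,p)-\tfrac1\beta\log\rho_{N-1}(q_{\rm rest},p_{\rm rest};\tilde q,\tilde p),$$ where $q_{\rm rest},p_{\rm rest}$ are the last $d_N-d_{N-1}$ coordinates ($\log 0=-\infty$). When $n$ hits $0$, $\delta H=+\infty$. If $K_n(p_n)\ge\delta H$ the proposal is accepted, and $p_n$ keeps its direction and is changed so that $K_n$ decreases by $\delta H$; otherwise the proposal is dropped and $p_n$ changes sign. The dynamics then continues. **Algorithm.** The transition kernel $\Gamma_T$ of the ideal algorithm with evolution time $T$ acts on $(q,n)$ with $q\in V_N$ as follows: sample independently $p\in\mathbb R^{d_N}$ with density $(2\pi m/\beta)^{-d_N/2}e^{-\beta K(p)}$ and $p_n\in\mathbb R$ with density $\frac{\beta}{2m_n}e^{-\beta|p_n|/m_n}$, run the dynamics for time $T$, and keep the positions $(q,n)$. **Theorem 1.** For every $T>0$, $\Gamma_T$ is a Markov kernel that satisfies detailed balance with respect to $\hat\pi$, that is, for all measurable sets $A,B$, $$\int_A\Gamma_T(\varphi,B)\,\hat\pi(d\varphi)=\int_B\Gamma_T(\varphi,A)\,\hat\pi(d\varphi).$$ Consequently,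 for all $0\le T_{\min}<T_{\max}$, the ideal algorithm with random evolution time $T\sim\mathrm{UNIF}[T_{\min},T_{\max}]$, whose kernel is $\Gamma=\frac1{T_{\max}-T_{\min}}\int_{T_{\min}}^{T_{\max}}\Gamma_T\,dT$, is a Markov kernel that satisfies detailed balance with respect to $\hat\pi$. -/

import Mathlib

open MeasureTheory ProbabilityTheory Set
open scoped ENNReal

noncomputable section

namespace DHMC

/-- Euclidean space `ℝ^k`. -/
abbrev E (k : ℕ) : Type := EuclideanSpace ℝ (Fin k)

/-- The concatenation `[x, y]` of `x ∈ ℝ^a` and `y ∈ ℝ^(b-a)`, a vector of `ℝ^b` (used for `a ≤ b`). -/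
def append {a b : ℕ} (x : E a) (y : E (b - a)) : E b :=
  WithLp.toLp 2 fun i : Fin b =>
    if h : (i : ℕ) < a then x ⟨i, h⟩ else y ⟨(i : ℕ) - a, by have := i.isLt; omega⟩

/-- The first `a` coordinates of a vector of `ℝ^b`. -/
def head {a b : ℕ} (h : a ≤ b) (x : E b) : E a :=
  WithLp.toLp 2 fun i : Fin a => x (Fin.castLE h i)

/-- The last `b - a` coordinates of a vector of `ℝ^b`. -/
def tail (a : ℕ) {b : ℕ} (x : E b) : E (b - a) :=
  WithLp.toLp 2 fun j : Fin (b - a) => x ⟨a + (j : ℕ), by have := j.isLt; omega⟩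

/-- The data of the transdimensional sampling problem: inverse temperature `β`, mass `m` of `p`,
mass `mn` of `p_n`, dimensions `d N`, domains `V N ⊆ ℝ^(d N)`, potentials `U N` on `V N`, and the
densities `ρ N q p · ·` of the new coordinates `(q_new, p_new)` proposed when going from `N` to
`N + 1`, together with the standing assumptions on them. -/
structure Model where
  β : ℝ
  m : ℝ
  mn : ℝ
  β_pos : 0 < β
  m_pos : 0 < m
  mn_pos : 0 < mn
  d : ℕ → ℕ
  d_strictMono : StrictMono d
  V : (N : ℕ) → Set (E (d N))
  V_open : ∀ N, IsOpen (V N)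
  V_nonempty : ∀ N, (V N).Nonempty
  /-- The projection of `V (N+1)` onto the first `d N` coordinates is `V N`. -/
  V_proj : ∀ N, head (d_strictMono.monotone N.le_succ) '' V (N + 1) = V N
  U : (N : ℕ) → E (d N) → ℝ
  U_smooth : ∀ N, ContDiffOn ℝ 2 (U N) (V N)
  /-- The Hamiltonian system `q' = p / m`, `p' = -∇ U_N(q)` on `V N × ℝ^(d N)` has global solutions. -/
  complete : ∀ N, ∀ q ∈ V N, ∀ p : E (d N), ∃ γ : ℝ → E (d N) × E (d N), γ 0 = (q, p) ∧
    ∀ t, (γ t).1 ∈ V N ∧ HasDerivAt γ (m⁻¹ • (γ t).2, -gradient (U N) (γ t).1) t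
  /-- The partition function is finite. -/
  partition_ne_top : ∑' N, ∫⁻ q in V N, ENNReal.ofReal (Real.exp (-β * U N q)) ≠ ∞
  ρ : (N : ℕ) → E (d N) → E (d N) → E (d (N + 1) - d N) → E (d (N + 1) - d N) → ℝ
  ρ_measurable : ∀ N, Measurable
    fun x : (E (d N) × E (d N)) × (E (d (N + 1) - d N) × E (d (N + 1) - d N)) =>
      ρ N x.1.1 x.1.2 x.2.1 x.2.2
  ρ_nonneg : ∀ N q p r s, 0 ≤ ρ N q p r s
  ρ_prob : ∀ N, ∀ q ∈ V N, ∀ p,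
    ∫⁻ w : E (d (N + 1) - d N) × E (d (N + 1) - d N), ENNReal.ofReal (ρ N q p w.1 w.2) = 1
  ρ_support : ∀ N, ∀ q ∈ V N, ∀ p r s, append q r ∉ V (N + 1) → ρ N q p r s = 0
  /-- The proposal density is even under the reversal of all momenta. -/
  ρ_even : ∀ N, ∀ q ∈ V N, ∀ p r s, ρ N q (-p) r (-s) = ρ N q p r s

namespace Model

variable (S : Model)

/-- Positions `φ = (q, n)` with `q ∈ V N`; the points that matter have `N ≤ n ≤ N + 1`. -/
abbrev Pos : Type := Σ N : ℕ, S.V N × ℝ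

/-- Phase points `(q, p, n, p_n)` with `q ∈ V N`, `p ∈ ℝ^(d N)`. -/
abbrev Phase : Type := Σ N : ℕ, S.V N × E (S.d N) × ℝ × ℝ

theorem d_le (N : ℕ) : S.d N ≤ S.d (N + 1) := S.d_strictMono.monotone N.le_succ

theorem head_mem (N : ℕ) (q : S.V (N + 1)) : head (S.d_le N) q.1 ∈ S.V N := by
  rw [← S.V_proj N]
  exact ⟨q.1, q.2, rfl⟩

/-! Target distribution and momentum laws -/

/-- The partition function `Z_β`. -/
def partition : ℝ≥0∞ := ∑' N, ∫⁻ q in S.V N, ENNReal.ofReal (Real.exp (-S.β * S.U N q))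

/-- The extended target: density `Z_β⁻¹ exp (-β U_N(q)) 1_{N ≤ n < N + 1}` with respect to
Lebesgue measure on each `V N × ℝ`. -/
def target : Measure S.Pos :=
  Measure.sum fun N => Measure.map (Sigma.mk N)
    (((Measure.comap Subtype.val volume : Measure (S.V N)).prod (volume : Measure ℝ)).withDensity fun x =>
      S.partition⁻¹ * ENNReal.ofReal (Real.exp (-S.β * S.U N x.1)) *
        (Ico (N : ℝ) (N + 1)).indicator 1 x.2)

/-- Kinetic energy `K(p) = ‖p‖² / (2m)`. -/
def kin {k : ℕ} (p : E k) : ℝ := ‖p‖ ^ 2 / (2 * S.m)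

/-- Kinetic energy `K_n(p_n) = |p_n| / m_n`. -/
def kinN (a : ℝ) : ℝ := |a| / S.mn

/-- The law of `p` in dimension `d N`: density `(2πm/β)^(-d_N/2) exp (-β K(p))`. -/
def pLaw (N : ℕ) : Measure (E (S.d N)) :=
  volume.withDensity fun p => ENNReal.ofReal
    ((2 * S.m * Real.pi / S.β) ^ (-((S.d N : ℝ) / 2)) * Real.exp (-S.β * S.kin p))

/-- The law of `p_n`: density `(2 m_n / β)⁻¹ exp (-β K_n(p_n))`. -/
def pnLaw : Measure ℝ :=
  volume.withDensity fun a => ENNReal.ofReal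
    ((2 * S.mn / S.β)⁻¹ * Real.exp (-S.β * S.kinN a))

/-! The dynamics between integers -/

/-- The solution map of the Hamiltonian system on `V N × ℝ^(d N)`. -/
def flow (N : ℕ) (t : ℝ) (q : S.V N) (p : E (S.d N)) : S.V N × E (S.d N) :=
  (⟨((S.complete N q.1 q.2 p).choose t).1, ((S.complete N q.1 q.2 p).choose_spec.2 t).1⟩,
    ((S.complete N q.1 q.2 p).choose t).2)

/-- The sign function with the convention `sign 0 = 1`. -/
def sgn (a : ℝ) : ℝ := if a < 0 then -1 else 1

/-- Evolution during time `t` without barrier: `(q, p)` follows the Hamiltonian system of index `N`,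
`n` moves with velocity `sign(p_n) / m_n`, and `p_n` is constant. -/
def evolve (t : ℝ) : S.Phase → S.Phase
  | ⟨N, q, p, n, a⟩ => ⟨N, (S.flow N t q p).1, (S.flow N t q p).2, n + t * (sgn a / S.mn), a⟩

/-- The time at which `n` hits the end of `[N, N + 1]` it is moving to. -/
def hitTime : S.Phase → ℝ
  | ⟨N, _, _, n, a⟩ => if a < 0 then S.mn * (n - N) else S.mn * (N + 1 - n)

/-! The jump at an integer -/

/-- The Hamiltonian of index `N` without `K_n(p_n)` and without the additive constant:
`U_N(q) + K(p) + d_N / (2β) log (2mπ/β)`. -/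
def ham (N : ℕ) (q p : E (S.d N)) : ℝ :=
  S.U N q + S.kin p + (S.d N : ℝ) / (2 * S.β) * Real.log (2 * S.m * Real.pi / S.β)

/-- The free-energy-corrected jump `H_{N+1}([q, r], [p, s]) - H_N(q, p) + β⁻¹ log ρ(r, s; q, p)`,
with `log 0 = -∞`. -/
def barrierUp (N : ℕ) (q p : E (S.d N)) (r s : E (S.d (N + 1) - S.d N)) : EReal :=
  ((S.ham (N + 1) (append q r) (append p s) - S.ham N q p : ℝ) : EReal) +
    ((S.β⁻¹ : ℝ) : EReal) * ENNReal.log (ENNReal.ofReal (S.ρ N q p r s))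

/-- The corresponding barrier for dropping the last `d_{N+1} - d_N` coordinates:
`H_N(q̄, p̄) - H_{N+1}(q, p) - β⁻¹ log ρ(tail q, tail p; q̄, p̄)` where the bar keeps the first
`d_N` coordinates. It is `+∞` where `ρ` vanishes. -/
def barrierDown (N : ℕ) (q p : E (S.d (N + 1))) : EReal :=
  ((S.ham N (head (S.d_le N) q) (head (S.d_le N) p) - S.ham (N + 1) q p : ℝ) : EReal) -
    ((S.β⁻¹ : ℝ) : EReal) * ENNReal.log (ENNReal.ofReal
      (S.ρ N (head (S.d_le N) q) (head (S.d_le N) p) (tail (S.d N) q) (tail (S.d N) p)))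

/-- The momentum after crossing a barrier `δ`: same direction, and
`K_n(p_n) - δ = K_n(new p_n)`. -/
def crossed (a : ℝ) (δ : EReal) : ℝ := sgn a * (|a| - S.mn * δ.toReal)

open Classical in
/-- The result of the attempt to go from `N` to `N + 1` with new coordinates `w = (q_new, p_new)`.
A proposal outside `V (N+1)`, where the potential is `+∞`, is rejected. -/
def jumpUp (N : ℕ) (q : S.V N) (p : E (S.d N)) (n a : ℝ)
    (w : E (S.d (N + 1) - S.d N) × E (S.d (N + 1) - S.d N)) : S.Phase :=
  if h : append q.1 w.1 ∈ S.V (N + 1) ∧ S.barrierUp N q p w.1 w.2 ≤ (S.kinN a : EReal) then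
    ⟨N + 1, ⟨append q.1 w.1, h.1⟩, append p w.2, n, S.crossed a (S.barrierUp N q p w.1 w.2)⟩
  else ⟨N, q, p, n, -a⟩

open Classical in
/-- The result of the attempt to lower the index; at index `0` the barrier is infinite. -/
def jumpDown : (N : ℕ) → S.V N → E (S.d N) → ℝ → ℝ → S.Phase
  | 0, q, p, n, a => ⟨0, q, p, n, -a⟩
  | N + 1, q, p, n, a =>
    if S.barrierDown N q p ≤ (S.kinN a : EReal) then
      ⟨N, ⟨head (S.d_le N) q.1, S.head_mem N q⟩, head (S.d_le N) p, n,
        S.crossed a (S.barrierDown N q p)⟩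
    else ⟨N + 1, q, p, n, -a⟩

/-- The law of the new coordinates `(q_new, p_new)`. -/
def newLaw (N : ℕ) (q p : E (S.d N)) :
    Measure (E (S.d (N + 1) - S.d N) × E (S.d (N + 1) - S.d N)) :=
  volume.withDensity fun w => ENNReal.ofReal (S.ρ N q p w.1 w.2)

/-- The law of the phase point right after `n` has hit an integer. -/
def jump : S.Phase → Measure S.Phase
  | ⟨N, q, p, n, a⟩ =>
    if a < 0 then Measure.dirac (S.jumpDown N q p n a)
    else (S.newLaw N q p).map (S.jumpUp N q p n a)

/-! Transition laws -/

/-- The law at time `t` of the dynamics started at `x`, at most `k` hits of integers being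
processed. -/
def dynAux : ℕ → ℝ → S.Phase → Measure S.Phase
  | 0, t, x => Measure.dirac (S.evolve t x)
  | k + 1, t, x =>
    if t < S.hitTime x then Measure.dirac (S.evolve t x)
    else (S.jump (S.evolve (S.hitTime x) x)).bind (dynAux k (t - S.hitTime x))

/-- The transition law of the trans-dimensional Hamiltonian dynamics for time `T`. Successive hits of
integers are `m_n` apart, so at most `⌊T / m_n⌋ + 1` of them happen in `[0, T]`. -/
def dyn (T : ℝ) (x : S.Phase) : Measure S.Phase := S.dynAux (⌊T / S.mn⌋₊ + 1) T x

/-- Forget the momenta. -/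
def toPos : S.Phase → S.Pos
  | ⟨N, q, _, n, _⟩ => ⟨N, q, n⟩

/-- The transition law of the ideal algorithm with evolution time `T`: sample the momenta, run the
dynamics for time `T`, keep the positions. -/
def idealStep (T : ℝ) : S.Pos → Measure S.Pos
  | ⟨N, q, n⟩ => (((S.pLaw N).prod S.pnLaw).bind fun ψ => S.dyn T ⟨N, q, ψ.1, n, ψ.2⟩).map S.toPos

/-- The transition law of the ideal algorithm with a uniformly distributed evolution time. -/
def randomStep (Tmin Tmax : ℝ) (x : S.Pos) : Measure S.Pos :=
  (cond (volume : Measure ℝ) (Icc Tmin Tmax)).bind fun T => S.idealStep T x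

end Model

end DHMC

end

noncomputable section

namespace DHMC

open Filter Topology

/-! ### Symplectic Euler scheme and Liouville's theorem -/

section SymplecticEuler

variable {F : Type*} [NormedAddCommGroup F] [InnerProductSpace ℝ F]

/-! The speed of `n` is constant, so the times at which `n` meets integers are known in advance. Let
the clock `c ∈ [0, 1)` be the fraction of the current unit interval that `n` has covered in its
direction of motion (`emb`). Up to null sets, a raised, lowered or reflected point starts a new
interval with `c = 0`, so the clock runs at rate `1 / mn` whatever the jumps do. After dropping `n`,
the dynamics on points `(q, p, p_n)` for time `T` from clock `c` is an alternating product of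
Hamiltonian flows and jump kernels (`clockKernel`, `ae_dyn_emb`). It has `k = ⌊c + T / mn⌋` jumps.
If `k > 0`, flows of duration `mn` separate them, a flow of duration `mn (1 - c)` precedes them and
a flow of duration `mn · fract (c + T / mn)` follows them.

Each factor is in detailed balance with the Boltzmann measure up to momentum reversal
(`RevAdjoint`). For the flow, this combines Liouville's theorem, conservation of energy and time
reversibility. For the jump (`revAdjoint_jumpKernel`), reflections balance themselves and raising
balances lowering. Indeed `K_n` is linear in `|p_n|`, so crossing a barrier translates `p_n`, which
preserves Lebesgue measure, and the term `β⁻¹ log ρ` of the barrier compensates the proposal density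
(`weight_mul_rho`, `lintegral_raised_eq_lowered`). Adjoints compose in reverse order
(`RevAdjoint.comp`), so the adjoint of the product is the product read backwards, which is the
kernel of clock `c' = 1 - fract (c + T / mn)` (`revAdjoint_clockKernel`).

Under the target and the momentum laws, the clock is uniform and independent of `(q, p, p_n)`, whose
law is proportional to the Boltzmann measure (`lintegral_target_idealStep`). The map `c ↦ c'` is a
rotation followed by a reflection of the circle, hence preserves this uniform law
(`setLIntegral_fract_reverse`). Momentum reversal together with `c ↦ 1 - c` does not move positions,
so integration over `c` gives detailed balance. A random evolution time only mixes reversible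
kernels.

Liouville's theorem and the measurability of the flow come from the symplectic Euler scheme: its
steps are compositions of shears, its iterates converge to the solutions, and Fatou's lemma passes
volumes to the limit. -/

/-- One step of size `h` of the symplectic Euler scheme for `q' = c p`, `p' = -G q`. -/
def eulerStep (G : F → F) (c h : ℝ) (x : F × F) : F × F :=
  (x.1 + (h * c) • (x.2 - h • G x.1), x.2 - h • G x.1)

/-- The step is the composition of the shears `(q, p) ↦ (q, p - h G q)` and `(q, p) ↦ (q + h c p,
p)`, each a translation on every fibre. No differentiability of `G` enters. -/
theorem measurePreserving_eulerStep [FiniteDimensional ℝ F] [MeasurableSpace F] [BorelSpace F]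
    {G : F → F} (hG : Measurable G) (c h : ℝ) :
    MeasurePreserving (eulerStep G c h) ((volume : Measure F).prod volume)
      ((volume : Measure F).prod volume) := by
  have h1 : MeasurePreserving (fun x : F × F => (x.1, x.2 - h • G x.1))
      ((volume : Measure F).prod volume) ((volume : Measure F).prod volume) := by
    refine (MeasurePreserving.id volume).skew_product (g := fun q p => p - h • G q)
      (by fun_prop) (ae_of_all _ fun q => ?_)
    exact (measurePreserving_sub_right volume (h • G q)).map_eq
  have h2 : MeasurePreserving (fun x : F × F => (x.1, x.2 + (h * c) • x.1))
      ((volume : Measure F).prod volume) ((volume : Measure F).prod volume) := by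
    refine (MeasurePreserving.id volume).skew_product (g := fun q p => p + (h * c) • q)
      (by fun_prop) (ae_of_all _ fun q => ?_)
    exact (measurePreserving_add_right volume ((h * c) • q)).map_eq
  have h3 : MeasurePreserving (Prod.swap : F × F → F × F)
      ((volume : Measure F).prod volume) ((volume : Measure F).prod volume) :=
    Measure.measurePreserving_swap
  exact h3.comp (h2.comp (h3.comp h1))

/-- The factor has the form `1 + A |h|` with `A` uniform for `|h| ≤ r`, so that `n` steps of size `t
/ n` expand distances at most by `exp (A |t|)`. -/
theorem dist_eulerStep_le {G : F → F} {L : NNReal} (hG : LipschitzWith L G) {c h r : ℝ}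
    (hr : |h| ≤ r) (x y : F × F) :
    ‖eulerStep G c h x - eulerStep G c h y‖ ≤ (1 + (L + |c| * (1 + r * L)) * |h|) * ‖x - y‖ := by
  have hL : (0 : ℝ) ≤ L := L.2
  have hr0 : 0 ≤ r := (abs_nonneg h).trans hr
  have e1 : ‖x.1 - y.1‖ ≤ ‖x - y‖ := norm_fst_le (x - y)
  have e2 : ‖x.2 - y.2‖ ≤ ‖x - y‖ := norm_snd_le (x - y)
  have hGn : ‖G x.1 - G y.1‖ ≤ L * ‖x - y‖ :=
    (by simpa [dist_eq_norm] using hG.dist_le_mul x.1 y.1 : ‖G x.1 - G y.1‖ ≤ L * ‖x.1 - y.1‖).trans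
      (by gcongr)
  have hp : ‖(x.2 - h • G x.1) - (y.2 - h • G y.1)‖ ≤ (1 + |h| * L) * ‖x - y‖ := by
    have : (x.2 - h • G x.1) - (y.2 - h • G y.1) = (x.2 - y.2) - h • (G x.1 - G y.1) := by
      rw [smul_sub]; abel
    rw [this]
    refine (norm_sub_le _ _).trans ?_
    rw [norm_smul, Real.norm_eq_abs]
    nlinarith [mul_le_mul_of_nonneg_left hGn (abs_nonneg h)]
  have hn := norm_nonneg (x - y)
  have hp' : ‖(x.2 - h • G x.1) - (y.2 - h • G y.1)‖ ≤ (1 + r * L) * ‖x - y‖ :=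
    hp.trans (by gcongr)
  refine max_le ?_ ?_
  · change ‖(x.1 + (h * c) • (x.2 - h • G x.1)) - (y.1 + (h * c) • (y.2 - h • G y.1))‖ ≤ _
    have : (x.1 + (h * c) • (x.2 - h • G x.1)) - (y.1 + (h * c) • (y.2 - h • G y.1)) =
        (x.1 - y.1) + (h * c) • ((x.2 - h • G x.1) - (y.2 - h • G y.1)) := by
      module
    rw [this]
    refine (norm_add_le _ _).trans ?_
    rw [norm_smul, Real.norm_eq_abs, abs_mul]
    have h1 : |h| * |c| * ‖(x.2 - h • G x.1) - (y.2 - h • G y.1)‖ ≤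
        |h| * |c| * ((1 + r * L) * ‖x - y‖) := by gcongr
    have h2 : 0 ≤ L * |h| * ‖x - y‖ := by positivity
    nlinarith
  · change ‖(x.2 - h • G x.1) - (y.2 - h • G y.1)‖ ≤ _
    refine hp.trans ?_
    have h2 : 0 ≤ |c| * (1 + r * L) * |h| * ‖x - y‖ := by positivity
    nlinarith

/-- A solution of `q' = c p`, `p' = -G q`, the domain of `G` being `V`. -/
def IsSolution (V : Set F) (G : F → F) (c : ℝ) (γ : ℝ → F × F) : Prop :=
  ∀ t, (γ t).1 ∈ V ∧ HasDerivAt γ (c • (γ t).2, -G (γ t).1) t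

theorem IsSolution.continuous {V : Set F} {G : F → F} {c : ℝ} {γ : ℝ → F × F}
    (hγ : IsSolution V G c γ) : Continuous γ :=
  continuous_iff_continuousAt.2 fun t => (hγ t).2.continuousAt

/-- Local error of the scheme along a curve whose field is Lipschitz. -/
theorem local_error_eulerStep {G : F → F} {L : NNReal} (hG : LipschitzWith L G) {c t M : ℝ}
    {γ : ℝ → F × F} (hγ : ∀ s ∈ uIcc 0 t, HasDerivAt γ (c • (γ s).2, -G (γ s).1) s)
    (hM : ∀ s ∈ uIcc 0 t, ‖(c • (γ s).2, -G (γ s).1)‖ ≤ M)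
    {s h : ℝ} (hs : s ∈ uIcc 0 t) (hsh : s + h ∈ uIcc 0 t) :
    ‖γ (s + h) - eulerStep G c h (γ s)‖ ≤ ((|c| + L) * M + |c| * M) * |h| ^ 2 := by
  have hL : (0 : ℝ) ≤ L := L.2
  have hM0 : 0 ≤ M := (norm_nonneg _).trans (hM s hs)
  have hsub : uIcc s (s + h) ⊆ uIcc 0 t := uIcc_subset_uIcc hs hsh
  set v : ℝ → F × F := fun u => (c • (γ u).2, -G (γ u).1) with hv
  have hlip : ∀ u ∈ uIcc s (s + h), ‖γ u - γ s‖ ≤ M * |h| := by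
    intro u hu
    have := (convex_uIcc s (s + h)).norm_image_sub_le_of_norm_hasDerivWithin_le
      (fun z hz => (hγ z (hsub hz)).hasDerivWithinAt) (fun z hz => hM z (hsub hz))
      left_mem_uIcc hu
    refine this.trans ?_
    gcongr
    rw [Real.norm_eq_abs]
    simpa using abs_sub_left_of_mem_uIcc hu
  have hvl : ∀ u ∈ uIcc s (s + h), ‖v u - v s‖ ≤ (|c| + L) * (M * |h|) := by
    intro u hu
    have e := hlip u hu
    have e1 : ‖(γ u).1 - (γ s).1‖ ≤ M * |h| := (norm_fst_le (γ u - γ s)).trans e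
    have e2 : ‖(γ u).2 - (γ s).2‖ ≤ M * |h| := (norm_snd_le (γ u - γ s)).trans e
    have hpos : 0 ≤ M * |h| := by positivity
    refine max_le ?_ ?_
    · change ‖c • (γ u).2 - c • (γ s).2‖ ≤ _
      rw [← smul_sub, norm_smul, Real.norm_eq_abs]
      nlinarith [mul_le_mul_of_nonneg_left e2 (abs_nonneg c), mul_nonneg hL hpos]
    · change ‖-G (γ u).1 - -G (γ s).1‖ ≤ _
      rw [neg_sub_neg, norm_sub_rev]
      have := hG.dist_le_mul (γ u).1 (γ s).1
      rw [dist_eq_norm, dist_eq_norm] at this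
      nlinarith [mul_le_mul_of_nonneg_left e1 hL, mul_nonneg (abs_nonneg c) hpos]
  -- Mean value inequality after subtracting the linear motion with velocity `v s`: the remaining
  -- velocity is `O(h)`, so the displacement is `O(h²)`.
  have hmain : ‖(γ (s + h) - (s + h) • v s) - (γ s - s • v s)‖ ≤
      ((|c| + L) * (M * |h|)) * ‖s + h - s‖ := by
    refine (convex_uIcc s (s + h)).norm_image_sub_le_of_norm_hasDerivWithin_le
      (f := fun u => γ u - u • v s) (f' := fun u => v u - v s)
      (fun z hz => ?_) hvl left_mem_uIcc right_mem_uIcc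
    have := (hγ z (hsub hz)).sub ((hasDerivAt_id z).smul_const (v s))
    rw [one_smul] at this
    exact this.hasDerivWithinAt
  -- The scheme moves `q` with the updated momentum; compared with the explicit Euler step this
  -- costs the term `h² c G`.
  have hsplit : γ (s + h) - eulerStep G c h (γ s) =
      ((γ (s + h) - (s + h) • v s) - (γ s - s • v s)) + ((h * c * h) • G (γ s).1, (0 : F)) := by
    ext1
    · simp only [eulerStep, hv, Prod.fst_sub, Prod.fst_add, Prod.smul_fst]
      module
    · simp only [eulerStep, hv, Prod.snd_sub, Prod.snd_add, Prod.smul_snd]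
      module
  have hlast : ‖((h * c * h) • G (γ s).1, (0 : F))‖ ≤ |c| * M * |h| ^ 2 := by
    have e : ‖G (γ s).1‖ ≤ M := by
      have := (norm_snd_le (v s)).trans (hM s hs)
      simpa [hv] using this
    rw [Prod.norm_def, norm_zero, max_eq_left (norm_nonneg _), norm_smul, Real.norm_eq_abs,
      abs_mul, abs_mul]
    nlinarith [mul_le_mul_of_nonneg_left e (by positivity : 0 ≤ |h| * |c| * |h|)]
  rw [hsplit]
  refine (norm_add_le _ _).trans ?_
  rw [add_sub_cancel_left, Real.norm_eq_abs] at hmain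
  nlinarith

/-- The iterates of the scheme converge to any solution along which `G` coincides with a globally
Lipschitz field. -/
theorem tendsto_eulerStep_iterate {G : F → F} {L : NNReal} (hG : LipschitzWith L G) {c t : ℝ}
    {γ : ℝ → F × F} (hγ : ∀ s ∈ uIcc 0 t, HasDerivAt γ (c • (γ s).2, -G (γ s).1) s) :
    Tendsto (fun n : ℕ => (eulerStep G c (t / n))^[n] (γ 0)) atTop (𝓝 (γ t)) := by
  have hcont : ContinuousOn (fun s => (c • (γ s).2, -G (γ s).1)) (uIcc 0 t) := by
    have h1 : ContinuousOn γ (uIcc 0 t) := fun s hs => (hγ s hs).continuousAt.continuousWithinAt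
    have h2 := hG.continuous
    fun_prop
  obtain ⟨M, hM⟩ := isCompact_uIcc.exists_bound_of_continuousOn hcont
  have hM0 : 0 ≤ M := (norm_nonneg _).trans (hM 0 left_mem_uIcc)
  have hL : (0 : ℝ) ≤ L := L.2
  set A : ℝ := L + |c| * (1 + |t| * L) with hA
  set B : ℝ := (|c| + L) * M + |c| * M with hB
  have hA0 : 0 ≤ A := by positivity
  have hB0 : 0 ≤ B := by positivity
  have key : ∀ n : ℕ, 0 < n → ‖(eulerStep G c (t / n))^[n] (γ 0) - γ t‖ ≤
      B * |t| ^ 2 * Real.exp (A * |t|) * (n : ℝ)⁻¹ := by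
    intro n hn
    have hn' : (0 : ℝ) < n := by exact_mod_cast hn
    set h : ℝ := t / n with hh
    have habs : |h| = |t| / n := by rw [hh, abs_div, abs_of_pos hn']
    have hhr : |h| ≤ |t| := by
      rw [habs]
      exact div_le_self (abs_nonneg t) (by exact_mod_cast hn)
    have hmem : ∀ k : ℕ, k ≤ n → (k : ℝ) * h ∈ uIcc 0 t := by
      intro k hk
      have hk1 : (k : ℝ) / n ≤ 1 := by
        rw [div_le_one hn']; exact_mod_cast hk
      have hk0 : 0 ≤ (k : ℝ) / n := by positivity
      have e : (k : ℝ) * h = (k / n : ℝ) * t := by rw [hh]; ring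
      rw [e, mem_uIcc]
      rcases le_total 0 t with ht | ht
      · left; constructor <;> nlinarith
      · right; constructor <;> nlinarith
    -- Each of the first `k` local errors is amplified by at most `(1 + A |h|) ^ k`. With `k = n`
    -- the total is `O(1 / n)`.
    have hrec : ∀ k : ℕ, k ≤ n → ‖(eulerStep G c h)^[k] (γ 0) - γ (k * h)‖ ≤
        k * (B * |h| ^ 2) * (1 + A * |h|) ^ k := by
      intro k
      induction k with
      | zero => intro _; simp
      | succ k ih =>
        intro hk
        have ih' := ih (Nat.le_of_succ_le hk)
        rw [Function.iterate_succ_apply']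
        have hs := hmem k (Nat.le_of_succ_le hk)
        have hsh : (k : ℝ) * h + h ∈ uIcc 0 t := by
          have := hmem (k + 1) hk
          push_cast at this
          rwa [add_mul, one_mul] at this
        have e1 := local_error_eulerStep hG hγ hM hs hsh
        have e2 := dist_eulerStep_le hG (c := c) hhr ((eulerStep G c h)^[k] (γ 0)) (γ (k * h))
        have e3 : ((k + 1 : ℕ) : ℝ) * h = k * h + h := by push_cast; ring
        rw [e3]
        have hone : (1 : ℝ) ≤ 1 + A * |h| := by
          have : 0 ≤ A * |h| := by positivity
          linarith
        calc ‖eulerStep G c h ((eulerStep G c h)^[k] (γ 0)) - γ (k * h + h)‖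
            ≤ ‖eulerStep G c h ((eulerStep G c h)^[k] (γ 0)) - eulerStep G c h (γ (k * h))‖ +
              ‖γ (k * h + h) - eulerStep G c h (γ (k * h))‖ := by
              rw [norm_sub_rev (γ (k * h + h))]
              exact norm_sub_le_norm_sub_add_norm_sub _ _ _
          _ ≤ (1 + A * |h|) * (k * (B * |h| ^ 2) * (1 + A * |h|) ^ k) + B * |h| ^ 2 := by
              refine add_le_add (e2.trans ?_) e1
              gcongr
          _ ≤ (1 + A * |h|) * (k * (B * |h| ^ 2) * (1 + A * |h|) ^ k) +
              B * |h| ^ 2 * (1 + A * |h|) ^ (k + 1) := by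
              have : B * |h| ^ 2 ≤ B * |h| ^ 2 * (1 + A * |h|) ^ (k + 1) :=
                le_mul_of_one_le_right (by positivity) (one_le_pow₀ hone)
              linarith
          _ = ((k + 1 : ℕ) : ℝ) * (B * |h| ^ 2) * (1 + A * |h|) ^ (k + 1) := by
              push_cast; ring
    have hfin := hrec n le_rfl
    have hnh : (n : ℝ) * h = t := by rw [hh]; field_simp
    rw [hnh] at hfin
    refine hfin.trans ?_
    have hexp : (1 + A * |h|) ^ n ≤ Real.exp (A * |t|) := by
      have h1 : 1 + A * |h| ≤ Real.exp (A * |h|) := by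
        have := Real.add_one_le_exp (A * |h|); linarith
      calc (1 + A * |h|) ^ n ≤ Real.exp (A * |h|) ^ n := by gcongr
        _ = Real.exp (A * |t|) := by
          rw [← Real.exp_nat_mul, habs]
          congr 1
          field_simp
    calc (n : ℝ) * (B * |h| ^ 2) * (1 + A * |h|) ^ n
        ≤ (n : ℝ) * (B * |h| ^ 2) * Real.exp (A * |t|) := by gcongr
      _ = B * |t| ^ 2 * Real.exp (A * |t|) * (n : ℝ)⁻¹ := by
        rw [habs]; field_simp
  rw [tendsto_iff_norm_sub_tendsto_zero]
  refine squeeze_zero' (Eventually.of_forall fun _ => norm_nonneg _)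
    ((eventually_gt_atTop 0).mono fun n hn => key n hn) ?_
  simpa only [mul_zero] using
    tendsto_inv_atTop_nhds_zero_nat.const_mul (B * |t| ^ 2 * Real.exp (A * |t|))

/-- Multiply `G` by a `C^1` cutoff equal to `1` near `K` and supported in a compact subset of `V`: a
compactly supported `C^1` field is globally Lipschitz. -/
theorem exists_lipschitzWith_eqOn [FiniteDimensional ℝ F] {V K : Set F} (hV : IsOpen V)
    {G : F → F} (hG : ContDiffOn ℝ 1 G V) (hK : IsCompact K) (hKV : K ⊆ V) :
    ∃ (G' : F → F) (L : NNReal), LipschitzWith L G' ∧ EqOn G' G K := by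
  obtain ⟨K', hK', hKK', hK'V⟩ := exists_compact_between hK hV hKV
  obtain ⟨χ, h1, h0, -⟩ := exists_contMDiffMap_one_nhds_of_subset_interior
    (n := 1) (modelWithCornersSelf ℝ F) hK.isClosed hKK'
  have hχ : ContDiff ℝ 1 χ := χ.contMDiff.contDiff
  have hsupp : tsupport (fun x => χ x • G x) ⊆ K' := by
    refine closure_minimal (fun x hx => ?_) hK'.isClosed
    by_contra hxK
    exact hx (by simp [h0 x hxK])
  have hcd : ContDiff ℝ 1 (fun x => χ x • G x) := by
    refine contDiff_iff_contDiffAt.2 fun x => ?_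
    by_cases hx : x ∈ V
    · exact hχ.contDiffAt.smul (hG.contDiffAt (hV.mem_nhds hx))
    · have hx' : x ∉ tsupport (fun x => χ x • G x) := fun h => hx (hK'V (hsupp h))
      exact contDiffAt_const.congr_of_eventuallyEq (notMem_tsupport_iff_eventuallyEq.1 hx')
  obtain ⟨L, hL⟩ := hcd.lipschitzWith_of_hasCompactSupport (𝕂 := ℝ)
    (HasCompactSupport.of_support_subset_isCompact hK' ((subset_tsupport _).trans hsupp))
    one_ne_zero
  refine ⟨_, L, hL, fun x hx => ?_⟩
  simp [h1.self_of_nhdsSet x hx]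

/-- A `C^1` field on an open set is, on each compact subset, eventually equal to the terms of a
sequence of globally Lipschitz fields. -/
theorem exists_seq_lipschitzWith [FiniteDimensional ℝ F] {V : Set F} (hV : IsOpen V)
    {G : F → F} (hG : ContDiffOn ℝ 1 G V) :
    ∃ G' : ℕ → F → F, (∀ j, ∃ L, LipschitzWith L (G' j)) ∧
      ∀ K, IsCompact K → K ⊆ V → ∀ᶠ j in atTop, EqOn (G' j) G K := by
  have : LocallyCompactSpace V := hV.locallyCompactSpace
  let Q := CompactExhaustion.choice V
  choose G' hG' using fun j => exists_lipschitzWith_eqOn hV hG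
    ((Q.isCompact j).image continuous_subtype_val) (Subtype.coe_image_subset V (Q j))
  refine ⟨G', fun j => ⟨_, (hG' j).choose_spec.1⟩, fun K hK hKV => ?_⟩
  have hK' : IsCompact ((Subtype.val : V → F) ⁻¹' K) := by
    rw [Subtype.isCompact_iff]
    simpa [Subtype.image_preimage_coe, inter_eq_right.2 hKV] using hK
  obtain ⟨n, hn⟩ := Q.exists_superset_of_isCompact hK'
  filter_upwards [eventually_ge_atTop n] with j hj x hx
  exact (hG' j).choose_spec.2 ⟨⟨x, hKV hx⟩, Q.subset hj (hn hx), rfl⟩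

/-- The arc traversed between times `0` and `t` is compact in `V`, so for large `j` the truncated
field agrees with `G` along it and the curve solves the truncated system there. -/
theorem IsSolution.tendsto {V : Set F} {G : F → F} {c : ℝ} {γ : ℝ → F × F}
    (hγ : IsSolution V G c γ) {G' : ℕ → F → F} (hG' : ∀ j, ∃ L, LipschitzWith L (G' j))
    (hK : ∀ K, IsCompact K → K ⊆ V → ∀ᶠ j in atTop, EqOn (G' j) G K) (t : ℝ) :
    ∀ᶠ j in atTop, Tendsto (fun n : ℕ => (eulerStep (G' j) c (t / n))^[n] (γ 0)) atTop
      (𝓝 (γ t)) := by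
  have hc : IsCompact ((fun s => (γ s).1) '' uIcc 0 t) :=
    isCompact_uIcc.image hγ.continuous.fst
  filter_upwards [hK _ hc (by rintro _ ⟨s, -, rfl⟩; exact (hγ s).1)] with j hj
  obtain ⟨L, hL⟩ := hG' j
  refine tendsto_eulerStep_iterate hL fun s hs => ?_
  rw [hj ⟨s, hs, rfl⟩]
  exact (hγ s).2

/-- Both solutions are limits of the same numerical iterates. -/
theorem IsSolution.eq_of_eq_zero [FiniteDimensional ℝ F] {V : Set F} (hV : IsOpen V)
    {G : F → F} (hG : ContDiffOn ℝ 1 G V) {c : ℝ} {γ γ' : ℝ → F × F}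
    (hγ : IsSolution V G c γ) (hγ' : IsSolution V G c γ') (h0 : γ 0 = γ' 0) : γ = γ' := by
  obtain ⟨G', hL, hK⟩ := exists_seq_lipschitzWith hV hG
  funext t
  obtain ⟨j, h1, h2⟩ := ((hγ.tendsto hL hK t).and (hγ'.tendsto hL hK t)).exists
  rw [h0] at h1
  exact tendsto_nhds_unique h1 h2

variable [FiniteDimensional ℝ F] [MeasurableSpace F] [BorelSpace F]

/-- Solutions depend measurably on time and initial condition. -/
theorem measurable_solution {X : Type*} [MeasurableSpace X] {V : Set F} (hV : IsOpen V)
    {G : F → F} (hG : ContDiffOn ℝ 1 G V) {c : ℝ} {i : X → F × F} (hi : Measurable i)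
    {Φ : X → ℝ → F × F} (h0 : ∀ x, Φ x 0 = i x) (hΦ : ∀ x, IsSolution V G c (Φ x)) :
    Measurable fun z : ℝ × X => Φ z.2 z.1 := by
  obtain ⟨G', hL, hK⟩ := exists_seq_lipschitzWith hV hG
  -- Convergence in `n` is not needed here: `limUnder` of measurable functions is measurable even
  -- where it takes its default value. For each `z` only large `j` matter, and there the limit
  -- exists.
  have hm : ∀ j, StronglyMeasurable fun z : ℝ × X =>
      limUnder atTop fun n : ℕ => (eulerStep (G' j) c (z.1 / n))^[n] (i z.2) := by
    intro j
    refine StronglyMeasurable.limUnder fun n => Measurable.stronglyMeasurable ?_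
    obtain ⟨L, hL⟩ := hL j
    have hGm : Measurable (G' j) := hL.continuous.measurable
    have : ∀ k : ℕ, Measurable fun z : ℝ × X =>
        (eulerStep (G' j) c (z.1 / n))^[k] (i z.2) := by
      intro k
      induction k with
      | zero => exact hi.comp measurable_snd
      | succ k ih =>
        simp only [Function.iterate_succ_apply']
        unfold eulerStep
        fun_prop
    exact this n
  refine measurable_of_tendsto_metrizable (fun j => (hm j).measurable)
    (tendsto_pi_nhds.2 fun z => ?_)
  refine tendsto_const_nhds.congr' ?_
  filter_upwards [(hΦ z.2).tendsto hL hK z.1] with j hj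
  rw [h0] at hj
  exact hj.limUnder_eq.symm

/-- The time `t` map does not increase volumes. -/
theorem volume_solution_preimage_le {V : Set F} (hV : IsOpen V)
    {G : F → F} (hG : ContDiffOn ℝ 1 G V) {c : ℝ} {Φ : F × F → ℝ → F × F}
    (h0 : ∀ x, x.1 ∈ V → Φ x 0 = x) (hΦ : ∀ x, x.1 ∈ V → IsSolution V G c (Φ x)) (t : ℝ)
    (B : Set (F × F)) :
    ((volume : Measure F).prod volume) {x | x.1 ∈ V ∧ Φ x t ∈ B} ≤
      ((volume : Measure F).prod volume) B := by
  set μ : Measure (F × F) := (volume : Measure F).prod volume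
  -- For open `W` the indicator is lower semicontinuous, so its value at the solution is at most the
  -- iterated `liminf` of its values along the scheme. Fatou's lemma, used once for `n` and once for
  -- `j`, gives the bound.
  have hopen : ∀ W : Set (F × F), IsOpen W → μ {x | x.1 ∈ V ∧ Φ x t ∈ W} ≤ μ W := by
    intro W hW
    obtain ⟨G', hL, hK⟩ := exists_seq_lipschitzWith hV hG
    let S : ℕ → ℕ → F × F → F × F := fun j n => (eulerStep (G' j) c (t / n))^[n]
    have hS : ∀ j n, MeasurePreserving (S j n) μ μ := by
      intro j n
      obtain ⟨L, hL⟩ := hL j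
      exact (measurePreserving_eulerStep hL.continuous.measurable c _).iterate n
    have hint : ∀ j n, ∫⁻ x, W.indicator 1 (S j n x) ∂μ = μ W := by
      intro j n
      rw [(hS j n).lintegral_comp (measurable_one.indicator hW.measurableSet),
        lintegral_indicator_one hW.measurableSet]
    have hpt : ∀ x, x.1 ∈ V → Φ x t ∈ W →
        1 ≤ liminf (fun j => liminf (fun n => W.indicator (1 : F × F → ℝ≥0∞) (S j n x)) atTop)
          atTop := by
      intro x hx hxW
      refine le_liminf_of_le (by isBoundedDefault) ?_
      filter_upwards [(hΦ x hx).tendsto hL hK t] with j hj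
      refine le_liminf_of_le (by isBoundedDefault) ?_
      rw [h0 x hx] at hj
      filter_upwards [hj.eventually (hW.mem_nhds hxW)] with n hn
      exact (indicator_of_mem hn (1 : F × F → ℝ≥0∞)).ge
    have hmeas : ∀ j n, Measurable fun x => W.indicator (1 : F × F → ℝ≥0∞) (S j n x) :=
      fun j n => (measurable_one.indicator hW.measurableSet).comp (hS j n).measurable
    have hmeas' : ∀ j, Measurable fun x =>
        liminf (fun n => W.indicator (1 : F × F → ℝ≥0∞) (S j n x)) atTop :=
      fun j => Measurable.liminf (hmeas j)
    calc μ {x | x.1 ∈ V ∧ Φ x t ∈ W}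
        ≤ μ {x | 1 ≤ liminf (fun j => liminf (fun n =>
            W.indicator (1 : F × F → ℝ≥0∞) (S j n x)) atTop) atTop} :=
          measure_mono fun x hx => hpt x hx.1 hx.2
      _ ≤ ∫⁻ x, liminf (fun j => liminf (fun n => W.indicator (1 : F × F → ℝ≥0∞) (S j n x))
            atTop) atTop ∂μ := by
          simpa using mul_meas_ge_le_lintegral (μ := μ) (Measurable.liminf hmeas') 1
      _ ≤ liminf (fun j => ∫⁻ x, liminf (fun n => W.indicator (1 : F × F → ℝ≥0∞) (S j n x))
            atTop ∂μ) atTop :=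
          lintegral_liminf_le hmeas'
      _ ≤ liminf (fun _ : ℕ => μ W) atTop := by
          refine liminf_le_liminf (Eventually.of_forall fun j => ?_)
          refine (lintegral_liminf_le (hmeas j)).trans ?_
          simp [hint]
      _ = μ W := by simp
  -- Outer regularity extends the bound to every set, measurable or not.
  rw [Set.measure_eq_iInf_isOpen B]
  refine le_iInf₂ fun W hBW => le_iInf fun hW => ?_
  exact (measure_mono (show {x : F × F | x.1 ∈ V ∧ Φ x t ∈ B} ⊆ {x | x.1 ∈ V ∧ Φ x t ∈ W} from
    fun x hx => ⟨hx.1, hBW hx.2⟩)).trans (hopen W hW)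

end SymplecticEuler

end DHMC

end

noncomputable section

namespace DHMC

namespace Model

variable (S : Model)

/-! ### The Hamiltonian flow -/

/-- Lebesgue measure on `V N`. -/
def volV (N : ℕ) : Measure (S.V N) := Measure.comap Subtype.val volume

theorem measurableEmbedding_coe (N : ℕ) : MeasurableEmbedding (Subtype.val : S.V N → E (S.d N)) :=
  MeasurableEmbedding.subtype_coe (S.V_open N).measurableSet

theorem map_coe_volV (N : ℕ) : (S.volV N).map Subtype.val = volume.restrict (S.V N) :=
  map_comap_subtype_coe (S.V_open N).measurableSet _

instance (N : ℕ) : SigmaFinite (S.volV N) := by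
  have h : SigmaFinite ((S.volV N).map Subtype.val) := by
    rw [S.map_coe_volV]; infer_instance
  exact SigmaFinite.of_map _ measurable_subtype_coe.aemeasurable h

/-- The inclusion is a measurable embedding, so no measurability of `B` is required; volume bounds
in the ambient space transfer to `V N` through this identity. -/
theorem volV_prod_apply (N : ℕ) {T : Type*} [MeasurableSpace T] (τ : Measure T) [SFinite τ]
    (B : Set (S.V N × T)) :
    ((S.volV N).prod τ) B =
      ((volume : Measure (E (S.d N))).prod τ) (Prod.map Subtype.val id '' B) := by
  have he : MeasurableEmbedding (Prod.map Subtype.val id : S.V N × T → E (S.d N) × T) :=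
    (S.measurableEmbedding_coe N).prodMap MeasurableEmbedding.id
  have hmap : ((S.volV N).prod τ).map (Prod.map Subtype.val id) =
      ((volume : Measure (E (S.d N))).prod τ).restrict (S.V N ×ˢ univ) := by
    rw [← Measure.map_prod_map _ _ measurable_subtype_coe measurable_id, S.map_coe_volV,
      Measure.map_id, ← Measure.prod_restrict, Measure.restrict_univ]
  have h1 : (((S.volV N).prod τ).map (Prod.map Subtype.val id))
      (Prod.map Subtype.val id '' B) = ((S.volV N).prod τ) B := by
    rw [he.map_apply, preimage_image_eq _ he.injective]
  rw [← h1, hmap, Measure.restrict_apply' ((S.V_open N).measurableSet.prod .univ),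
    inter_eq_left.2]
  rintro _ ⟨x, -, rfl⟩
  exact ⟨x.1.2, mem_univ _⟩

theorem contDiffOn_gradient (N : ℕ) : ContDiffOn ℝ 1 (gradient (S.U N)) (S.V N) := by
  have h : ContDiffOn ℝ 1 (fderiv ℝ (S.U N)) (S.V N) :=
    (S.U_smooth N).fderiv_of_isOpen (S.V_open N) (by norm_num)
  exact (InnerProductSpace.toDual ℝ (E (S.d N))).symm.contDiff.comp_contDiffOn h

/-- The Hamiltonian trajectory in the ambient space. -/
def orbit (N : ℕ) (x : S.V N × E (S.d N)) (t : ℝ) : E (S.d N) × E (S.d N) :=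
  ((S.flow N t x.1 x.2).1.1, (S.flow N t x.1 x.2).2)

theorem isSolution_orbit (N : ℕ) (x : S.V N × E (S.d N)) :
    IsSolution (S.V N) (gradient (S.U N)) S.m⁻¹ (S.orbit N x) :=
  (S.complete N x.1.1 x.1.2 x.2).choose_spec.2

theorem orbit_zero (N : ℕ) (x : S.V N × E (S.d N)) : S.orbit N x 0 = (x.1.1, x.2) :=
  (S.complete N x.1.1 x.1.2 x.2).choose_spec.1

/-- `flow` is made from chosen solutions; uniqueness identifies the choice with any explicit
candidate, which yields the group law and time reversal. -/
theorem orbit_eq (N : ℕ) (x : S.V N × E (S.d N)) {γ : ℝ → E (S.d N) × E (S.d N)}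
    (hγ : IsSolution (S.V N) (gradient (S.U N)) S.m⁻¹ γ) (h0 : γ 0 = (x.1.1, x.2)) :
    S.orbit N x = γ :=
  (S.isSolution_orbit N x).eq_of_eq_zero (S.V_open N) (S.contDiffOn_gradient N) hγ
    ((S.orbit_zero N x).trans h0.symm)

theorem flow_ext {N : ℕ} {y z : S.V N × E (S.d N)} (h : (y.1.1, y.2) = (z.1.1, z.2)) : y = z := by
  rw [Prod.mk.injEq] at h
  exact Prod.ext (Subtype.ext h.1) h.2

@[simp]
theorem flow_zero (N : ℕ) (q : S.V N) (p : E (S.d N)) : S.flow N 0 q p = (q, p) :=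
  S.flow_ext (S.orbit_zero N (q, p))

theorem flow_add (N : ℕ) (s t : ℝ) (q : S.V N) (p : E (S.d N)) :
    S.flow N (s + t) q p = S.flow N s (S.flow N t q p).1 (S.flow N t q p).2 := by
  refine S.flow_ext ?_
  have h := S.orbit_eq N (S.flow N t q p) (γ := fun s => S.orbit N (q, p) (s + t))
    (fun s => ⟨(S.isSolution_orbit N (q, p) (s + t)).1,
      (S.isSolution_orbit N (q, p) (s + t)).2.comp_add_const s t⟩) (by simp [orbit])
  exact (congrFun h s).symm

/-- Reversing time and negating `p` turns solutions into solutions. -/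
theorem flow_neg (N : ℕ) (t : ℝ) (q : S.V N) (p : E (S.d N)) :
    S.flow N t q (-p) = ((S.flow N (-t) q p).1, -(S.flow N (-t) q p).2) := by
  refine S.flow_ext ?_
  have h := S.orbit_eq N (q, -p)
    (γ := fun s => ((S.orbit N (q, p) (-s)).1, -(S.orbit N (q, p) (-s)).2))
    (fun s => ⟨(S.isSolution_orbit N (q, p) (-s)).1, ?_⟩) (by simp [orbit])
  · exact congrFun h t
  · have h1 := (S.isSolution_orbit N (q, p) (-s)).2
    have h2 := h1.scomp s (hasDerivAt_neg s)
    have h3 : HasDerivAt (fun s => (S.orbit N (q, p) (-s)).1) _ s :=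
      (ContinuousLinearMap.fst ℝ (E (S.d N)) (E (S.d N))).hasFDerivAt.comp_hasDerivAt s h2
    have h4 : HasDerivAt (fun s => (S.orbit N (q, p) (-s)).2) _ s :=
      (ContinuousLinearMap.snd ℝ (E (S.d N)) (E (S.d N))).hasFDerivAt.comp_hasDerivAt s h2
    refine (h3.prodMk h4.neg).congr_deriv ?_
    simp

theorem measurable_flow (N : ℕ) :
    Measurable fun z : ℝ × (S.V N × E (S.d N)) => S.flow N z.1 z.2.1 z.2.2 := by
  have h := measurable_solution (S.V_open N) (S.contDiffOn_gradient N) (c := S.m⁻¹)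
    (i := fun x : S.V N × E (S.d N) => (x.1.1, x.2)) (by fun_prop) (S.orbit_zero N)
    (S.isSolution_orbit N)
  exact h.fst.subtype_mk.prodMk h.snd

theorem measurePreserving_flow (N : ℕ) (t : ℝ) :
    MeasurePreserving (fun x : S.V N × E (S.d N) => S.flow N t x.1 x.2)
      ((S.volV N).prod volume) ((S.volV N).prod volume) := by
  have hm : ∀ t, Measurable fun x : S.V N × E (S.d N) => S.flow N t x.1 x.2 := fun t =>
    (S.measurable_flow N).comp (measurable_const.prodMk measurable_id)
  have hle : ∀ (t : ℝ) (B : Set (S.V N × E (S.d N))),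
      ((S.volV N).prod volume) ((fun x => S.flow N t x.1 x.2) ⁻¹' B) ≤
        ((S.volV N).prod volume) B := by
    intro t B
    classical
    rw [S.volV_prod_apply, S.volV_prod_apply]
    refine le_trans (measure_mono ?_) (volume_solution_preimage_le (S.V_open N)
      (S.contDiffOn_gradient N) (c := S.m⁻¹)
      -- Off `V N` the value is arbitrary, since the volume bound only concerns starting points over
      -- `V N`.
      (Φ := fun x => if h : x.1 ∈ S.V N then S.orbit N (⟨x.1, h⟩, x.2) else fun _ => 0)
      (fun x hx => ?_) (fun x hx => ?_) t _)
    · rintro _ ⟨x, hx, rfl⟩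
      refine ⟨x.1.2, S.flow N t x.1 x.2, hx, ?_⟩
      simp [orbit, Prod.map]
    · simp [hx, orbit_zero]
    · simpa [hx] using S.isSolution_orbit N (⟨x.1, hx⟩, x.2)
  refine ⟨hm t, Measure.ext fun B hB => ?_⟩
  rw [Measure.map_apply (hm t) hB]
  refine le_antisymm (hle t B) ?_
  -- The reverse inequality is the same bound for the inverse map, applied to the preimage of `B`.
  refine le_trans (le_of_eq ?_) (hle (-t) ((fun x => S.flow N t x.1 x.2) ⁻¹' B))
  congr 1
  ext x
  simp only [mem_preimage]
  rw [← S.flow_add]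
  simp

/-- Along an orbit the derivative of `U + K` is `⟨∇U, p / m⟩ - ⟨p, ∇U⟩ / m = 0`; the additive
constant of `ham` plays no role. -/
theorem energy_flow (N : ℕ) (t : ℝ) (q : S.V N) (p : E (S.d N)) :
    S.ham N (S.flow N t q p).1 (S.flow N t q p).2 = S.ham N q p := by
  have hm := S.m_pos.ne'
  set γ := S.orbit N (q, p) with hγ
  have hsol := S.isSolution_orbit N (q, p)
  have hder : ∀ s, HasDerivAt (fun s => S.U N (γ s).1 + S.kin (γ s).2) 0 s := by
    intro s
    have h1 := (hsol s).2
    have hU : HasFDerivAt (S.U N) (fderiv ℝ (S.U N) (γ s).1) (γ s).1 :=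
      ((((S.U_smooth N).contDiffAt ((S.V_open N).mem_nhds (hsol s).1)).differentiableAt
        (by norm_num)).hasFDerivAt)
    have h5 : HasDerivAt (fun s => (γ s).1) _ s :=
      (ContinuousLinearMap.fst ℝ (E (S.d N)) (E (S.d N))).hasFDerivAt.comp_hasDerivAt s h1
    have h6 : HasDerivAt (fun s => (γ s).2) _ s :=
      (ContinuousLinearMap.snd ℝ (E (S.d N)) (E (S.d N))).hasFDerivAt.comp_hasDerivAt s h1
    have h2 := hU.comp_hasDerivAt s h5
    have h3 := h6.norm_sq.div_const (2 * S.m)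
    have h4 := h2.add h3
    refine h4.congr_deriv ?_
    have : fderiv ℝ (S.U N) (γ s).1 (S.m⁻¹ • (γ s).2) =
        inner ℝ (gradient (S.U N) (γ s).1) (S.m⁻¹ • (γ s).2) := by
      simp [gradient]
    change fderiv ℝ (S.U N) (γ s).1 (S.m⁻¹ • (γ s).2) + 2 * inner ℝ (γ s).2
      (-gradient (S.U N) (γ s).1) / (2 * S.m) = 0
    rw [this, inner_smul_right, inner_neg_right, real_inner_comm]
    field_simp
    ring
  have hconst := is_const_of_deriv_eq_zero (fun s => (hder s).differentiableAt)
    (fun s => (hder s).deriv) t 0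
  have h0 : γ 0 = (q.1, p) := S.orbit_zero N (q, p)
  simp only [h0] at hconst
  unfold ham
  rw [← hconst]
  rfl

end Model

/-! ### Splitting the coordinates -/

section Split

variable {a b : ℕ}

theorem head_append (h : a ≤ b) (x : E a) (y : E (b - a)) : head h (append x y) = x := by
  ext i
  simp [head, append]

theorem tail_append (x : E a) (y : E (b - a)) : tail a (append x y) = y := by
  ext j
  simp [tail, append]

theorem append_head_tail (h : a ≤ b) (x : E b) : append (head h x) (tail a x) = x := by
  ext i
  by_cases hi : (i : ℕ) < a
  · simp [append, head, hi]
  · have : a + ((i : ℕ) - a) = i := by omega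
    simp [append, tail, hi, this]

theorem head_neg (h : a ≤ b) (x : E b) : head h (-x) = -head h x := rfl

theorem tail_neg (x : E b) : tail a (-x) = -tail a x := rfl

theorem append_neg (x : E a) (y : E (b - a)) : append (-x) (-y) = -append x y := by
  ext i
  by_cases hi : (i : ℕ) < a <;> simp [append, hi]

theorem measurable_append {X : Type*} [MeasurableSpace X] {f : X → E a} {g : X → E (b - a)}
    (hf : Measurable f) (hg : Measurable g) : Measurable fun x => append (f x) (g x) := by
  refine (WithLp.measurable_toLp 2 _).comp (measurable_pi_lambda _ fun i => ?_)
  by_cases hi : (i : ℕ) < a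
  · simp only [hi, dite_true]; fun_prop
  · simp only [hi, dite_false]; fun_prop

theorem measurable_head (h : a ≤ b) : Measurable (head h) := by
  unfold head; fun_prop

theorem measurable_tail : Measurable (tail a : E b → E (b - a)) := by
  unfold tail; fun_prop

theorem measurePreserving_append (h : a ≤ b) :
    MeasurePreserving (fun x : E a × E (b - a) => append x.1 x.2)
      ((volume : Measure (E a)).prod (volume : Measure (E (b - a)))) (volume : Measure (E b)) := by
  let e : Fin a ⊕ Fin (b - a) ≃ Fin b :=
    finSumFinEquiv.trans (finCongr (Nat.add_sub_cancel' h))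
  have h1 := (PiLp.volume_preserving_ofLp (Fin a)).prod (PiLp.volume_preserving_ofLp (Fin (b - a)))
  have h2 := volume_measurePreserving_sumPiEquivProdPi_symm (fun _ : Fin a ⊕ Fin (b - a) => ℝ)
  have h3 := volume_measurePreserving_piCongrLeft (fun _ : Fin b => ℝ) e
  have h4 := PiLp.volume_preserving_toLp (Fin b)
  have h5 := h4.comp (h3.comp (h2.comp h1))
  convert! h5 using 1
  funext x
  ext i
  obtain ⟨j, rfl⟩ := e.surjective i
  simp only [Function.comp, MeasurableEquiv.coe_piCongrLeft, Equiv.piCongrLeft_apply_apply]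
  rcases j with j | j
  · simp [append, e, MeasurableEquiv.sumPiEquivProdPi]
  · simp [append, e, MeasurableEquiv.sumPiEquivProdPi]

end Split

/-! ### Measurability on sigma types and of parametrized mixtures -/

section Sigma

variable {ι : Type*} {α : ι → Type*} [∀ i, MeasurableSpace (α i)]

theorem measurableSet_sigma_iff {s : Set (Sigma α)} :
    MeasurableSet s ↔ ∀ i, MeasurableSet (Sigma.mk i ⁻¹' s) := by
  simp only [MeasurableSpace.measurableSet_iInf]
  rfl

theorem measurable_sigmaMk (i : ι) : Measurable (Sigma.mk i : α i → Sigma α) :=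
  fun _ hs => measurableSet_sigma_iff.1 hs i

theorem measurable_sigma {β : Type*} [MeasurableSpace β] {f : Sigma α → β}
    (hf : ∀ i, Measurable fun x : α i => f ⟨i, x⟩) : Measurable f :=
  fun _ hs => measurableSet_sigma_iff.2 fun i => hf i hs

theorem measurableEmbedding_sigmaMk (i : ι) :
    MeasurableEmbedding (Sigma.mk i : α i → Sigma α) where
  injective := sigma_mk_injective
  measurable := measurable_sigmaMk i
  measurableSet_image' := by
    intro s hs
    refine measurableSet_sigma_iff.2 fun j => ?_
    by_cases h : j = i
    · subst h
      rwa [preimage_image_eq _ sigma_mk_injective]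
    · convert MeasurableSet.empty
      ext x
      simp only [mem_preimage, mem_image, mem_empty_iff_false, iff_false]
      rintro ⟨y, -, hy⟩
      exact h (congrArg Sigma.fst hy).symm

/-- `X × Sigma α` is the countable union of the measurably embedded pieces `X × α i`, so
measurability can be tested on each piece. -/
theorem measurable_prod_sigma [Countable ι] {β X : Type*} [MeasurableSpace β] [MeasurableSpace X]
    {f : X × Sigma α → β} (hf : ∀ i, Measurable fun z : X × α i => f (z.1, ⟨i, z.2⟩)) :
    Measurable f := by
  intro s hs
  have h : f ⁻¹' s = ⋃ i, Prod.map id (Sigma.mk i) ''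
      ((fun z : X × α i => f (z.1, ⟨i, z.2⟩)) ⁻¹' s) := by
    ext ⟨x, i, y⟩
    simp only [mem_preimage, mem_iUnion, mem_image]
    constructor
    · intro h
      exact ⟨i, (x, y), h, rfl⟩
    · rintro ⟨j, ⟨x', y'⟩, h, he⟩
      rw [← he]
      exact h
  rw [h]
  exact MeasurableSet.iUnion fun i =>
    (MeasurableEmbedding.id.prodMap (measurableEmbedding_sigmaMk i)).measurableSet_image.2 (hf i hs)

end Sigma

section Mixtures

variable {X Y Z : Type*} [MeasurableSpace X] [MeasurableSpace Y] [MeasurableSpace Z]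

theorem measurable_lintegral_param {κ : X → Measure Y} (hκ : Measurable κ)
    (hp : ∀ x, IsProbabilityMeasure (κ x)) {f : X → Y → ℝ≥0∞}
    (hf : Measurable (Function.uncurry f)) : Measurable fun x => ∫⁻ y, f x y ∂κ x := by
  let K : Kernel X Y := ⟨κ, hκ⟩
  have : IsMarkovKernel K := ⟨hp⟩
  exact Measurable.lintegral_kernel_prod_right' (κ := K) hf

theorem measurable_bind_param {κ : X → Measure Y} (hκ : Measurable κ)
    (hp : ∀ x, IsProbabilityMeasure (κ x)) {η : X → Y → Measure Z}
    (hη : Measurable (Function.uncurry η)) : Measurable fun x => (κ x).bind (η x) := by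
  refine Measure.measurable_of_measurable_coe _ fun s hs => ?_
  have hx : ∀ x, (κ x).bind (η x) s = ∫⁻ y, η x y s ∂κ x := fun x =>
    Measure.bind_apply hs hη.of_uncurry_left.aemeasurable
  simp only [hx]
  exact measurable_lintegral_param hκ hp ((Measure.measurable_coe hs).comp hη)

theorem measurable_map_param {κ : X → Measure Y} (hκ : Measurable κ)
    (hp : ∀ x, IsProbabilityMeasure (κ x)) {f : X → Y → Z}
    (hf : Measurable (Function.uncurry f)) : Measurable fun x => (κ x).map (f x) := by
  have h : ∀ x, (κ x).map (f x) = (κ x).bind fun y => Measure.dirac (f x y) := fun x =>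
    (Measure.bind_dirac_eq_map (κ x) hf.of_uncurry_left).symm
  simp only [h]
  exact measurable_bind_param hκ hp (Measure.measurable_dirac.comp hf)

theorem isProbabilityMeasure_bind {κ : Measure Y} [IsProbabilityMeasure κ] {η : Y → Measure Z}
    (hη : Measurable η) (hp : ∀ y, IsProbabilityMeasure (η y)) :
    IsProbabilityMeasure (κ.bind η) := by
  constructor
  rw [Measure.bind_apply .univ hη.aemeasurable]
  simp [(hp _).measure_univ]

end Mixtures

namespace Model

variable (S : Model)

/-! ### Measurability of the dynamics -/

section Measurability

variable {X : Type*} [MeasurableSpace X] {N : ℕ}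

theorem measurable_flow_comp {t : X → ℝ} {q : X → S.V N} {p : X → E (S.d N)} (ht : Measurable t)
    (hq : Measurable q) (hp : Measurable p) : Measurable fun x => S.flow N (t x) (q x) (p x) :=
  (S.measurable_flow N).comp (ht.prodMk (hq.prodMk hp))

theorem measurable_ham {q : X → S.V N} {p : X → E (S.d N)} (hq : Measurable q)
    (hp : Measurable p) : Measurable fun x => S.ham N (q x) (p x) := by
  have hU : Measurable fun q : S.V N => S.U N q :=
    (S.U_smooth N).continuousOn.domRestrict.measurable
  have := hU.comp hq
  unfold ham kin
  exact (this.add (by fun_prop)).add_const _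

theorem measurable_rho {q p : X → E (S.d N)} {r s : X → E (S.d (N + 1) - S.d N)}
    (hq : Measurable q) (hp : Measurable p) (hr : Measurable r) (hs : Measurable s) :
    Measurable fun x => S.ρ N (q x) (p x) (r x) (s x) :=
  (S.ρ_measurable N).comp ((hq.prodMk hp).prodMk (hr.prodMk hs))

/-- `U (N + 1)` is controlled only on `V (N + 1)`, hence the hypothesis `hV`. For the same reason
acceptance and jumps are treated on subtypes below. -/
theorem measurable_barrierUp {q : X → S.V N} {p : X → E (S.d N)}
    {r s : X → E (S.d (N + 1) - S.d N)} (hq : Measurable q) (hp : Measurable p)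
    (hr : Measurable r) (hs : Measurable s) (hV : ∀ x, append (q x).1 (r x) ∈ S.V (N + 1)) :
    Measurable fun x => S.barrierUp N (q x) (p x) (r x) (s x) := by
  have h1 : Measurable fun x => (⟨append (q x).1 (r x), hV x⟩ : S.V (N + 1)) :=
    (measurable_append (measurable_subtype_coe.comp hq) hr).subtype_mk
  have h2 := S.measurable_ham h1 (measurable_append hp hs)
  have h3 := S.measurable_ham hq hp
  have h4 := S.measurable_rho (measurable_subtype_coe.comp hq) hp hr hs
  unfold barrierUp
  exact (h2.sub h3).coe_real_ereal.add
    (measurable_const.mul (Measurable.ennreal_log h4.ennreal_ofReal))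

theorem measurable_barrierDown {q : X → S.V (N + 1)} {p : X → E (S.d (N + 1))}
    (hq : Measurable q) (hp : Measurable p) :
    Measurable fun x => S.barrierDown N (q x) (p x) := by
  have hq' : Measurable fun x => (q x).1 := measurable_subtype_coe.comp hq
  have h1 : Measurable fun x => (⟨head (S.d_le N) (q x).1, S.head_mem N (q x)⟩ : S.V N) :=
    ((measurable_head _).comp hq').subtype_mk
  have h2 := S.measurable_ham h1 ((measurable_head (S.d_le N)).comp hp)
  have h3 := S.measurable_ham hq hp
  have h4 := S.measurable_rho ((measurable_head (S.d_le N)).comp hq')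
    ((measurable_head (S.d_le N)).comp hp) (measurable_tail.comp hq') (measurable_tail.comp hp)
  unfold barrierDown
  simp only [sub_eq_add_neg (G := EReal)]
  exact (h2.sub h3).coe_real_ereal.add
    (measurable_const.mul (Measurable.ennreal_log h4.ennreal_ofReal)).neg

theorem measurable_sgn : Measurable sgn :=
  Measurable.ite measurableSet_Iio measurable_const measurable_const

theorem measurable_crossed {a : X → ℝ} {δ : X → EReal} (ha : Measurable a) (hδ : Measurable δ) :
    Measurable fun x => S.crossed (a x) (δ x) := by
  have := measurable_sgn.comp ha
  unfold crossed
  exact this.mul ((by fun_prop : Measurable fun x => |a x|).sub (hδ.ereal_toReal.const_mul _))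

/-- The proposal `w` to raise the index is accepted. -/
def AcceptUp (N : ℕ) (q : S.V N) (p : E (S.d N)) (a : ℝ)
    (w : E (S.d (N + 1) - S.d N) × E (S.d (N + 1) - S.d N)) : Prop :=
  append q.1 w.1 ∈ S.V (N + 1) ∧ S.barrierUp N q p w.1 w.2 ≤ (S.kinN a : EReal)

theorem measurableSet_append_mem {q : X → S.V N} {r : X → E (S.d (N + 1) - S.d N)}
    (hq : Measurable q) (hr : Measurable r) :
    MeasurableSet {x | append (q x).1 (r x) ∈ S.V (N + 1)} :=
  measurable_append (measurable_subtype_coe.comp hq) hr (S.V_open (N + 1)).measurableSet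

theorem measurableSet_acceptUp {q : X → S.V N} {p : X → E (S.d N)} {a : X → ℝ}
    {w : X → E (S.d (N + 1) - S.d N) × E (S.d (N + 1) - S.d N)} (hq : Measurable q)
    (hp : Measurable p) (ha : Measurable a) (hw : Measurable w) :
    MeasurableSet {x | S.AcceptUp N (q x) (p x) (a x) (w x)} := by
  set D := {x | append (q x).1 (w x).1 ∈ S.V (N + 1)} with hD
  have hDm : MeasurableSet D := S.measurableSet_append_mem hq hw.fst
  have hc : Measurable (Subtype.val : D → X) := measurable_subtype_coe
  have h1 : Measurable fun x : D => S.barrierUp N (q x) (p x) (w x).1 (w x).2 :=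
    S.measurable_barrierUp (hq.comp hc) (hp.comp hc) (hw.fst.comp hc) (hw.snd.comp hc)
      fun x => x.2
  have h2 : Measurable fun x : D => (S.kinN (a x) : EReal) := by
    have : Measurable fun x : D => a x := ha.comp hc
    unfold kinN
    exact Measurable.coe_real_ereal (by fun_prop)
  convert hDm.subtype_image (measurableSet_le h1 h2) using 1
  ext x
  simp only [AcceptUp, mem_ofPred_eq, mem_image, Subtype.exists, hD]
  constructor
  · rintro ⟨h, h'⟩
    exact ⟨x, h, h', rfl⟩
  · rintro ⟨y, h, h', rfl⟩
    exact ⟨h, h'⟩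

theorem jumpUp_of_accept {q : S.V N} {p : E (S.d N)} {n a : ℝ}
    {w : E (S.d (N + 1) - S.d N) × E (S.d (N + 1) - S.d N)} (h : S.AcceptUp N q p a w) :
    S.jumpUp N q p n a w = ⟨N + 1, ⟨append q.1 w.1, h.1⟩, append p w.2, n,
      S.crossed a (S.barrierUp N q p w.1 w.2)⟩ :=
  dif_pos h

theorem jumpUp_of_not_accept {q : S.V N} {p : E (S.d N)} {n a : ℝ}
    {w : E (S.d (N + 1) - S.d N) × E (S.d (N + 1) - S.d N)} (h : ¬ S.AcceptUp N q p a w) :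
    S.jumpUp N q p n a w = ⟨N, q, p, n, -a⟩ :=
  dif_neg h

theorem measurable_jumpUp {q : X → S.V N} {p : X → E (S.d N)} {n a : X → ℝ}
    {w : X → E (S.d (N + 1) - S.d N) × E (S.d (N + 1) - S.d N)} (hq : Measurable q)
    (hp : Measurable p) (hn : Measurable n) (ha : Measurable a) (hw : Measurable w) :
    Measurable fun x => S.jumpUp N (q x) (p x) (n x) (a x) (w x) := by
  classical
  have hA := S.measurableSet_acceptUp hq hp ha hw
  set A := {x | S.AcceptUp N (q x) (p x) (a x) (w x)}
  have hc : Measurable (Subtype.val : A → X) := measurable_subtype_coe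
  have hc' : Measurable (Subtype.val : (Aᶜ : Set X) → X) := measurable_subtype_coe
  have hb : Measurable fun x : A => S.barrierUp N (q x) (p x) (w x).1 (w x).2 :=
    S.measurable_barrierUp (hq.comp hc) (hp.comp hc) (hw.fst.comp hc) (hw.snd.comp hc)
      fun x => x.2.1
  have h1 : Measurable fun x : A => (⟨N + 1, ⟨append (q x).1 (w x).1, x.2.1⟩,
      append (p x) (w x).2, n x, S.crossed (a x) (S.barrierUp N (q x) (p x) (w x).1 (w x).2)⟩ :
        S.Phase) := by
    refine (measurable_sigmaMk (N + 1)).comp (Measurable.prodMk ?_ (Measurable.prodMk ?_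
      (Measurable.prodMk ?_ ?_)))
    · exact (measurable_append (measurable_subtype_coe.comp (hq.comp hc))
        (hw.fst.comp hc)).subtype_mk
    · exact measurable_append (hp.comp hc) (hw.snd.comp hc)
    · exact hn.comp hc
    · exact S.measurable_crossed (ha.comp hc) hb
  have h2 : Measurable fun x : (Aᶜ : Set X) =>
      (⟨N, q x, p x, n x, -a x⟩ : S.Phase) :=
    (measurable_sigmaMk N).comp ((hq.comp hc').prodMk ((hp.comp hc').prodMk
      ((hn.comp hc').prodMk (ha.comp hc').neg)))
  convert! Measurable.dite (s := A) h1 h2 hA using 1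
  funext x
  by_cases hx : x ∈ A
  · rw [dif_pos hx, S.jumpUp_of_accept hx]
  · rw [dif_neg hx, S.jumpUp_of_not_accept hx]

theorem measurable_jumpDown {q : X → S.V N} {p : X → E (S.d N)} {n a : X → ℝ}
    (hq : Measurable q) (hp : Measurable p) (hn : Measurable n) (ha : Measurable a) :
    Measurable fun x => S.jumpDown N (q x) (p x) (n x) (a x) := by
  have hrej : Measurable fun x => (⟨N, q x, p x, n x, -a x⟩ : S.Phase) :=
    (measurable_sigmaMk N).comp (hq.prodMk (hp.prodMk (hn.prodMk ha.neg)))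
  cases N with
  | zero => exact hrej
  | succ N =>
    have hb := S.measurable_barrierDown hq hp
    have hk : Measurable fun x => (S.kinN (a x) : EReal) := by
      unfold kinN
      exact Measurable.coe_real_ereal (by fun_prop)
    refine Measurable.ite (measurableSet_le hb hk) ?_ hrej
    refine (measurable_sigmaMk N).comp (Measurable.prodMk ?_ (Measurable.prodMk ?_
      (Measurable.prodMk hn (S.measurable_crossed ha hb))))
    · exact ((measurable_head _).comp (measurable_subtype_coe.comp hq)).subtype_mk
    · exact (measurable_head _).comp hp

end Measurability

/-! ### Transition laws as measurable families of probability measures -/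

instance (N : ℕ) (q : S.V N) (p : E (S.d N)) : IsProbabilityMeasure (S.newLaw N q p) := by
  constructor
  rw [newLaw, withDensity_apply _ .univ, Measure.restrict_univ]
  exact S.ρ_prob N q q.2 p

theorem measurable_newLaw (N : ℕ) :
    Measurable fun x : S.V N × E (S.d N) => S.newLaw N x.1 x.2 := by
  refine Measure.measurable_of_measurable_coe _ fun s hs => ?_
  simp only [newLaw, withDensity_apply _ hs]
  refine Measurable.lintegral_prod_right' (f := fun z : (S.V N × E (S.d N)) ×
      (E (S.d (N + 1) - S.d N) × E (S.d (N + 1) - S.d N)) =>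
        ENNReal.ofReal (S.ρ N z.1.1 z.1.2 z.2.1 z.2.2)) ?_
  exact (S.measurable_rho (by fun_prop) (by fun_prop) (by fun_prop)
    (by fun_prop)).ennreal_ofReal

theorem measurable_jumpUp_right (N : ℕ) (q : S.V N) (p : E (S.d N)) (n a : ℝ) :
    Measurable (S.jumpUp N q p n a) :=
  S.measurable_jumpUp measurable_const measurable_const measurable_const measurable_const
    measurable_id

instance (x : S.Phase) : IsProbabilityMeasure (S.jump x) := by
  obtain ⟨N, q, p, n, a⟩ := x
  simp only [jump]
  split_ifs
  · infer_instance
  · exact Measure.isProbabilityMeasure_map (S.measurable_jumpUp_right N q p n a).aemeasurable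

theorem measurable_jump : Measurable S.jump := by
  refine measurable_sigma fun N => ?_
  change Measurable fun x : S.V N × E (S.d N) × ℝ × ℝ => if x.2.2.2 < 0 then
    Measure.dirac (S.jumpDown N x.1 x.2.1 x.2.2.1 x.2.2.2) else
    (S.newLaw N x.1 x.2.1).map (S.jumpUp N x.1 x.2.1 x.2.2.1 x.2.2.2)
  refine Measurable.ite (measurableSet_lt (by fun_prop) measurable_const) ?_ ?_
  · exact Measure.measurable_dirac.comp (S.measurable_jumpDown (by fun_prop) (by fun_prop)
      (by fun_prop) (by fun_prop))
  · refine measurable_map_param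
      ((S.measurable_newLaw N).comp (f := fun x : S.V N × E (S.d N) × ℝ × ℝ => (x.1, x.2.1))
        (by fun_prop)) (fun x => inferInstanceAs (IsProbabilityMeasure (S.newLaw N x.1 x.2.1))) ?_
    exact S.measurable_jumpUp (by fun_prop) (by fun_prop) (by fun_prop) (by fun_prop)
      (by fun_prop)

theorem measurable_evolve : Measurable fun z : ℝ × S.Phase => S.evolve z.1 z.2 := by
  refine measurable_prod_sigma fun N => ?_
  have h := S.measurable_flow_comp (X := ℝ × (S.V N × E (S.d N) × ℝ × ℝ)) (N := N)
    (t := fun z => z.1) (q := fun z => z.2.1) (p := fun z => z.2.2.1) (by fun_prop) (by fun_prop)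
    (by fun_prop)
  have hs := measurable_sgn.comp (g := sgn) (f := fun z : ℝ × (S.V N × E (S.d N) × ℝ × ℝ) =>
    z.2.2.2.2) (by fun_prop)
  refine (measurable_sigmaMk N).comp (h.fst.prodMk (h.snd.prodMk (Measurable.prodMk ?_ ?_)))
  · exact (by fun_prop : Measurable fun z : ℝ × (S.V N × E (S.d N) × ℝ × ℝ) =>
      z.2.2.2.1).add (measurable_fst.mul (hs.div_const _))
  · fun_prop

theorem measurable_hitTime : Measurable S.hitTime := by
  refine measurable_sigma fun N => ?_
  exact Measurable.ite (measurableSet_lt (by fun_prop) measurable_const) (by fun_prop)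
    (by fun_prop)

theorem measurable_dynAux (k : ℕ) : Measurable fun z : ℝ × S.Phase => S.dynAux k z.1 z.2 := by
  induction k with
  | zero => exact Measure.measurable_dirac.comp S.measurable_evolve
  | succ k ih =>
    have hh : Measurable fun z : ℝ × S.Phase => S.hitTime z.2 :=
      S.measurable_hitTime.comp measurable_snd
    refine Measurable.ite (measurableSet_lt measurable_fst hh)
      (Measure.measurable_dirac.comp S.measurable_evolve) ?_
    refine measurable_bind_param (S.measurable_jump.comp
      (S.measurable_evolve.comp (hh.prodMk measurable_snd)))
      (fun z => inferInstanceAs (IsProbabilityMeasure (S.jump _))) ?_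
    exact ih.comp (((measurable_fst.sub hh).comp measurable_fst).prodMk measurable_snd)

theorem isProbabilityMeasure_dynAux (k : ℕ) (t : ℝ) (x : S.Phase) :
    IsProbabilityMeasure (S.dynAux k t x) := by
  induction k generalizing t x with
  | zero => unfold dynAux; infer_instance
  | succ k ih =>
    unfold dynAux
    split_ifs
    · infer_instance
    · exact isProbabilityMeasure_bind
        ((S.measurable_dynAux k).comp (measurable_const.prodMk measurable_id)) fun y => ih _ y

theorem measurable_dyn : Measurable fun z : ℝ × S.Phase => S.dyn z.1 z.2 := by
  have h1 : Measurable fun z : ℕ × (ℝ × S.Phase) => S.dynAux z.1 z.2.1 z.2.2 :=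
    measurable_from_prod_countable_right fun k => S.measurable_dynAux k
  have h2 : Measurable fun z : ℝ × S.Phase => ⌊z.1 / S.mn⌋₊ + 1 := by fun_prop
  exact h1.comp (h2.prodMk measurable_id)

instance (t : ℝ) (x : S.Phase) : IsProbabilityMeasure (S.dyn t x) :=
  S.isProbabilityMeasure_dynAux _ _ _

theorem measurable_toPos : Measurable S.toPos :=
  measurable_sigma fun N => (measurable_sigmaMk N).comp (by fun_prop :
    Measurable fun x : S.V N × E (S.d N) × ℝ × ℝ => (x.1, x.2.2.1))

/-! ### Normalization of the momentum laws and the ideal step -/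

theorem lintegral_exp_neg_kin (k : ℕ) :
    ∫⁻ p : E k, ENNReal.ofReal (Real.exp (-S.β * S.kin p)) =
      ENNReal.ofReal ((2 * S.m * Real.pi / S.β) ^ ((k : ℝ) / 2)) := by
  have hb : 0 < S.β / (2 * S.m) := div_pos S.β_pos (mul_pos two_pos S.m_pos)
  have h := GaussianFourier.integral_rexp_neg_mul_sq_norm (V := E k) hb
  have he : (fun p : E k => Real.exp (-S.β * S.kin p)) =
      fun p => Real.exp (-(S.β / (2 * S.m)) * ‖p‖ ^ 2) := by
    funext p
    unfold kin
    congr 1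
    ring
  have hpos : 0 < (2 * S.m * Real.pi / S.β) ^ ((k : ℝ) / 2) :=
    Real.rpow_pos_of_pos (div_pos (mul_pos (mul_pos two_pos S.m_pos) Real.pi_pos) S.β_pos) _
  have hval : Real.pi / (S.β / (2 * S.m)) = 2 * S.m * Real.pi / S.β := by
    have := S.β_pos.ne'
    field_simp
  rw [hval, finrank_euclideanSpace_fin] at h
  rw [← ofReal_integral_eq_lintegral_ofReal, he, h]
  · rw [he]
    -- A function that is not integrable has Bochner integral `0`, whereas the Gaussian formula
    -- gives a positive value.
    by_contra hc
    rw [integral_undef hc] at h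
    exact hpos.ne h
  · exact ae_of_all _ fun p => (Real.exp_pos _).le

instance (N : ℕ) : IsProbabilityMeasure (S.pLaw N) := by
  constructor
  have hpos : 0 < 2 * S.m * Real.pi / S.β :=
    div_pos (mul_pos (mul_pos two_pos S.m_pos) Real.pi_pos) S.β_pos
  rw [pLaw, withDensity_apply _ .univ, Measure.restrict_univ]
  simp_rw [ENNReal.ofReal_mul (Real.rpow_pos_of_pos hpos _).le]
  rw [lintegral_const_mul' _ _ ENNReal.ofReal_ne_top, lintegral_exp_neg_kin,
    ← ENNReal.ofReal_mul (Real.rpow_pos_of_pos hpos _).le, ← Real.rpow_add hpos]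
  simp

theorem lintegral_eq_add_Ioi {f : ℝ → ℝ≥0∞} (hf : Measurable f) :
    ∫⁻ a, f a = ∫⁻ s in Ioi 0, (f s + f (-s)) := by
  rw [lintegral_add_left hf, ← lintegral_add_compl f measurableSet_Ioi (μ := volume) (A := Ioi 0)]
  congr 1
  rw [compl_Ioi, setLIntegral_congr Iio_ae_eq_Iic.symm]
  have h := (Measure.measurePreserving_neg (volume : Measure ℝ)).setLIntegral_comp_preimage
    measurableSet_Iio hf (s := Iio 0)
  rw [← h]
  simp

instance : IsProbabilityMeasure S.pnLaw := by
  constructor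
  have hβ := S.β_pos
  have hmn := S.mn_pos
  have hr : 0 < S.β / S.mn := div_pos hβ hmn
  have hc : 0 ≤ (2 * S.mn / S.β)⁻¹ := by positivity
  rw [pnLaw, withDensity_apply _ .univ, Measure.restrict_univ]
  simp_rw [ENNReal.ofReal_mul hc]
  rw [lintegral_const_mul' _ _ ENNReal.ofReal_ne_top, lintegral_eq_add_Ioi (by
    unfold kinN; fun_prop)]
  have h1 : ∀ s ∈ Ioi (0 : ℝ), ENNReal.ofReal (Real.exp (-S.β * S.kinN s)) +
      ENNReal.ofReal (Real.exp (-S.β * S.kinN (-s))) =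
        2 * ENNReal.ofReal (Real.exp (-(S.β / S.mn) * s)) := by
    intro s hs
    have : S.kinN (-s) = S.kinN s := by simp [kinN]
    rw [this, ← two_mul]
    congr 3
    rw [kinN, abs_of_pos hs]
    ring
  rw [setLIntegral_congr_fun measurableSet_Ioi h1, lintegral_const_mul' _ _ (by simp),
    ← ofReal_integral_eq_lintegral_ofReal, integral_exp_mul_Ioi (by linarith)]
  · rw [show (2 : ℝ≥0∞) = ENNReal.ofReal 2 by simp, ← ENNReal.ofReal_mul (by norm_num),
      ← ENNReal.ofReal_mul hc, ← ENNReal.ofReal_one]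
    congr 1
    simp only [mul_zero, Real.exp_zero]
    field_simp
  · exact integrableOn_exp_mul_Ioi (by linarith) 0
  · exact ae_of_all _ fun p => (Real.exp_pos _).le

theorem measurable_idealStep : Measurable fun z : ℝ × S.Pos => S.idealStep z.1 z.2 := by
  refine measurable_prod_sigma fun N => ?_
  refine (Measure.measurable_map _ S.measurable_toPos).comp ?_
  refine measurable_bind_param (κ := fun _ : ℝ × (S.V N × ℝ) => (S.pLaw N).prod S.pnLaw)
    measurable_const (fun _ => inferInstance) (η := fun z ψ =>
      S.dyn z.1 ⟨N, z.2.1, ψ.1, z.2.2, ψ.2⟩) ?_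
  refine S.measurable_dyn.comp (Measurable.prodMk (by fun_prop) ?_)
  exact (measurable_sigmaMk N).comp (by fun_prop :
    Measurable fun x : (ℝ × (S.V N × ℝ)) × (E (S.d N) × ℝ) => (x.1.2.1, x.2.1, x.1.2.2, x.2.2))

theorem measurable_dyn_momentum (T : ℝ) (N : ℕ) (q : S.V N) (n : ℝ) :
    Measurable fun ψ : E (S.d N) × ℝ => S.dyn T ⟨N, q, ψ.1, n, ψ.2⟩ := by
  refine S.measurable_dyn.comp (Measurable.prodMk (by fun_prop) ?_)
  exact (measurable_sigmaMk N).comp (by fun_prop :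
    Measurable fun x : E (S.d N) × ℝ => (q, x.1, n, x.2))

instance (T : ℝ) (x : S.Pos) : IsProbabilityMeasure (S.idealStep T x) := by
  obtain ⟨N, q, n⟩ := x
  have : IsProbabilityMeasure
      (((S.pLaw N).prod S.pnLaw).bind fun ψ => S.dyn T ⟨N, q, ψ.1, n, ψ.2⟩) :=
    isProbabilityMeasure_bind (S.measurable_dyn_momentum T N q n) fun _ => inferInstance
  exact Measure.isProbabilityMeasure_map S.measurable_toPos.aemeasurable

end Model

theorem lintegral_prod_prod_comm {A P R Q : Type*} [MeasurableSpace A] [MeasurableSpace P]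
    [MeasurableSpace R] [MeasurableSpace Q] (α : Measure A) (π : Measure P) (ρ : Measure R)
    (θ : Measure Q) [SFinite α] [SFinite π] [SFinite ρ] [SFinite θ]
    {H : (A × P) × (R × Q) → ℝ≥0∞} (hH : Measurable H) :
    ∫⁻ z, H z ∂((α.prod π).prod (ρ.prod θ)) =
      ∫⁻ z, H ((z.1.1, z.2.1), (z.1.2, z.2.2)) ∂((α.prod ρ).prod (π.prod θ)) := by
  rw [lintegral_prod _ hH.aemeasurable, lintegral_prod _ (by fun_prop),
    lintegral_prod _ (by fun_prop), lintegral_prod _ (by fun_prop)]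
  refine lintegral_congr fun a => ?_
  have h1 : ∀ p, ∫⁻ y, H ((a, p), y) ∂(ρ.prod θ) = ∫⁻ r, ∫⁻ s, H ((a, p), (r, s)) ∂θ ∂ρ :=
    fun p => lintegral_prod _ (by fun_prop)
  have h2 : ∀ r, ∫⁻ y, H ((a, y.1), (r, y.2)) ∂(π.prod θ) =
      ∫⁻ p, ∫⁻ s, H ((a, p), (r, s)) ∂θ ∂π :=
    fun r => lintegral_prod (fun y : P × Q => H ((a, y.1), (r, y.2))) (by fun_prop)
  simp only [h1, h2]
  exact lintegral_lintegral_swap (by fun_prop)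

namespace Model

variable (S : Model)

/-! ### Lebesgue measure on `V N × ℝ^(d N)` and the splitting of new coordinates -/

/-- Lebesgue measure on `V N × ℝ^(d N)`. -/
def vol (N : ℕ) : Measure (S.V N × E (S.d N)) := (S.volV N).prod volume

/-- Splitting a position of index `N + 1` into a position of index `N` and new coordinates. -/
def splitPos (N : ℕ) (q : S.V (N + 1)) : S.V N × E (S.d (N + 1) - S.d N) :=
  (⟨head (S.d_le N) q.1, S.head_mem N q⟩, tail (S.d N) q.1)

theorem measurable_splitPos (N : ℕ) : Measurable (S.splitPos N) :=
  ((measurable_head _).comp measurable_subtype_coe).subtype_mk.prodMk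
    (measurable_tail.comp measurable_subtype_coe)

theorem measurableSet_splitPos_range (N : ℕ) :
    MeasurableSet {x : S.V N × E (S.d (N + 1) - S.d N) | append x.1.1 x.2 ∈ S.V (N + 1)} :=
  S.measurableSet_append_mem measurable_fst measurable_snd

/-- `append` preserves Lebesgue measure and inverts `splitPos`. The restriction is necessary because
`V (N + 1)` may be smaller than the full cylinder over `V N`. -/
theorem measurePreserving_splitPos (N : ℕ) :
    MeasurePreserving (S.splitPos N) (S.volV (N + 1)) (((S.volV N).prod volume).restrict
      {x : S.V N × E (S.d (N + 1) - S.d N) | append x.1.1 x.2 ∈ S.V (N + 1)}) := by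
  refine ⟨S.measurable_splitPos N, Measure.ext fun B hB => ?_⟩
  have hm := S.measurable_splitPos N hB
  rw [Measure.map_apply (S.measurable_splitPos N) hB, Measure.restrict_apply hB,
    S.volV_prod_apply, volV, comap_subtype_coe_apply (S.V_open (N + 1)).measurableSet,
    ← (measurePreserving_append (S.d_le N)).measure_preimage
      ((S.measurableEmbedding_coe (N + 1)).measurableSet_image.2 hm).nullMeasurableSet]
  congr 1
  ext ⟨x, y⟩
  simp only [mem_preimage, mem_image, mem_inter_iff, mem_ofPred_eq, Prod.exists, Prod.map_apply,
    id_eq, Prod.mk.injEq]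
  constructor
  · rintro ⟨z, hz, hzx⟩
    have hx : head (S.d_le N) z.1 = x := by rw [hzx, head_append]
    have hy : tail (S.d N) z.1 = y := by rw [hzx, tail_append]
    refine ⟨(S.splitPos N z).1, (S.splitPos N z).2, ⟨hz, ?_⟩, hx, hy⟩
    simp only [splitPos, append_head_tail]
    exact z.2
  · rintro ⟨a, b, ⟨hab, hV⟩, rfl, rfl⟩
    refine ⟨⟨append a.1 b, hV⟩, ?_, rfl⟩
    have : S.splitPos N ⟨append a.1 b, hV⟩ = (a, b) := by
      simp [splitPos, head_append, tail_append]
    rwa [this]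

theorem measurePreserving_head_tail {a b : ℕ} (h : a ≤ b) :
    MeasurePreserving (fun p : E b => (head h p, tail a p)) volume (volume.prod volume) := by
  have hm : Measurable fun p : E b => (head h p, tail a p) :=
    (measurable_head h).prodMk measurable_tail
  refine ⟨hm, ?_⟩
  rw [← (measurePreserving_append h).map_eq,
    Measure.map_map hm (measurePreserving_append h).measurable]
  have : (fun p : E b => (head h p, tail a p)) ∘ (fun x : E a × E (b - a) => append x.1 x.2) =
      id := by
    funext x
    simp [head_append, tail_append]
  rw [this, Measure.map_id]

/-- Splitting a point of index `N + 1` into a point of index `N` and new coordinates. -/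
def split (N : ℕ) (x : S.V (N + 1) × E (S.d (N + 1))) :
    (S.V N × E (S.d N)) × (E (S.d (N + 1) - S.d N) × E (S.d (N + 1) - S.d N)) :=
  (((S.splitPos N x.1).1, head (S.d_le N) x.2), ((S.splitPos N x.1).2, tail (S.d N) x.2))

/-- This is the change of variables between a point of index `N` with proposed coordinates and a
point of index `N + 1`. The hypothesis `h0` removes the part of the cylinder outside `V (N + 1)`. -/
theorem lintegral_split (N : ℕ)
    {H : (S.V N × E (S.d N)) × (E (S.d (N + 1) - S.d N) × E (S.d (N + 1) - S.d N)) → ℝ≥0∞}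
    (hH : Measurable H) (h0 : ∀ z, append z.1.1.1 z.2.1 ∉ S.V (N + 1) → H z = 0) :
    ∫⁻ z, H z ∂((S.vol N).prod (volume.prod volume)) =
      ∫⁻ x, H (S.split N x) ∂S.vol (N + 1) := by
  have h1 := (S.measurePreserving_splitPos N).prod (measurePreserving_head_tail (S.d_le N))
  have hH' : Measurable fun z : (S.V N × E (S.d (N + 1) - S.d N)) ×
      (E (S.d N) × E (S.d (N + 1) - S.d N)) => H ((z.1.1, z.2.1), (z.1.2, z.2.2)) := by
    fun_prop
  have h2 := h1.lintegral_comp hH'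
  change ∫⁻ x, H (S.split N x) ∂S.vol (N + 1) = _ at h2
  have h3 := lintegral_prod_prod_comm (S.volV N) (volume : Measure (E (S.d N)))
    (volume : Measure (E (S.d (N + 1) - S.d N))) (volume : Measure (E (S.d (N + 1) - S.d N))) hH
  rw [h2]
  refine h3.trans ?_
  have hm := (S.measurableSet_splitPos_range N).prod
    (MeasurableSet.univ : MeasurableSet (univ : Set (E (S.d N) × E (S.d (N + 1) - S.d N))))
  rw [← Measure.restrict_univ (μ := (volume : Measure (E (S.d N))).prod
      (volume : Measure (E (S.d (N + 1) - S.d N)))), Measure.prod_restrict,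
    Measure.restrict_univ, ← lintegral_indicator hm]
  refine lintegral_congr fun z => ?_
  by_cases hz : append z.1.1.1 z.1.2 ∈ S.V (N + 1)
  · rw [indicator_of_mem]
    exact ⟨hz, mem_univ _⟩
  · rw [indicator_of_notMem]
    · exact h0 _ hz
    · exact fun h => hz h.1

theorem lintegral_neg_momentum (N : ℕ) (F : S.V N × E (S.d N) → ℝ≥0∞) (hF : Measurable F) :
    ∫⁻ x, F (x.1, -x.2) ∂S.vol N = ∫⁻ x, F x ∂S.vol N :=
  ((MeasurePreserving.id (S.volV N)).prod (Measure.measurePreserving_neg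
    (volume : Measure (E (S.d N))))).lintegral_comp hF

/-! ### The fibre space: phase points without the coordinate `n` -/

/-- Points `(q, p, p_n)` with `q ∈ V N`. -/
abbrev Fib : Type := Σ N : ℕ, S.V N × E (S.d N) × ℝ

/-- The unnormalized Boltzmann weight. -/
def weight (N : ℕ) (q p : E (S.d N)) (a : ℝ) : ℝ≥0∞ :=
  ENNReal.ofReal (Real.exp (-S.β * (S.ham N q p + S.kinN a)))

/-- The Boltzmann measure on the fibre space. -/
def fibMeasure : Measure S.Fib :=
  Measure.sum fun N => Measure.map (Sigma.mk N)
    (((S.volV N).prod (volume.prod volume)).withDensity fun x => S.weight N x.1 x.2.1 x.2.2)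

theorem kinN_neg (a : ℝ) : S.kinN (-a) = S.kinN a := by simp [kinN]

theorem ham_neg (N : ℕ) (q p : E (S.d N)) : S.ham N q (-p) = S.ham N q p := by simp [ham, kin]

theorem weight_neg_right (N : ℕ) (q p : E (S.d N)) (a : ℝ) :
    S.weight N q p (-a) = S.weight N q p a := by simp [weight, kinN_neg]

theorem weight_neg_left (N : ℕ) (q p : E (S.d N)) (a : ℝ) :
    S.weight N q (-p) a = S.weight N q p a := by simp [weight, ham_neg]

theorem measurable_weight {X : Type*} [MeasurableSpace X] {N : ℕ} {q : X → S.V N}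
    {p : X → E (S.d N)} {a : X → ℝ} (hq : Measurable q) (hp : Measurable p) (ha : Measurable a) :
    Measurable fun x => S.weight N (q x) (p x) (a x) := by
  have h := S.measurable_ham hq hp
  unfold weight kinN
  fun_prop

theorem measurable_fib_comp {X Z : Type*} [MeasurableSpace X] [MeasurableSpace Z] {N : ℕ}
    {F : S.Fib → Z} (hF : Measurable F) {q : X → S.V N}
    {p : X → E (S.d N)} {a : X → ℝ} (hq : Measurable q) (hp : Measurable p) (ha : Measurable a) :
    Measurable fun x => F ⟨N, q x, p x, a x⟩ :=
  hF.comp ((measurable_sigmaMk N).comp (hq.prodMk (hp.prodMk ha)))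

theorem measurable_weight_integral {F : S.Fib → ℝ≥0∞} (hF : Measurable F) (N : ℕ) :
    Measurable fun x : S.V N × E (S.d N) => ∫⁻ s in Ioi 0, S.weight N x.1 x.2 s *
      (F ⟨N, x.1, x.2, s⟩ + F ⟨N, x.1, x.2, -s⟩) := by
  refine Measurable.lintegral_prod_right' (f := fun z : (S.V N × E (S.d N)) × ℝ =>
    S.weight N z.1.1 z.1.2 z.2 * (F ⟨N, z.1.1, z.1.2, z.2⟩ + F ⟨N, z.1.1, z.1.2, -z.2⟩)) ?_
  exact (S.measurable_weight (by fun_prop) (by fun_prop) (by fun_prop)).mul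
    ((S.measurable_fib_comp hF (by fun_prop) (by fun_prop) (by fun_prop)).add
      (S.measurable_fib_comp hF (by fun_prop) (by fun_prop) (by fun_prop)))

/-- The weight is even in `p_n`, so the line of `p_n` folds into a speed `s > 0` and two directions.
Upward and downward jumps can then be compared at positive `s`. -/
theorem lintegral_fibMeasure {F : S.Fib → ℝ≥0∞} (hF : Measurable F) :
    ∫⁻ y, F y ∂S.fibMeasure = ∑' N, ∫⁻ x, (∫⁻ s in Ioi 0, S.weight N x.1 x.2 s *
      (F ⟨N, x.1, x.2, s⟩ + F ⟨N, x.1, x.2, -s⟩)) ∂S.vol N := by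
  rw [fibMeasure, lintegral_sum_measure]
  refine tsum_congr fun N => ?_
  have hw : Measurable fun x : S.V N × E (S.d N) × ℝ => S.weight N x.1 x.2.1 x.2.2 :=
    S.measurable_weight (by fun_prop) (by fun_prop) (by fun_prop)
  have hFN : Measurable fun x : S.V N × E (S.d N) × ℝ => F ⟨N, x⟩ :=
    hF.comp (measurable_sigmaMk N)
  have hprod : Measurable fun x : S.V N × E (S.d N) × ℝ =>
    S.weight N x.1 x.2.1 x.2.2 * F ⟨N, x⟩ := hw.mul hFN
  have e1 : ∫⁻ x, F ⟨N, x⟩ ∂(((S.volV N).prod (volume.prod volume)).withDensity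
      fun x => S.weight N x.1 x.2.1 x.2.2) =
      ∫⁻ x, S.weight N x.1 x.2.1 x.2.2 * F ⟨N, x⟩ ∂((S.volV N).prod (volume.prod volume)) :=
    lintegral_withDensity_eq_lintegral_mul _ hw hFN
  rw [lintegral_map hF (measurable_sigmaMk N), e1, lintegral_prod _ hprod.aemeasurable, vol,
    lintegral_prod _ (S.measurable_weight_integral hF N).aemeasurable]
  refine lintegral_congr fun q => ?_
  have hq : Measurable fun y : E (S.d N) × ℝ => S.weight N q y.1 y.2 * F ⟨N, q, y⟩ :=
    (S.measurable_weight (q := fun _ => q) measurable_const measurable_fst measurable_snd).mul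
      (S.measurable_fib_comp (q := fun _ => q) hF measurable_const measurable_fst measurable_snd)
  rw [lintegral_prod _ hq.aemeasurable]
  refine lintegral_congr fun p => ?_
  have hm : Measurable fun a : ℝ => S.weight N q p a * F ⟨N, q, p, a⟩ :=
    (S.measurable_weight (q := fun _ => q) measurable_const measurable_const measurable_id).mul
      (S.measurable_fib_comp (q := fun _ => q) hF measurable_const measurable_const measurable_id)
  rw [lintegral_eq_add_Ioi hm]
  refine lintegral_congr fun s => ?_
  rw [weight_neg_right, mul_add]

/-- Reversal of all momenta. -/
def rev : S.Fib → S.Fib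
  | ⟨N, q, p, a⟩ => ⟨N, q, -p, -a⟩

theorem measurable_rev : Measurable S.rev :=
  measurable_sigma fun N => (measurable_sigmaMk N).comp (by fun_prop :
    Measurable fun x : S.V N × E (S.d N) × ℝ => (x.1, -x.2.1, -x.2.2))

@[simp]
theorem rev_rev (y : S.Fib) : S.rev (S.rev y) = y := by
  obtain ⟨N, q, p, a⟩ := y
  exact congrArg₂ (fun p a => (⟨N, q, p, a⟩ : S.Fib)) (neg_neg p) (neg_neg a)

theorem lintegral_rev {F : S.Fib → ℝ≥0∞} (hF : Measurable F) :
    ∫⁻ y, F (S.rev y) ∂S.fibMeasure = ∫⁻ y, F y ∂S.fibMeasure := by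
  rw [S.lintegral_fibMeasure hF,
    S.lintegral_fibMeasure (F := fun y => F (S.rev y)) (hF.comp S.measurable_rev)]
  refine tsum_congr fun N => ?_
  rw [← S.lintegral_neg_momentum N _ (S.measurable_weight_integral hF N)]
  refine lintegral_congr fun x => lintegral_congr fun s => ?_
  simp only [rev, weight_neg_left, neg_neg]
  rw [add_comm]

/-- The Hamiltonian flow on the fibre space. -/
def flowFib (t : ℝ) : S.Fib → S.Fib
  | ⟨N, q, p, a⟩ => ⟨N, (S.flow N t q p).1, (S.flow N t q p).2, a⟩

theorem measurable_flowFib (t : ℝ) : Measurable (S.flowFib t) := by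
  refine measurable_sigma fun N => ?_
  have h := S.measurable_flow_comp (X := S.V N × E (S.d N) × ℝ) (N := N) (t := fun _ => t)
    (q := fun x => x.1) (p := fun x => x.2.1) (by fun_prop) (by fun_prop) (by fun_prop)
  exact (measurable_sigmaMk N).comp (h.fst.prodMk (h.snd.prodMk (by fun_prop)))

/-- Liouville's theorem preserves the volume and conservation of energy preserves the weight. -/
theorem lintegral_flowFib (t : ℝ) {F : S.Fib → ℝ≥0∞} (hF : Measurable F) :
    ∫⁻ y, F (S.flowFib t y) ∂S.fibMeasure = ∫⁻ y, F y ∂S.fibMeasure := by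
  rw [S.lintegral_fibMeasure hF, S.lintegral_fibMeasure (F := fun y => F (S.flowFib t y))
    (hF.comp (S.measurable_flowFib t))]
  refine tsum_congr fun N => ?_
  rw [vol, ← (S.measurePreserving_flow N t).lintegral_comp (S.measurable_weight_integral hF N)]
  refine lintegral_congr fun x => lintegral_congr fun s => ?_
  simp only [flowFib, weight, energy_flow]

theorem flowFib_rev_flowFib_rev (t : ℝ) (y : S.Fib) :
    S.flowFib t (S.rev (S.flowFib t (S.rev y))) = y := by
  obtain ⟨N, q, p, a⟩ := y
  have h := S.flow_add N t (-t) q p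
  rw [add_neg_cancel, flow_zero] at h
  simp only [rev, flowFib, S.flow_neg N t q p, neg_neg]
  rw [← h]

/-! ### Kernels in detailed balance up to reversal -/

/-- `κ` and `η` are adjoint to each other up to momentum reversal. -/
def RevAdjoint (κ η : Kernel S.Fib S.Fib) : Prop :=
  ∀ f g : S.Fib → ℝ≥0∞, Measurable f → Measurable g →
    ∫⁻ y, f y * ∫⁻ z, g z ∂κ y ∂S.fibMeasure =
      ∫⁻ y, g (S.rev y) * ∫⁻ z, f (S.rev z) ∂η y ∂S.fibMeasure

variable {S}

/-- Apply the two relations in turn; the reversals between them cancel because `rev` is a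
measure-preserving involution. The order of the adjoints is reversed. -/
theorem RevAdjoint.comp {κ₁ κ₂ η₁ η₂ : Kernel S.Fib S.Fib} (h₁ : S.RevAdjoint κ₁ η₁)
    (h₂ : S.RevAdjoint κ₂ η₂) : S.RevAdjoint (κ₂ ∘ₖ κ₁) (η₁ ∘ₖ η₂) := by
  intro f g hf hg
  have hfr : Measurable fun z => f (S.rev z) := hf.comp S.measurable_rev
  simp only [Kernel.lintegral_comp _ _ _ hg, Kernel.lintegral_comp _ _ _ hfr]
  rw [h₁ f _ hf hg.lintegral_kernel, ← S.lintegral_rev]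
  · simp only [rev_rev]
    have := h₂ (fun y => ∫⁻ z, f (S.rev z) ∂η₁ (S.rev y)) g
      (hfr.lintegral_kernel.comp S.measurable_rev) hg
    simp only [rev_rev] at this
    rw [← this]
    exact lintegral_congr fun y => mul_comm _ _
  · exact (hg.lintegral_kernel.comp S.measurable_rev).mul hfr.lintegral_kernel

/-- Take `f = 1`: adjointness to a Markov kernel forces invariance. It is used to carry null sets
through the kernels. -/
theorem RevAdjoint.bind_eq {κ η : Kernel S.Fib S.Fib} [IsMarkovKernel η]
    (h : S.RevAdjoint κ η) : S.fibMeasure.bind κ = S.fibMeasure := by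
  refine Measure.ext fun B hB => ?_
  have h1 := h 1 (B.indicator 1) measurable_one (measurable_one.indicator hB)
  rw [Measure.bind_apply hB κ.measurable.aemeasurable]
  simp only [Pi.one_apply, one_mul, lintegral_indicator_one hB, lintegral_one, measure_univ,
    mul_one] at h1
  rw [h1, S.lintegral_rev (measurable_one.indicator hB), lintegral_indicator_one hB]

variable (S)

/-- The Hamiltonian flow as a kernel. -/
def flowKernel (t : ℝ) : Kernel S.Fib S.Fib :=
  Kernel.deterministic (S.flowFib t) (S.measurable_flowFib t)

instance (t : ℝ) : IsMarkovKernel (S.flowKernel t) :=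
  inferInstanceAs (IsMarkovKernel (Kernel.deterministic _ _))

theorem lintegral_flowKernel (t : ℝ) {g : S.Fib → ℝ≥0∞} (hg : Measurable g) (y : S.Fib) :
    ∫⁻ z, g z ∂S.flowKernel t y = g (S.flowFib t y) :=
  Kernel.lintegral_deterministic' (S.measurable_flowFib t) hg

/-- The flow composed with `rev` is an involution, and both maps preserve the Boltzmann measure. -/
theorem revAdjoint_flowKernel (t : ℝ) : S.RevAdjoint (S.flowKernel t) (S.flowKernel t) := by
  intro f g hf hg
  have hfr : Measurable fun z => f (S.rev z) := hf.comp S.measurable_rev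
  simp only [S.lintegral_flowKernel t hg, S.lintegral_flowKernel t hfr]
  have hm : Measurable fun y => g y * f (S.rev (S.flowFib t (S.rev y))) :=
    hg.mul (hf.comp (S.measurable_rev.comp ((S.measurable_flowFib t).comp S.measurable_rev)))
  have h1 := S.lintegral_rev hm
  simp only [rev_rev] at h1
  rw [h1, ← S.lintegral_flowFib t hm]
  refine lintegral_congr fun y => ?_
  have h2 := S.flowFib_rev_flowFib_rev t (S.rev y)
  rw [rev_rev] at h2
  have h3 : S.rev (S.flowFib t (S.rev (S.flowFib t y))) = y := by
    rw [h2, rev_rev]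
  rw [h3, mul_comm]

end Model

namespace Model

variable (S : Model)

/-! ### The jump kernel on the fibre space -/

/-- The phase point over `y` whose coordinate `n` has covered the fraction `c` of its way through
the current unit interval. -/
def emb (c : ℝ) : S.Fib → S.Phase
  | ⟨N, q, p, a⟩ => ⟨N, q, p, if a < 0 then N + 1 - c else N + c, a⟩

/-- Forget the coordinate `n`. -/
def proj : S.Phase → S.Fib
  | ⟨N, q, p, _, a⟩ => ⟨N, q, p, a⟩

theorem measurable_emb : Measurable fun z : ℝ × S.Fib => S.emb z.1 z.2 := by
  refine measurable_prod_sigma fun N => ?_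
  have h : Measurable fun z : ℝ × (S.V N × E (S.d N) × ℝ) =>
      if z.2.2.2 < 0 then (N : ℝ) + 1 - z.1 else N + z.1 :=
    Measurable.ite (measurableSet_lt (by fun_prop) measurable_const) (by fun_prop) (by fun_prop)
  exact (measurable_sigmaMk N).comp (Measurable.prodMk (by fun_prop)
    (Measurable.prodMk (by fun_prop) (h.prodMk (by fun_prop))))

theorem measurable_emb_right (c : ℝ) : Measurable (S.emb c) :=
  S.measurable_emb.comp (measurable_const.prodMk measurable_id)

theorem measurable_proj : Measurable S.proj :=
  measurable_sigma fun N => (measurable_sigmaMk N).comp (by fun_prop :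
    Measurable fun x : S.V N × E (S.d N) × ℝ × ℝ => (x.1, x.2.1, x.2.2.2))

/-- The jump at an integer, on the fibre space. -/
def jumpKernel : Kernel S.Fib S.Fib where
  toFun y := (S.jump (S.emb 1 y)).map S.proj
  measurable' := (Measure.measurable_map _ S.measurable_proj).comp
    (S.measurable_jump.comp (S.measurable_emb_right 1))

instance : IsMarkovKernel S.jumpKernel :=
  ⟨fun _ => Measure.isProbabilityMeasure_map S.measurable_proj.aemeasurable⟩

theorem lintegral_jumpKernel {g : S.Fib → ℝ≥0∞} (hg : Measurable g) (y : S.Fib) :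
    ∫⁻ z, g z ∂S.jumpKernel y = ∫⁻ x, g (S.proj x) ∂S.jump (S.emb 1 y) :=
  lintegral_map hg S.measurable_proj

/-- The density of proposals `w` that raise the index, times the value of `g` after the jump. -/
def raisedIntegrand (g : S.Fib → ℝ≥0∞) (N : ℕ) (q : S.V N) (p : E (S.d N)) (s : ℝ)
    (w : E (S.d (N + 1) - S.d N) × E (S.d (N + 1) - S.d N)) : ℝ≥0∞ :=
  ENNReal.ofReal (S.ρ N q p w.1 w.2) * {w | S.AcceptUp N q p s w}.indicator
    (fun w => g (S.proj (S.jumpUp N q p 0 s w))) w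

/-- The expectation of `g` after a jump, on the event that the index is raised. -/
def raised (g : S.Fib → ℝ≥0∞) (N : ℕ) (q : S.V N) (p : E (S.d N)) (s : ℝ) : ℝ≥0∞ :=
  ∫⁻ w, S.raisedIntegrand g N q p s w

/-- The probability that a raise of the index is rejected. -/
def rejectUp (N : ℕ) (q : S.V N) (p : E (S.d N)) (s : ℝ) : ℝ≥0∞ :=
  ∫⁻ w : E (S.d (N + 1) - S.d N) × E (S.d (N + 1) - S.d N),
    ENNReal.ofReal (S.ρ N q p w.1 w.2) * {w | S.AcceptUp N q p s w}ᶜ.indicator 1 w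

open Classical in
/-- The value of `g` after a jump if the index is lowered, and `0` otherwise. -/
def lowered (g : S.Fib → ℝ≥0∞) : (N : ℕ) → S.V N → E (S.d N) → ℝ → ℝ≥0∞
  | 0, _, _, _ => 0
  | N + 1, q, p, s => if S.barrierDown N q p ≤ (S.kinN s : EReal) then
      g ⟨N, ⟨head (S.d_le N) q.1, S.head_mem N q⟩, head (S.d_le N) p,
        S.crossed (-s) (S.barrierDown N q p)⟩ else 0

open Classical in
/-- The probability that the lowering of the index is rejected. -/
def rejectDown : (N : ℕ) → S.V N → E (S.d N) → ℝ → ℝ≥0∞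
  | 0, _, _, _ => 1
  | N + 1, q, p, s => if S.barrierDown N q p ≤ (S.kinN s : EReal) then 0 else 1

theorem proj_jumpUp (N : ℕ) (q : S.V N) (p : E (S.d N)) (n n' a : ℝ)
    (w : E (S.d (N + 1) - S.d N) × E (S.d (N + 1) - S.d N)) :
    S.proj (S.jumpUp N q p n a w) = S.proj (S.jumpUp N q p n' a w) := by
  by_cases h : S.AcceptUp N q p a w
  · rw [S.jumpUp_of_accept h, S.jumpUp_of_accept h]; rfl
  · rw [S.jumpUp_of_not_accept h, S.jumpUp_of_not_accept h]; rfl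

section

variable {X : Type*} [MeasurableSpace X] {N : ℕ} {q : X → S.V N} {p : X → E (S.d N)} {s : X → ℝ}

theorem measurable_raisedIntegrand {g : S.Fib → ℝ≥0∞} (hg : Measurable g)
    {w : X → E (S.d (N + 1) - S.d N) × E (S.d (N + 1) - S.d N)} (hq : Measurable q)
    (hp : Measurable p) (hs : Measurable s) (hw : Measurable w) :
    Measurable fun x => S.raisedIntegrand g N (q x) (p x) (s x) (w x) := by
  refine (S.measurable_rho (measurable_subtype_coe.comp hq) hp hw.fst
    hw.snd).ennreal_ofReal.mul ?_
  have h := (hg.comp (S.measurable_proj.comp (S.measurable_jumpUp hq hp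
    (n := fun _ => 0) measurable_const hs hw))).indicator (S.measurableSet_acceptUp hq hp hs hw)
  convert! h using 1

theorem measurable_raised {g : S.Fib → ℝ≥0∞} (hg : Measurable g) (hq : Measurable q)
    (hp : Measurable p) (hs : Measurable s) :
    Measurable fun x => S.raised g N (q x) (p x) (s x) := by
  refine Measurable.lintegral_prod_right' (f := fun z : X ×
    (E (S.d (N + 1) - S.d N) × E (S.d (N + 1) - S.d N)) =>
      S.raisedIntegrand g N (q z.1) (p z.1) (s z.1) z.2) ?_
  exact S.measurable_raisedIntegrand hg (hq.comp measurable_fst) (hp.comp measurable_fst)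
    (hs.comp measurable_fst) measurable_snd

theorem measurable_rejectUp (hq : Measurable q)
    (hp : Measurable p) (hs : Measurable s) :
    Measurable fun x => S.rejectUp N (q x) (p x) (s x) := by
  refine Measurable.lintegral_prod_right' (f := fun z : X ×
    (E (S.d (N + 1) - S.d N) × E (S.d (N + 1) - S.d N)) =>
      ENNReal.ofReal (S.ρ N (q z.1) (p z.1) z.2.1 z.2.2) *
        {w | S.AcceptUp N (q z.1) (p z.1) (s z.1) w}ᶜ.indicator 1 z.2) ?_
  refine (S.measurable_rho (measurable_subtype_coe.comp (hq.comp measurable_fst))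
    (hp.comp measurable_fst) measurable_snd.fst measurable_snd.snd).ennreal_ofReal.mul ?_
  have h := (measurable_one (α := ℝ≥0∞)).indicator (S.measurableSet_acceptUp
    (hq.comp measurable_fst) (hp.comp measurable_fst) (hs.comp measurable_fst)
    (w := fun z : X × (E (S.d (N + 1) - S.d N) × E (S.d (N + 1) - S.d N)) => z.2)
    measurable_snd).compl
  convert! h using 1

theorem measurableSet_barrierDown_le {q : X → S.V (N + 1)} {p : X → E (S.d (N + 1))}
    (hq : Measurable q) (hp : Measurable p) (hs : Measurable s) :
    MeasurableSet {x | S.barrierDown N (q x) (p x) ≤ (S.kinN (s x) : EReal)} := by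
  refine measurableSet_le (S.measurable_barrierDown hq hp) ?_
  unfold kinN
  exact Measurable.coe_real_ereal (by fun_prop)

theorem measurable_lowered {g : S.Fib → ℝ≥0∞} (hg : Measurable g) (hq : Measurable q)
    (hp : Measurable p) (hs : Measurable s) :
    Measurable fun x => S.lowered g N (q x) (p x) (s x) := by
  cases N with
  | zero => exact measurable_const
  | succ N =>
    refine Measurable.ite (S.measurableSet_barrierDown_le hq hp hs) ?_ measurable_const
    exact S.measurable_fib_comp hg
      ((measurable_head _).comp (measurable_subtype_coe.comp hq)).subtype_mk
      ((measurable_head _).comp hp)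
      (S.measurable_crossed hs.neg (S.measurable_barrierDown hq hp))

theorem measurable_rejectDown (hq : Measurable q) (hp : Measurable p) (hs : Measurable s) :
    Measurable fun x => S.rejectDown N (q x) (p x) (s x) := by
  cases N with
  | zero => exact measurable_const
  | succ N =>
    exact Measurable.ite (S.measurableSet_barrierDown_le hq hp hs) measurable_const
      measurable_const

end

/-! ### Decomposition of a jump into index change and reflection -/

theorem jump_emb_of_nonneg (N : ℕ) (q : S.V N) (p : E (S.d N)) {s : ℝ} (hs : 0 ≤ s) :
    S.jump (S.emb 1 ⟨N, q, p, s⟩) = (S.newLaw N q p).map (S.jumpUp N q p (N + 1) s) := by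
  have : S.emb 1 ⟨N, q, p, s⟩ = ⟨N, q, p, N + 1, s⟩ := by simp [emb, hs.not_gt]
  rw [this]
  exact if_neg hs.not_gt

theorem jump_emb_neg (N : ℕ) (q : S.V N) (p : E (S.d N)) {s : ℝ} (hs : 0 < s) :
    S.jump (S.emb 1 ⟨N, q, p, -s⟩) = Measure.dirac (S.jumpDown N q p N (-s)) := by
  have : S.emb 1 ⟨N, q, p, -s⟩ = ⟨N, q, p, N, -s⟩ := by simp [emb, hs]
  rw [this]
  exact if_pos (neg_lt_zero.2 hs)

theorem lintegral_jumpKernel_of_nonneg {g : S.Fib → ℝ≥0∞} (hg : Measurable g) (N : ℕ) (q : S.V N)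
    (p : E (S.d N)) {s : ℝ} (hs : 0 ≤ s) :
    ∫⁻ z, g z ∂S.jumpKernel ⟨N, q, p, s⟩ =
      S.raised g N q p s + S.rejectUp N q p s * g ⟨N, q, p, -s⟩ := by
  have hgp : Measurable fun x => g (S.proj x) := hg.comp S.measurable_proj
  have hρ : Measurable fun w : E (S.d (N + 1) - S.d N) × E (S.d (N + 1) - S.d N) =>
      ENNReal.ofReal (S.ρ N q p w.1 w.2) :=
    (S.measurable_rho (measurable_const (a := q.1)) (measurable_const (a := p)) measurable_fst
      measurable_snd).ennreal_ofReal
  have hA : MeasurableSet {w | S.AcceptUp N q p s w} :=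
    S.measurableSet_acceptUp (measurable_const (a := q)) (measurable_const (a := p))
      (measurable_const (a := s)) measurable_id
  have hr : Measurable fun w => S.raisedIntegrand g N q p s w :=
    S.measurable_raisedIntegrand hg (measurable_const (a := q)) (measurable_const (a := p))
      (measurable_const (a := s)) measurable_id
  have hrej : Measurable fun w : E (S.d (N + 1) - S.d N) × E (S.d (N + 1) - S.d N) =>
      ENNReal.ofReal (S.ρ N q p w.1 w.2) *
        {w | S.AcceptUp N q p s w}ᶜ.indicator 1 w :=
    hρ.mul (measurable_one.indicator hA.compl)
  rw [S.lintegral_jumpKernel hg, S.jump_emb_of_nonneg N q p hs, lintegral_map hgp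
    (S.measurable_jumpUp_right ..), newLaw,
    lintegral_withDensity_eq_lintegral_mul _ hρ
      (g := fun w => g (S.proj (S.jumpUp N q p (N + 1) s w)))
      (hgp.comp (S.measurable_jumpUp_right N q p (N + 1) s)),
    raised, rejectUp, ← lintegral_mul_const _ hrej, ← lintegral_add_left hr]
  refine lintegral_congr fun w => ?_
  simp only [Pi.mul_apply, raisedIntegrand]
  rw [S.proj_jumpUp N q p _ 0 s w]
  by_cases hw : S.AcceptUp N q p s w
  · rw [indicator_of_mem (by exact hw), indicator_of_notMem (by exact fun h => h hw)]
    simp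
  · rw [indicator_of_notMem (by exact hw), indicator_of_mem (by exact hw),
      S.jumpUp_of_not_accept hw]
    simp [proj]

theorem lintegral_jumpKernel_neg {g : S.Fib → ℝ≥0∞} (hg : Measurable g) (N : ℕ) (q : S.V N)
    (p : E (S.d N)) {s : ℝ} (hs : 0 < s) :
    ∫⁻ z, g z ∂S.jumpKernel ⟨N, q, p, -s⟩ =
      S.lowered g N q p s + S.rejectDown N q p s * g ⟨N, q, p, s⟩ := by
  have hgp : Measurable fun x => g (S.proj x) := hg.comp S.measurable_proj
  rw [S.lintegral_jumpKernel hg, S.jump_emb_neg N q p hs, lintegral_dirac' _ hgp]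
  cases N with
  | zero => simp [jumpDown, lowered, rejectDown, proj]
  | succ N =>
    simp only [jumpDown, lowered, rejectDown, kinN_neg]
    split_ifs <;> simp [proj]

/-! ### Evenness -/

theorem barrierUp_neg (N : ℕ) (q : S.V N) (p : E (S.d N)) (r s : E (S.d (N + 1) - S.d N)) :
    S.barrierUp N q (-p) r (-s) = S.barrierUp N q p r s := by
  simp only [barrierUp, append_neg, ham_neg, S.ρ_even N q q.2]

theorem barrierDown_neg (N : ℕ) (q : S.V (N + 1)) (p : E (S.d (N + 1))) :
    S.barrierDown N q (-p) = S.barrierDown N q p := by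
  simp only [barrierDown, head_neg, tail_neg, ham_neg, S.ρ_even N _ (S.head_mem N q)]

theorem acceptUp_neg (N : ℕ) (q : S.V N) (p : E (S.d N)) (a : ℝ)
    (w : E (S.d (N + 1) - S.d N) × E (S.d (N + 1) - S.d N)) :
    S.AcceptUp N q (-p) a (w.1, -w.2) ↔ S.AcceptUp N q p a w := by
  simp only [AcceptUp, barrierUp_neg]

/-- Substitute `p_new ↦ -p_new` and use that density and barrier are even. -/
theorem rejectUp_neg (N : ℕ) (q : S.V N) (p : E (S.d N)) (s : ℝ) :
    S.rejectUp N q (-p) s = S.rejectUp N q p s := by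
  have hmp := (MeasurePreserving.id (volume : Measure (E (S.d (N + 1) - S.d N)))).prod
    (Measure.measurePreserving_neg (volume : Measure (E (S.d (N + 1) - S.d N))))
  have he : MeasurableEmbedding (Prod.map id Neg.neg :
      E (S.d (N + 1) - S.d N) × E (S.d (N + 1) - S.d N) → _) :=
    MeasurableEmbedding.id.prodMap (MeasurableEquiv.neg _).measurableEmbedding
  unfold rejectUp
  refine (hmp.lintegral_comp_emb he _).symm.trans (lintegral_congr fun w => ?_)
  simp only [Prod.map_fst, Prod.map_snd, id_eq, S.ρ_even N q q.2]
  congr 1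
  by_cases hw : S.AcceptUp N q p s w
  · rw [indicator_of_notMem (by exact fun h => h ((S.acceptUp_neg N q p s w).2 hw)),
      indicator_of_notMem (by exact fun h => h hw)]
  · rw [indicator_of_mem (by exact fun h => hw ((S.acceptUp_neg N q p s w).1 h)),
      indicator_of_mem (by exact hw)]
    rfl

theorem rejectDown_neg (N : ℕ) (q : S.V N) (p : E (S.d N)) (s : ℝ) :
    S.rejectDown N q (-p) s = S.rejectDown N q p s := by
  cases N with
  | zero => rfl
  | succ N => simp only [rejectDown, barrierDown_neg]

/-! ### Balance between raising and lowering -/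

theorem crossed_of_pos {s : ℝ} (hs : 0 < s) (δ : EReal) :
    S.crossed s δ = s - S.mn * δ.toReal := by
  simp [crossed, sgn, hs.not_gt, abs_of_pos hs]

theorem crossed_neg_of_pos {s : ℝ} (hs : 0 < s) (δ : EReal) :
    S.crossed (-s) δ = -(s - S.mn * δ.toReal) := by
  simp [crossed, sgn, hs, abs_of_pos hs]

theorem barrierUp_of_pos {N : ℕ} {q p : E (S.d N)} {r s : E (S.d (N + 1) - S.d N)}
    (h : 0 < S.ρ N q p r s) :
    S.barrierUp N q p r s = ((S.ham (N + 1) (append q r) (append p s) - S.ham N q p +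
      S.β⁻¹ * Real.log (S.ρ N q p r s) : ℝ) : EReal) := by
  rw [barrierUp, ENNReal.log_ofReal_of_pos h, ← EReal.coe_mul, ← EReal.coe_add]

theorem barrierDown_of_pos {N : ℕ} {q p : E (S.d (N + 1))}
    (h : 0 < S.ρ N (head (S.d_le N) q) (head (S.d_le N) p) (tail (S.d N) q) (tail (S.d N) p)) :
    S.barrierDown N q p = ((-(S.ham (N + 1) q p - S.ham N (head (S.d_le N) q) (head (S.d_le N) p) +
      S.β⁻¹ * Real.log (S.ρ N (head (S.d_le N) q) (head (S.d_le N) p) (tail (S.d N) q)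
        (tail (S.d N) p))) : ℝ) : EReal) := by
  rw [barrierDown, ENNReal.log_ofReal_of_pos h, ← EReal.coe_mul, ← EReal.coe_sub]
  congr 1
  ring

theorem barrierDown_of_eq_zero {N : ℕ} {q p : E (S.d (N + 1))}
    (h : S.ρ N (head (S.d_le N) q) (head (S.d_le N) p) (tail (S.d N) q) (tail (S.d N) p) = 0) :
    S.barrierDown N q p = ⊤ := by
  rw [barrierDown, h, ENNReal.ofReal_zero, ENNReal.log_zero,
    EReal.coe_mul_bot_of_pos (inv_pos.2 S.β_pos), sub_eq_add_neg, EReal.neg_bot,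
    EReal.coe_add_top]

/-- Translation `s = u + c`. Positivity of both momenta and the two thresholds describe the same set
except at the null points `u = 0` and `u = -c`. -/
theorem lintegral_Ioi_shift {A B : ℝ → ℝ≥0∞} {c : ℝ}
    (hAB : ∀ u, 0 < u → 0 < u + c → A (u + c) = B u) :
    ∫⁻ s in Ioi 0, (Ici c).indicator A s = ∫⁻ u in Ioi 0, (Ici (-c)).indicator B u := by
  rw [← lintegral_indicator measurableSet_Ioi, ← lintegral_indicator measurableSet_Ioi,
    ← lintegral_add_right_eq_self _ c]
  have h1 : ∀ᵐ u : ℝ, u ≠ 0 := by simp [ae_iff]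
  have h2 : ∀ᵐ u : ℝ, u ≠ -c := by simp [ae_iff]
  refine lintegral_congr_ae ?_
  filter_upwards [h1, h2] with u hu1 hu2
  simp only [indicator, mem_Ioi, mem_Ici]
  by_cases hu : 0 < u
  · by_cases huc : 0 < u + c
    · rw [if_pos huc, if_pos (by linarith), if_pos hu, if_pos (by linarith), hAB u hu huc]
    · have : ¬ -c ≤ u := fun h => huc (by
        rcases h.lt_or_eq with h | h
        · linarith
        · exact absurd h.symm hu2)
      rw [if_neg huc, if_pos hu, if_neg this]
  · have : ¬ c ≤ u + c := fun h => hu (by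
      rcases (show 0 ≤ u by linarith).lt_or_eq with h | h
      · exact h
      · exact absurd h.symm hu1)
    rw [if_neg this, if_neg hu, ite_self]

/-- This is where the form of the barrier matters. Raising `K_n` by `δH` multiplies the weight of
index `N` by `exp (-β δH)`, which replaces `H_N` by `H_{N+1}` and divides by `ρ`; the proposal
density restores that factor. -/
theorem weight_mul_rho {N : ℕ} {q p : E (S.d (N + 1))} {q' p' : E (S.d N)} {ρ u : ℝ} (hρ : 0 < ρ)
    (hu : 0 ≤ u) (huc : 0 ≤ u + S.mn * (S.ham (N + 1) q p - S.ham N q' p' + S.β⁻¹ * Real.log ρ)) :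
    S.weight N q' p' (u + S.mn * (S.ham (N + 1) q p - S.ham N q' p' + S.β⁻¹ * Real.log ρ)) *
      ENNReal.ofReal ρ = S.weight (N + 1) q p u := by
  have hβ := S.β_pos.ne'
  have hm := S.mn_pos.ne'
  rw [weight, weight, ← ENNReal.ofReal_mul (Real.exp_pos _).le]
  congr 1
  nth_rewrite 2 [← Real.exp_log hρ]
  rw [← Real.exp_add, kinN, kinN, abs_of_nonneg hu, abs_of_nonneg huc]
  congr 1
  field_simp
  ring

/-- Splitting a point of index `N + 1` matches each raise with the opposite lowering. For fixed `(q,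
p)` the barriers are `D` and `-D`, and the momenta before and after differ by the shift `mn D`, so
`lintegral_Ioi_shift` and `weight_mul_rho` conclude. -/
theorem lintegral_raised_eq_lowered {f g : S.Fib → ℝ≥0∞} (hf : Measurable f) (hg : Measurable g)
    (N : ℕ) :
    ∫⁻ x, (∫⁻ s in Ioi 0, S.weight N x.1 x.2 s *
      (f ⟨N, x.1, x.2, s⟩ * S.raised g N x.1 x.2 s)) ∂S.vol N =
    ∫⁻ x, (∫⁻ s in Ioi 0, S.weight (N + 1) x.1 x.2 s *
      (g ⟨N + 1, x.1, x.2, s⟩ * S.lowered (fun y => f (S.rev y)) (N + 1) x.1 (-x.2) s))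
        ∂S.vol (N + 1) := by
  let G : ((S.V N × E (S.d N)) × (E (S.d (N + 1) - S.d N) × E (S.d (N + 1) - S.d N))) →
      ℝ → ℝ≥0∞ := fun z s => S.weight N z.1.1 z.1.2 s * (f ⟨N, z.1.1, z.1.2, s⟩ *
        S.raisedIntegrand g N z.1.1 z.1.2 s z.2)
  have hG : Measurable (Function.uncurry G) :=
    (S.measurable_weight (by fun_prop) (by fun_prop) (by fun_prop)).mul
      ((S.measurable_fib_comp hf (by fun_prop) (by fun_prop) (by fun_prop)).mul
        (S.measurable_raisedIntegrand hg (by fun_prop) (by fun_prop) (by fun_prop)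
          (by fun_prop)))
  have hri : ∀ (x : S.V N × E (S.d N)) (s : ℝ),
      Measurable fun w => S.raisedIntegrand g N x.1 x.2 s w := fun x s =>
    S.measurable_raisedIntegrand hg (measurable_const (a := x.1)) (measurable_const (a := x.2))
      (measurable_const (a := s)) measurable_id
  have h1 : ∀ x : S.V N × E (S.d N), ∫⁻ s in Ioi 0, S.weight N x.1 x.2 s *
      (f ⟨N, x.1, x.2, s⟩ * S.raised g N x.1 x.2 s) =
      ∫⁻ w, (∫⁻ s in Ioi 0, G (x, w) s) ∂(volume.prod volume) := by
    intro x
    rw [← lintegral_lintegral_swap]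
    · refine lintegral_congr fun s => ?_
      rw [raised, ← lintegral_const_mul _ (hri x s),
        ← lintegral_const_mul _ ((hri x s).const_mul _)]
      rfl
    · exact (hG.comp (by fun_prop : Measurable fun z : ℝ ×
        (E (S.d (N + 1) - S.d N) × E (S.d (N + 1) - S.d N)) => ((x, z.2), z.1))).aemeasurable
  have h2 : Measurable fun z => ∫⁻ s in Ioi 0, G z s := Measurable.lintegral_prod_right' hG
  simp only [h1]
  -- With the `p_n` integral innermost, the two sides can be compared over each point of index `N +
  -- 1` separately.
  rw [← lintegral_prod _ h2.aemeasurable, S.lintegral_split N h2]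
  · refine lintegral_congr fun x => ?_
    obtain ⟨q, p⟩ := x
    set ρ₀ := S.ρ N (head (S.d_le N) q.1) (head (S.d_le N) p) (tail (S.d N) q.1)
      (tail (S.d N) p) with hρ₀
    rcases (S.ρ_nonneg N _ _ _ _ : 0 ≤ ρ₀).lt_or_eq with hpos | hzero
    · set D : ℝ := S.ham (N + 1) q p - S.ham N (head (S.d_le N) q.1) (head (S.d_le N) p) +
        S.β⁻¹ * Real.log ρ₀ with hD
      have hup : S.barrierUp N (head (S.d_le N) q.1) (head (S.d_le N) p) (tail (S.d N) q.1)
          (tail (S.d N) p) = (D : EReal) := by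
        rw [S.barrierUp_of_pos hpos, append_head_tail, append_head_tail]
      have hdown : S.barrierDown N q p = ((-D : ℝ) : EReal) := S.barrierDown_of_pos hpos
      have hle : ∀ {s t : ℝ}, 0 < s → ((t : EReal) ≤ (S.kinN s : EReal) ↔ S.mn * t ≤ s) := by
        intro s t hs
        rw [EReal.coe_le_coe_iff, kinN, abs_of_pos hs, le_div_iff₀ S.mn_pos, mul_comm]
      have hq : append (head (S.d_le N) q.1) (tail (S.d N) q.1) = q.1 := append_head_tail _ _
      have hL : ∀ s ∈ Ioi (0 : ℝ), G (S.split N (q, p)) s = (Ici (S.mn * D)).indicator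
          (fun s => S.weight N (head (S.d_le N) q.1) (head (S.d_le N) p) s *
            ENNReal.ofReal ρ₀ * (f ⟨N, ⟨head (S.d_le N) q.1, S.head_mem N q⟩,
              head (S.d_le N) p, s⟩ * g ⟨N + 1, q, p, s - S.mn * D⟩)) s := by
        intro s hs
        simp only [G, split, splitPos, raisedIntegrand]
        rw [← hρ₀]
        by_cases hsD : S.mn * D ≤ s
        · have hacc : S.AcceptUp N ⟨head (S.d_le N) q.1, S.head_mem N q⟩ (head (S.d_le N) p) s
              (tail (S.d N) q.1, tail (S.d N) p) :=
            ⟨by rw [hq]; exact q.2, by rw [hup]; exact (hle hs).2 hsD⟩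
          rw [indicator_of_mem (by exact hacc), indicator_of_mem (by exact hsD),
            S.jumpUp_of_accept hacc]
          simp only [proj, hup, S.crossed_of_pos hs, EReal.toReal_coe, append_head_tail]
          ring
        · have hacc : ¬ S.AcceptUp N ⟨head (S.d_le N) q.1, S.head_mem N q⟩ (head (S.d_le N) p) s
              (tail (S.d N) q.1, tail (S.d N) p) := by
            rintro ⟨-, h⟩
            rw [hup] at h
            exact hsD ((hle hs).1 h)
          rw [indicator_of_notMem (by exact hacc), indicator_of_notMem (by exact hsD)]
          simp
      have hR : ∀ s ∈ Ioi (0 : ℝ), S.weight (N + 1) q p s * (g ⟨N + 1, q, p, s⟩ *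
          S.lowered (fun y => f (S.rev y)) (N + 1) q (-p) s) = (Ici (-(S.mn * D))).indicator
          (fun s => S.weight (N + 1) q p s * (f ⟨N, ⟨head (S.d_le N) q.1, S.head_mem N q⟩,
              head (S.d_le N) p, s + S.mn * D⟩ * g ⟨N + 1, q, p, s⟩)) s := by
        intro s hs
        simp only [lowered, barrierDown_neg, hdown]
        have hle' := hle (t := -D) hs
        rw [mul_neg] at hle'
        by_cases hsD : -(S.mn * D) ≤ s
        · rw [if_pos (hle'.2 hsD), indicator_of_mem (by exact hsD)]
          simp only [rev, S.crossed_neg_of_pos hs, EReal.toReal_coe, head_neg, neg_neg]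
          rw [mul_neg, sub_neg_eq_add]
          ring
        · rw [if_neg fun h => hsD (hle'.1 h), indicator_of_notMem (by exact hsD)]
          simp
      rw [setLIntegral_congr_fun measurableSet_Ioi hL, setLIntegral_congr_fun measurableSet_Ioi hR]
      refine lintegral_Ioi_shift fun u hu huc => ?_
      rw [S.weight_mul_rho hpos hu.le huc.le, add_sub_cancel_right]
    -- A point that is never proposed contributes nothing: on the left `ρ` is a factor, on the right
    -- the barrier is `⊤` and lowering is always rejected.
    · have hz : ρ₀ = 0 := hzero.symm
      have hdown : S.barrierDown N q p = ⊤ := S.barrierDown_of_eq_zero hzero.symm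
      have hL : ∀ s, G (S.split N (q, p)) s = 0 := by
        intro s
        simp only [G, split, splitPos, raisedIntegrand]
        rw [← hρ₀, hz]
        simp
      simp [hL, lowered, barrierDown_neg, hdown]
  · intro z hz
    have : ∀ s, G z s = 0 := fun s => by
      simp only [G, raisedIntegrand, S.ρ_support N z.1.1.1 z.1.1.2 z.1.2 z.2.1 z.2.2 hz]
      simp
    simp [this]

end Model

/-! ### Reversed detailed balance of the jump kernel -/

namespace Model

variable (S : Model)

/-- Flow of mass by raising the index from `N`. -/
def raiseFlux (f g : S.Fib → ℝ≥0∞) (N : ℕ) : ℝ≥0∞ :=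
  ∫⁻ x, (∫⁻ s in Ioi 0, S.weight N x.1 x.2 s *
    (f ⟨N, x.1, x.2, s⟩ * S.raised g N x.1 x.2 s)) ∂S.vol N

/-- Flow of mass by lowering the index from `N`. -/
def lowerFlux (f g : S.Fib → ℝ≥0∞) (N : ℕ) : ℝ≥0∞ :=
  ∫⁻ x, (∫⁻ s in Ioi 0, S.weight N x.1 x.2 s *
    (f ⟨N, x.1, x.2, -s⟩ * S.lowered g N x.1 x.2 s)) ∂S.vol N

/-- Flow of mass by reflections at index `N`. -/
def reflectFlux (f g : S.Fib → ℝ≥0∞) (N : ℕ) : ℝ≥0∞ :=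
  ∫⁻ x, (∫⁻ s in Ioi 0, S.weight N x.1 x.2 s *
    (f ⟨N, x.1, x.2, s⟩ * g ⟨N, x.1, x.2, -s⟩ * S.rejectUp N x.1 x.2 s +
      f ⟨N, x.1, x.2, -s⟩ * g ⟨N, x.1, x.2, s⟩ * S.rejectDown N x.1 x.2 s)) ∂S.vol N

variable {f g : S.Fib → ℝ≥0∞}

theorem lintegral_mul_jumpKernel (hf : Measurable f) (hg : Measurable g) :
    ∫⁻ y, f y * ∫⁻ z, g z ∂S.jumpKernel y ∂S.fibMeasure =
      ∑' N, S.raiseFlux f g N + ∑' N, S.lowerFlux f g N + ∑' N, S.reflectFlux f g N := by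
  rw [S.lintegral_fibMeasure (F := fun y => f y * ∫⁻ z, g z ∂S.jumpKernel y)
    (hf.mul hg.lintegral_kernel), ← ENNReal.tsum_add,
    ← ENNReal.tsum_add]
  refine tsum_congr fun N => ?_
  have hw : Measurable fun z : (S.V N × E (S.d N)) × ℝ => S.weight N z.1.1 z.1.2 z.2 :=
    S.measurable_weight (by fun_prop) (by fun_prop) (by fun_prop)
  have h1 : Measurable fun z : (S.V N × E (S.d N)) × ℝ => S.weight N z.1.1 z.1.2 z.2 *
      (f ⟨N, z.1.1, z.1.2, z.2⟩ * S.raised g N z.1.1 z.1.2 z.2) :=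
    hw.mul ((S.measurable_fib_comp hf (by fun_prop) (by fun_prop) (by fun_prop)).mul
      (S.measurable_raised hg (by fun_prop) (by fun_prop) (by fun_prop)))
  have h2 : Measurable fun z : (S.V N × E (S.d N)) × ℝ => S.weight N z.1.1 z.1.2 z.2 *
      (f ⟨N, z.1.1, z.1.2, -z.2⟩ * S.lowered g N z.1.1 z.1.2 z.2) :=
    hw.mul ((S.measurable_fib_comp hf (by fun_prop) (by fun_prop) (by fun_prop)).mul
      (S.measurable_lowered hg (by fun_prop) (by fun_prop) (by fun_prop)))
  have h1' := h1.lintegral_prod_right' (ν := volume.restrict (Ioi 0))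
  have h2' := h2.lintegral_prod_right' (ν := volume.restrict (Ioi 0))
  rw [raiseFlux, lowerFlux, reflectFlux, add_assoc, ← lintegral_add_left h2',
    ← lintegral_add_left h1']
  refine lintegral_congr fun x => ?_
  have hq : Measurable fun _ : ℝ => x.1 := measurable_const
  have hp : Measurable fun _ : ℝ => x.2 := measurable_const
  have hs : Measurable fun s : ℝ => s := measurable_id
  have hwx : Measurable fun s : ℝ => S.weight N x.1 x.2 s := S.measurable_weight hq hp hs
  have h1x : Measurable fun s : ℝ => S.weight N x.1 x.2 s *
    (f ⟨N, x.1, x.2, s⟩ * S.raised g N x.1 x.2 s) :=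
    hwx.mul ((S.measurable_fib_comp hf hq hp hs).mul (S.measurable_raised hg hq hp hs))
  have h2x : Measurable fun s : ℝ => S.weight N x.1 x.2 s *
    (f ⟨N, x.1, x.2, -s⟩ * S.lowered g N x.1 x.2 s) :=
    hwx.mul ((S.measurable_fib_comp hf hq hp hs.neg).mul (S.measurable_lowered hg hq hp hs))
  rw [← lintegral_add_left h2x, ← lintegral_add_left h1x]
  refine setLIntegral_congr_fun measurableSet_Ioi fun s hs => ?_
  rw [S.lintegral_jumpKernel_of_nonneg hg N x.1 x.2 (le_of_lt hs),
    S.lintegral_jumpKernel_neg hg N x.1 x.2 hs]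
  ring

theorem measurable_lowerFlux_integrand (hf : Measurable f) (hg : Measurable g) (N : ℕ) :
    Measurable fun x : S.V N × E (S.d N) => ∫⁻ s in Ioi 0, S.weight N x.1 x.2 s *
      (f ⟨N, x.1, x.2, -s⟩ * S.lowered g N x.1 x.2 s) := by
  refine Measurable.lintegral_prod_right' (f := fun z : (S.V N × E (S.d N)) × ℝ =>
    S.weight N z.1.1 z.1.2 z.2 *
      (f ⟨N, z.1.1, z.1.2, -z.2⟩ * S.lowered g N z.1.1 z.1.2 z.2)) ?_
  exact (S.measurable_weight (by fun_prop) (by fun_prop) (by fun_prop)).mul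
    ((S.measurable_fib_comp hf (by fun_prop) (by fun_prop) (by fun_prop)).mul
      (S.measurable_lowered hg (by fun_prop) (by fun_prop) (by fun_prop)))

theorem measurable_reflectFlux_integrand (hf : Measurable f) (hg : Measurable g) (N : ℕ) :
    Measurable fun x : S.V N × E (S.d N) => ∫⁻ s in Ioi 0, S.weight N x.1 x.2 s *
      (f ⟨N, x.1, x.2, s⟩ * g ⟨N, x.1, x.2, -s⟩ * S.rejectUp N x.1 x.2 s +
        f ⟨N, x.1, x.2, -s⟩ * g ⟨N, x.1, x.2, s⟩ * S.rejectDown N x.1 x.2 s) := by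
  refine Measurable.lintegral_prod_right' (f := fun z : (S.V N × E (S.d N)) × ℝ =>
    S.weight N z.1.1 z.1.2 z.2 *
      (f ⟨N, z.1.1, z.1.2, z.2⟩ * g ⟨N, z.1.1, z.1.2, -z.2⟩ * S.rejectUp N z.1.1 z.1.2 z.2 +
        f ⟨N, z.1.1, z.1.2, -z.2⟩ * g ⟨N, z.1.1, z.1.2, z.2⟩ *
          S.rejectDown N z.1.1 z.1.2 z.2)) ?_
  have h : ∀ {u : S.Fib → ℝ≥0∞}, Measurable u →
      Measurable (fun z : (S.V N × E (S.d N)) × ℝ => u ⟨N, z.1.1, z.1.2, z.2⟩) ∧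
      Measurable (fun z : (S.V N × E (S.d N)) × ℝ => u ⟨N, z.1.1, z.1.2, -z.2⟩) :=
    fun hu => ⟨S.measurable_fib_comp hu (by fun_prop) (by fun_prop) (by fun_prop),
      S.measurable_fib_comp hu (by fun_prop) (by fun_prop) (by fun_prop)⟩
  exact (S.measurable_weight (by fun_prop) (by fun_prop) (by fun_prop)).mul
    ((((h hf).1.mul (h hg).2).mul
      (S.measurable_rejectUp (by fun_prop) (by fun_prop) (by fun_prop))).add
    (((h hf).2.mul (h hg).1).mul
      (S.measurable_rejectDown (by fun_prop) (by fun_prop) (by fun_prop))))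

/-- A reflection followed by reversal only changes the sign of `p`. Each of the two terms is
therefore mapped to itself, the rejection probabilities being even in `p`. -/
theorem reflectFlux_rev (hf : Measurable f) (hg : Measurable g) (N : ℕ) :
    S.reflectFlux (fun y => g (S.rev y)) (fun y => f (S.rev y)) N = S.reflectFlux f g N := by
  rw [reflectFlux, ← S.lintegral_neg_momentum N _ (S.measurable_reflectFlux_integrand
    (f := fun y => g (S.rev y)) (g := fun y => f (S.rev y))
    (hg.comp S.measurable_rev) (hf.comp S.measurable_rev) N)]
  refine lintegral_congr fun x => lintegral_congr fun s => ?_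
  simp only [rev, neg_neg, weight_neg_left, rejectUp_neg, rejectDown_neg]
  ring

theorem raiseFlux_eq_lowerFlux (hf : Measurable f) (hg : Measurable g) (N : ℕ) :
    S.raiseFlux f g N = S.lowerFlux (fun y => g (S.rev y)) (fun y => f (S.rev y)) (N + 1) := by
  rw [raiseFlux, S.lintegral_raised_eq_lowered hf hg, lowerFlux,
    ← S.lintegral_neg_momentum (N + 1) _ (S.measurable_lowerFlux_integrand
    (f := fun y => g (S.rev y)) (g := fun y => f (S.rev y))
    (hg.comp S.measurable_rev) (hf.comp S.measurable_rev) (N + 1))]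
  refine lintegral_congr fun x => lintegral_congr fun s => ?_
  simp only [rev, neg_neg, weight_neg_left]

theorem tsum_raiseFlux (hf : Measurable f) (hg : Measurable g) :
    ∑' N, S.raiseFlux f g N =
      ∑' N, S.lowerFlux (fun y => g (S.rev y)) (fun y => f (S.rev y)) N := by
  -- Raising from `N` pairs with lowering from `N + 1`; the unpaired index `0` cannot be lowered.
  rw [tsum_eq_zero_add' (f := S.lowerFlux (fun y => g (S.rev y)) fun y => f (S.rev y))
    ENNReal.summable]
  have h0 : S.lowerFlux (fun y => g (S.rev y)) (fun y => f (S.rev y)) 0 = 0 := by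
    simp [lowerFlux, lowered]
  rw [h0, zero_add]
  exact tsum_congr fun N => S.raiseFlux_eq_lowerFlux hf hg N

/-- Passing to reversed functions exchanges the raising and lowering fluxes and fixes the reflection
flux. -/
theorem revAdjoint_jumpKernel : S.RevAdjoint S.jumpKernel S.jumpKernel := by
  intro f g hf hg
  have hfr : Measurable fun y => f (S.rev y) := hf.comp S.measurable_rev
  have hgr : Measurable fun y => g (S.rev y) := hg.comp S.measurable_rev
  rw [S.lintegral_mul_jumpKernel hf hg, S.lintegral_mul_jumpKernel hgr hfr,
    S.tsum_raiseFlux hf hg, S.tsum_raiseFlux hgr hfr]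
  simp only [rev_rev, S.reflectFlux_rev hf hg]
  rw [add_comm (∑' N, S.lowerFlux f g N)]

end Model

theorem map_bind_eq {X Y Z : Type*} [MeasurableSpace X] [MeasurableSpace Y] [MeasurableSpace Z]
    (μ : Measure X) {η : X → Measure Y} (hη : Measurable η) {e : Y → Z} (he : Measurable e) :
    (μ.bind η).map e = μ.bind fun x => (η x).map e := by
  have h : Measurable fun x => (η x).map e := (Measure.measurable_map e he).comp hη
  refine Measure.ext fun s hs => ?_
  rw [Measure.map_apply he hs, Measure.bind_apply (he hs) hη.aemeasurable,
    Measure.bind_apply hs h.aemeasurable]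
  exact lintegral_congr fun x => (Measure.map_apply he hs).symm

namespace Model

variable (S : Model)

/-! ### The clock -/

theorem emb_of_neg {N : ℕ} (c : ℝ) (q : S.V N) (p : E (S.d N)) {a : ℝ} (ha : a < 0) :
    S.emb c ⟨N, q, p, a⟩ = ⟨N, q, p, N + 1 - c, a⟩ := by
  simp only [emb, if_pos ha]

theorem emb_of_nonneg {N : ℕ} (c : ℝ) (q : S.V N) (p : E (S.d N)) {a : ℝ} (ha : 0 ≤ a) :
    S.emb c ⟨N, q, p, a⟩ = ⟨N, q, p, N + c, a⟩ := by
  simp only [emb, if_neg ha.not_gt]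

/-- Only the clock enters, not `y`: this makes the sequence of hitting times deterministic. -/
theorem hitTime_emb (c : ℝ) (y : S.Fib) : S.hitTime (S.emb c y) = S.mn * (1 - c) := by
  obtain ⟨N, q, p, a⟩ := y
  by_cases ha : a < 0
  · simp only [emb, hitTime, if_pos ha]; ring
  · simp only [emb, hitTime, if_neg ha]; ring

theorem evolve_emb (t c : ℝ) (y : S.Fib) :
    S.evolve t (S.emb c y) = S.emb (c + t / S.mn) (S.flowFib t y) := by
  obtain ⟨N, q, p, a⟩ := y
  by_cases ha : a < 0
  · rw [flowFib, S.emb_of_neg c _ _ ha, S.emb_of_neg _ _ _ ha]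
    have : (N : ℝ) + 1 - c + t * (-1 / S.mn) = N + 1 - (c + t / S.mn) := by ring
    simp only [evolve, sgn, if_pos ha, this]
  · rw [flowFib, S.emb_of_nonneg c _ _ (not_lt.1 ha), S.emb_of_nonneg _ _ _ (not_lt.1 ha)]
    have : (N : ℝ) + c + t * (1 / S.mn) = N + (c + t / S.mn) := by ring
    simp only [evolve, sgn, if_neg ha, this]

/-- Fibre points from which a jump may lead to `p_n = 0`. -/
def degenerate : Set S.Fib :=
  {y | match y with
    | ⟨0, _, _, a⟩ => a = 0
    | ⟨N + 1, q, p, a⟩ => a = 0 ∨ -a = S.mn * (S.barrierDown N q p).toReal}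

theorem measurableSet_degenerate : MeasurableSet S.degenerate := by
  refine measurableSet_sigma_iff.2 fun N => ?_
  cases N with
  | zero =>
    exact measurableSet_eq_fun (f := fun x : S.V 0 × E (S.d 0) × ℝ => x.2.2) (by fun_prop)
      measurable_const
  | succ N =>
    have hb := S.measurable_barrierDown (N := N)
      (q := fun x : S.V (N + 1) × E (S.d (N + 1)) × ℝ => x.1) (p := fun x => x.2.1)
      (by fun_prop) (by fun_prop)
    exact (measurableSet_eq_fun (f := fun x : S.V (N + 1) × E (S.d (N + 1)) × ℝ => x.2.2)
      (by fun_prop) measurable_const).union (measurableSet_eq_fun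
        (f := fun x : S.V (N + 1) × E (S.d (N + 1)) × ℝ => -x.2.2) (by fun_prop)
          (hb.ereal_toReal.const_mul _))

/-- For fixed `(q, p)` only finitely many values of `p_n` are excluded. They must be avoided because
`sgn 0 = 1`: a downward motion arriving at `p_n = 0` would turn upwards without a barrier. -/
theorem ae_notMem_degenerate : ∀ᵐ y ∂S.fibMeasure, y ∉ S.degenerate := by
  have hm : Measurable (S.degenerate.indicator (1 : S.Fib → ℝ≥0∞)) :=
    measurable_one.indicator S.measurableSet_degenerate
  rw [← measure_eq_zero_iff_ae_notMem, ← lintegral_indicator_one S.measurableSet_degenerate,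
    S.lintegral_fibMeasure hm, ENNReal.tsum_eq_zero]
  intro N
  refine (lintegral_congr fun x => ?_).trans lintegral_zero
  have hne : ∀ c : ℝ, ∀ᵐ s : ℝ, s ≠ c := fun c => by simp [ae_iff]
  refine (setLIntegral_congr_fun_ae measurableSet_Ioi ?_).trans lintegral_zero
  cases N with
  | zero =>
    refine Filter.Eventually.of_forall fun s hs => ?_
    have h1 : (⟨0, x.1, x.2, s⟩ : S.Fib) ∉ S.degenerate := (ne_of_gt hs : s ≠ 0)
    have h2 : (⟨0, x.1, x.2, -s⟩ : S.Fib) ∉ S.degenerate := fun h =>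
      (ne_of_gt hs : s ≠ 0) (neg_eq_zero.1 h)
    rw [indicator_of_notMem h1, indicator_of_notMem h2, add_zero, mul_zero]
  | succ N =>
    filter_upwards [hne (S.mn * (S.barrierDown N x.1 x.2).toReal),
      hne (-(S.mn * (S.barrierDown N x.1 x.2).toReal))] with s hs1 hs2 hs
    have hs0 : s ≠ 0 := ne_of_gt hs
    have h1 : (⟨N + 1, x.1, x.2, s⟩ : S.Fib) ∉ S.degenerate := by
      rintro (h | h)
      · exact hs0 h
      · exact hs2 (by rw [← h, neg_neg])
    have h2 : (⟨N + 1, x.1, x.2, -s⟩ : S.Fib) ∉ S.degenerate := by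
      rintro (h | h)
      · exact hs0 (neg_eq_zero.1 h)
      · exact hs1 (by rw [← h, neg_neg])
    rw [indicator_of_notMem h1, indicator_of_notMem h2, add_zero, mul_zero]

theorem ae_momentum_ne_zero : ∀ᵐ y ∂S.fibMeasure, y.2.2.2 ≠ 0 := by
  filter_upwards [S.ae_notMem_degenerate] with y hy h
  obtain ⟨_ | N, q, p, a⟩ := y
  · exact hy h
  · exact hy (Or.inl h)

theorem crossed_nonneg {s : ℝ} (hs : 0 < s) {δ : EReal} (hδ : δ ≤ (S.kinN s : EReal)) :
    0 ≤ S.crossed s δ := by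
  rw [S.crossed_of_pos hs]
  have h : S.mn * δ.toReal ≤ s := by
    induction δ with
    -- A barrier `-∞` has `toReal` equal to `0`, so crossing it leaves the momentum unchanged.
    | bot => simpa using hs.le
    | coe x =>
      rw [EReal.coe_le_coe_iff, kinN, abs_of_pos hs, le_div_iff₀ S.mn_pos] at hδ
      rw [EReal.toReal_coe, mul_comm]
      exact hδ
    | top => simp at hδ
  linarith

/-- Raised, lowered or reflected, the point sits at the end of its interval that it is leaving, so
its clock restarts at `0` and `n` is recovered from the fibre point. -/
theorem jump_emb_one {y : S.Fib} (hy : y ∉ S.degenerate) :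
    S.jump (S.emb 1 y) = (S.jumpKernel y).map (S.emb 0) := by
  change _ = ((S.jump (S.emb 1 y)).map S.proj).map (S.emb 0)
  rw [Measure.map_map (S.measurable_emb_right 0) S.measurable_proj]
  obtain ⟨N, q, p, a⟩ := y
  have ha0 : a ≠ 0 := by
    rintro rfl
    cases N with
    | zero => exact hy rfl
    | succ N => exact hy (Or.inl rfl)
  rcases lt_or_gt_of_ne ha0 with ha | ha
  · obtain ⟨s, hs, rfl⟩ : ∃ s, 0 < s ∧ a = -s := ⟨-a, by linarith, by ring⟩
    rw [S.jump_emb_neg N q p hs, Measure.map_dirac' ((S.measurable_emb_right 0).comp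
      S.measurable_proj)]
    congr 1
    cases N with
    | zero => simp [jumpDown, proj, emb, hs.not_gt]
    | succ N =>
      simp only [jumpDown, kinN_neg]
      split_ifs with hδ
      · have h1 := S.crossed_nonneg hs hδ
        have h2 : S.crossed s (S.barrierDown N q p) ≠ 0 := by
          rw [S.crossed_of_pos hs]
          intro h
          exact hy (Or.inr (by rw [neg_neg]; linarith))
        have h3 : S.crossed (-s) (S.barrierDown N q p) < 0 := by
          rw [S.crossed_neg_of_pos hs, ← S.crossed_of_pos hs, neg_lt_zero]
          exact lt_of_le_of_ne h1 h2.symm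
        simp [proj, emb, h3]
      · simp [proj, emb, hs.not_gt]
  · rw [S.jump_emb_of_nonneg N q p ha.le, Measure.map_map ((S.measurable_emb_right 0).comp
      S.measurable_proj) (S.measurable_jumpUp_right ..)]
    congr 1
    funext w
    simp only [Function.comp]
    by_cases hw : S.AcceptUp N q p a w
    -- A raise ending at `p_n = 0` is harmless, since `sgn 0 = 1` keeps the upward direction.
    · have h1 := S.crossed_nonneg ha hw.2
      rw [S.jumpUp_of_accept hw]
      simp [proj, emb, h1.not_gt]
    · rw [S.jumpUp_of_not_accept hw]
      simp [proj, emb, ha]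

/-! ### Iterated jumps -/

/-- `j + 1` jumps separated by Hamiltonian flow during time `m_n`. -/
def chain : ℕ → Kernel S.Fib S.Fib
  | 0 => S.jumpKernel
  | j + 1 => chain j ∘ₖ (S.flowKernel S.mn ∘ₖ S.jumpKernel)

instance (j : ℕ) : IsMarkovKernel (S.chain j) := by
  induction j with
  | zero => exact inferInstanceAs (IsMarkovKernel S.jumpKernel)
  | succ j ih => unfold chain; infer_instance

/-- The definition adds a jump at the start, whereas the adjoint adds it at the end; the alternating
word is a palindrome. -/
theorem chain_succ' (j : ℕ) :
    S.chain (j + 1) = S.jumpKernel ∘ₖ (S.flowKernel S.mn ∘ₖ S.chain j) := by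
  induction j with
  | zero => rfl
  | succ j ih =>
    change S.chain (j + 1) ∘ₖ (S.flowKernel S.mn ∘ₖ S.jumpKernel) =
      S.jumpKernel ∘ₖ (S.flowKernel S.mn ∘ₖ (S.chain j ∘ₖ (S.flowKernel S.mn ∘ₖ S.jumpKernel)))
    rw [ih]
    simp only [Kernel.comp_assoc]

theorem revAdjoint_chain (j : ℕ) : S.RevAdjoint (S.chain j) (S.chain j) := by
  induction j with
  | zero => exact S.revAdjoint_jumpKernel
  | succ j ih =>
    have h := (S.revAdjoint_jumpKernel.comp (S.revAdjoint_flowKernel S.mn)).comp ih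
    rwa [Kernel.comp_assoc, ← S.chain_succ'] at h

/-- `j + 1` jumps preceded by flow during time `r` and followed by flow during time `s`. -/
def path (j : ℕ) (r s : ℝ) : Kernel S.Fib S.Fib :=
  S.flowKernel s ∘ₖ (S.chain j ∘ₖ S.flowKernel r)

instance (j : ℕ) (r s : ℝ) : IsMarkovKernel (S.path j r s) := by
  unfold path; infer_instance

/-- Reading the word backwards exchanges the initial and final flow times. -/
theorem revAdjoint_path (j : ℕ) (r s : ℝ) : S.RevAdjoint (S.path j r s) (S.path j s r) := by
  have h := ((S.revAdjoint_flowKernel r).comp (S.revAdjoint_chain j)).comp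
    (S.revAdjoint_flowKernel s)
  rwa [Kernel.comp_assoc] at h

/-! ### The dynamics as an alternating product of flows and jumps -/

theorem comp_flowKernel_apply (κ : Kernel S.Fib S.Fib) (t : ℝ) (y : S.Fib) :
    (κ ∘ₖ S.flowKernel t) y = κ (S.flowFib t y) := by
  rw [flowKernel, Kernel.comp_deterministic_eq_comap, Kernel.comap_apply]

theorem ae_flowFib {P : S.Fib → Prop} (h : ∀ᵐ y ∂S.fibMeasure, P y) (t : ℝ) :
    ∀ᵐ y ∂S.fibMeasure, P (S.flowFib t y) := by
  have hb := (S.revAdjoint_flowKernel t).bind_eq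
  rw [flowKernel, show (⇑(Kernel.deterministic (S.flowFib t) (S.measurable_flowFib t)) :
    S.Fib → Measure S.Fib) = fun y => Measure.dirac (S.flowFib t y) from rfl,
    Measure.bind_dirac_eq_map _ (S.measurable_flowFib t)] at hb
  rw [← hb] at h
  exact ae_of_ae_map (S.measurable_flowFib t).aemeasurable h

theorem ae_ae_of_revAdjoint {κ η : Kernel S.Fib S.Fib} [IsMarkovKernel η]
    (hκ : S.RevAdjoint κ η) {P : S.Fib → Prop} (h : ∀ᵐ y ∂S.fibMeasure, P y) :
    ∀ᵐ y ∂S.fibMeasure, ∀ᵐ z ∂κ y, P z := by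
  rw [← hκ.bind_eq] at h
  exact Measure.ae_ae_of_ae_bind κ.measurable.aemeasurable h

theorem dynAux_emb_of_lt (k : ℕ) {t c : ℝ} (h : t < S.mn * (1 - c)) (y : S.Fib) :
    S.dynAux k t (S.emb c y) = Measure.dirac (S.emb (c + t / S.mn) (S.flowFib t y)) := by
  cases k with
  | zero => rw [dynAux, evolve_emb]
  | succ k => rw [dynAux, hitTime_emb, if_pos h, evolve_emb]

theorem dynAux_emb_of_le (k : ℕ) {t c : ℝ} (h : S.mn * (1 - c) ≤ t) (y : S.Fib) :
    S.dynAux (k + 1) t (S.emb c y) = (S.jump (S.emb 1 (S.flowFib (S.mn * (1 - c)) y))).bind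
      (S.dynAux k (t - S.mn * (1 - c))) := by
  have hm := S.mn_pos.ne'
  have h1 : c + S.mn * (1 - c) / S.mn = 1 := by field_simp; ring
  rw [dynAux, hitTime_emb, if_neg h.not_gt, evolve_emb, h1]

theorem measurable_dynAux_right (k : ℕ) (t : ℝ) : Measurable (S.dynAux k t) :=
  (S.measurable_dynAux k).comp (measurable_const.prodMk measurable_id)

/-- After the jump the clock is `0`, so exactly `j` further hits occur before time `j mn + s < (j +
1) mn`, and any budget `k ≥ j` processes them all. -/
theorem ae_jump_bind_dynAux (j k : ℕ) (hk : j ≤ k) {s : ℝ} (hs0 : 0 ≤ s) (hs : s < S.mn) :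
    ∀ᵐ y ∂S.fibMeasure, (S.jump (S.emb 1 y)).bind (S.dynAux k (j * S.mn + s)) =
      ((S.flowKernel s ∘ₖ S.chain j) y).map (S.emb (s / S.mn)) := by
  have hemb := S.measurable_emb_right
  have hmap : ∀ (k : ℕ) (t : ℝ) (y : S.Fib), y ∉ S.degenerate →
      (S.jump (S.emb 1 y)).bind (S.dynAux k t) =
        (S.jumpKernel y).bind fun z => S.dynAux k t (S.emb 0 z) := by
    intro k t y hy
    have hd : Measurable fun z => Measure.dirac (S.emb 0 z) :=
      Measure.measurable_dirac.comp (hemb 0)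
    rw [S.jump_emb_one hy, ← Measure.bind_dirac_eq_map _ (hemb 0), Measure.bind_bind
      hd.aemeasurable
      (S.measurable_dynAux_right k t).aemeasurable]
    simp only [Measure.dirac_bind (S.measurable_dynAux_right k t)]
  induction j generalizing k with
  | zero =>
    filter_upwards [S.ae_notMem_degenerate] with y hy
    have h : ∀ z, S.dynAux k ((0 : ℕ) * S.mn + s) (S.emb 0 z) =
        (S.flowKernel s z).map (S.emb (s / S.mn)) := by
      intro z
      rw [S.dynAux_emb_of_lt k (by simpa using hs), flowKernel, Kernel.deterministic_apply,
        Measure.map_dirac' (hemb _)]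
      simp
    rw [hmap _ _ _ hy]
    simp only [h]
    rw [← map_bind_eq _ (S.flowKernel s).measurable (hemb _), Kernel.comp_apply]
    rfl
  | succ j ih =>
    obtain ⟨k, rfl⟩ : ∃ k', k = k' + 1 := ⟨k - 1, by omega⟩
    -- The induction hypothesis holds only almost everywhere; invariance of the Boltzmann measure
    -- makes it hold almost surely after a jump and a flow.
    have h1 := S.ae_ae_of_revAdjoint S.revAdjoint_jumpKernel
      (S.ae_flowFib (ih k (by omega)) S.mn)
    filter_upwards [S.ae_notMem_degenerate, h1] with y hy hz
    rw [hmap _ _ _ hy]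
    have h2 : (fun z => S.dynAux (k + 1) ((j + 1 : ℕ) * S.mn + s) (S.emb 0 z)) =ᵐ[S.jumpKernel y]
        fun z => (((S.flowKernel s ∘ₖ S.chain j) ∘ₖ S.flowKernel S.mn) z).map
          (S.emb (s / S.mn)) := by
      filter_upwards [hz] with z hz
      have hj : (0 : ℝ) ≤ j * S.mn := mul_nonneg j.cast_nonneg S.mn_pos.le
      rw [S.dynAux_emb_of_le k (by push_cast; linarith [S.mn_pos]), sub_zero, mul_one,
        comp_flowKernel_apply, ← hz]
      congr 2
      push_cast
      ring
    rw [Measure.bind_congr_right h2, ← map_bind_eq _ (Kernel.measurable _) (hemb _),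
      ← Kernel.comp_apply, chain]
    simp only [Kernel.comp_assoc]

theorem ae_dynAux_emb (j k : ℕ) (hk : j < k) {c s t : ℝ} (hs0 : 0 ≤ s) (hs : s < S.mn)
    (ht : t = S.mn * (1 - c) + j * S.mn + s) :
    ∀ᵐ y ∂S.fibMeasure, S.dynAux k t (S.emb c y) =
      (S.path j (S.mn * (1 - c)) s y).map (S.emb (s / S.mn)) := by
  obtain ⟨k, rfl⟩ : ∃ k', k = k' + 1 := ⟨k - 1, by omega⟩
  have hj : (0 : ℝ) ≤ j * S.mn := mul_nonneg j.cast_nonneg S.mn_pos.le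
  filter_upwards [S.ae_flowFib (S.ae_jump_bind_dynAux j k (by omega) hs0 hs)
    (S.mn * (1 - c))] with y hy
  rw [S.dynAux_emb_of_le k (by linarith), path, ← Kernel.comp_assoc, comp_flowKernel_apply, ← hy]
  congr 2
  rw [ht]
  ring

/-- The transition kernel on the fibre space of the dynamics run for time `T` from clock `c`. -/
def clockKernel (T c : ℝ) : Kernel S.Fib S.Fib :=
  match ⌊c + T / S.mn⌋₊ with
  | 0 => S.flowKernel T
  | j + 1 => S.path j (S.mn * (1 - c)) (S.mn * Int.fract (c + T / S.mn))

instance (T c : ℝ) : IsMarkovKernel (S.clockKernel T c) := by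
  unfold clockKernel
  split <;> infer_instance

theorem ae_dyn_emb {T c : ℝ} (hT : 0 ≤ T) (hc0 : 0 ≤ c) (hc1 : c < 1) :
    ∀ᵐ y ∂S.fibMeasure, S.dyn T (S.emb c y) =
      (S.clockKernel T c y).map (S.emb (Int.fract (c + T / S.mn))) := by
  have hm := S.mn_pos
  have hτ : 0 ≤ T / S.mn := div_nonneg hT hm.le
  have hx0 : 0 ≤ c + T / S.mn := by linarith
  have hfl : (⌊c + T / S.mn⌋₊ : ℝ) + Int.fract (c + T / S.mn) = c + T / S.mn := by
    rw [natCast_floor_eq_intCast_floor hx0]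
    exact Int.floor_add_fract _
  have hf0 := Int.fract_nonneg (c + T / S.mn)
  have hf1 := Int.fract_lt_one (c + T / S.mn)
  unfold clockKernel dyn
  rcases hk : ⌊c + T / S.mn⌋₊ with _ | j
  · refine Filter.Eventually.of_forall fun y => ?_
    rw [hk, Nat.cast_zero, zero_add] at hfl
    have hlt : T < S.mn * (1 - c) := by
      have : T / S.mn < 1 - c := by linarith
      rwa [div_lt_iff₀ hm, mul_comm] at this
    rw [S.dynAux_emb_of_lt _ hlt, hfl, flowKernel, Kernel.deterministic_apply,
      Measure.map_dirac' (S.measurable_emb_right _)]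
  · rw [hk] at hfl
    push_cast at hfl
    have hT' : T = S.mn * (T / S.mn) := by field_simp
    -- Since `c < 1`, the identity `j + 1 + fract = c + T / mn` gives `j ≤ T / mn`: the hit budget
    -- in `dyn` suffices.
    have hjk : j < ⌊T / S.mn⌋₊ + 1 := by
      have h1 : (j : ℝ) ≤ T / S.mn := by linarith
      exact Nat.lt_succ_of_le (Nat.le_floor h1)
    have h := S.ae_dynAux_emb j (⌊T / S.mn⌋₊ + 1) hjk (c := c) (t := T)
      (s := S.mn * Int.fract (c + T / S.mn)) (mul_nonneg hm.le hf0) (by nlinarith)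
      (by
        have h2 : T / S.mn = j + 1 + Int.fract (c + T / S.mn) - c := by linarith
        generalize Int.fract (c + T / S.mn) = F at h2
        rw [hT', h2]
        ring)
    rw [mul_div_cancel_left₀ _ hm.ne'] at h
    exact h

/-! ### Reversal of the clock -/

theorem fract_reverse {c τ : ℝ} (hc0 : 0 < c) (hc1 : c < 1) :
    Int.fract (1 - Int.fract (c + τ) + τ) = 1 - c := by
  rw [Int.fract_eq_iff]
  refine ⟨by linarith, by linarith, ⌊c + τ⌋, ?_⟩
  have := Int.floor_add_fract (c + τ)
  linarith

/-- With `k = ⌊c + τ⌋`, the reversed clock ends at total `k + 1 - c`. The condition `c > 0` excludes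
an extra hit exactly at the final time. -/
theorem floor_reverse {c τ : ℝ} (hτ : 0 ≤ τ) (hc0 : 0 < c) (hc1 : c < 1) :
    ⌊1 - Int.fract (c + τ) + τ⌋₊ = ⌊c + τ⌋₊ := by
  have hf := Int.fract_lt_one (c + τ)
  have h1 : ((⌊c + τ⌋₊ : ℕ) : ℝ) + Int.fract (c + τ) = c + τ := by
    rw [natCast_floor_eq_intCast_floor (by linarith)]
    exact Int.floor_add_fract _
  rw [Nat.floor_eq_iff (by linarith)]
  constructor <;> linarith

/-- The reversed clock has the same number of jumps, and its first and last flow times are those of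
clock `c` exchanged. -/
theorem revAdjoint_clockKernel {T c : ℝ} (hT : 0 ≤ T) (hc0 : 0 < c) (hc1 : c < 1) :
    S.RevAdjoint (S.clockKernel T c) (S.clockKernel T (1 - Int.fract (c + T / S.mn))) := by
  unfold clockKernel
  rw [floor_reverse (div_nonneg hT S.mn_pos.le) hc0 hc1, fract_reverse hc0 hc1, sub_sub_cancel]
  generalize ⌊c + T / S.mn⌋₊ = k
  cases k with
  | zero => exact S.revAdjoint_flowKernel T
  | succ j => exact S.revAdjoint_path j _ _

end Model

/-- Rotation by `τ` and reflection of the circle preserve Lebesgue measure; two fundamental domains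
of `ℤ` in `ℝ` give the same integral of a periodic function. -/
theorem setLIntegral_fract_reverse {h : ℝ → ℝ≥0∞} (hh : Measurable h) (τ : ℝ) :
    ∫⁻ c in Ioo 0 1, h (1 - Int.fract (c + τ)) = ∫⁻ c in Ioo 0 1, h c := by
  have hk : Measurable fun x : ℝ => h (1 - Int.fract x) :=
    hh.comp (measurable_const.sub measurable_fract)
  have h1 := (measurePreserving_add_right volume τ).setLIntegral_comp_preimage
    (s := Ioc τ (τ + 1)) measurableSet_Ioc hk
  have hpre : (fun x : ℝ => x + τ) ⁻¹' Ioc τ (τ + 1) = Ioc 0 1 := by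
    ext x
    simp only [mem_preimage, mem_Ioc]
    constructor <;> rintro ⟨h1, h2⟩ <;> constructor <;> linarith
  have h2 := (isAddFundamentalDomain_Ioc (zero_lt_one' ℝ) τ volume).setLIntegral_eq
    (isAddFundamentalDomain_Ioc (zero_lt_one' ℝ) 0 volume) (fun x : ℝ => h (1 - Int.fract x)) (by
      rintro ⟨_, k, rfl⟩ x
      simp [AddSubgroup.vadd_def])
  have h3 := (Measure.measurePreserving_sub_left (volume : Measure ℝ) 1).setLIntegral_comp_preimage
    (s := Ioo 0 1) measurableSet_Ioo hh
  have hpre3 : (fun x : ℝ => 1 - x) ⁻¹' Ioo 0 1 = Ioo 0 1 := by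
    ext x
    simp only [mem_preimage, mem_Ioo]
    constructor <;> rintro ⟨h1, h2⟩ <;> constructor <;> linarith
  rw [hpre] at h1
  rw [hpre3] at h3
  rw [setLIntegral_congr Ioo_ae_eq_Ioc, h1, h2, zero_add, ← h3,
    ← setLIntegral_congr Ioo_ae_eq_Ioc]
  exact setLIntegral_congr_fun measurableSet_Ioo fun c hc => by
    rw [Int.fract_eq_self.2 ⟨hc.1.le, hc.2⟩]

theorem ae_fract_add_ne_zero (τ : ℝ) : ∀ᵐ c : ℝ, Int.fract (c + τ) ≠ 0 := by
  rw [ae_iff]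
  refine ((countable_range fun k : ℤ => (k : ℝ) - τ).mono fun c hc => ?_).measure_zero _
  have hc : Int.fract (c + τ) = 0 := not_not.1 hc
  exact ⟨⌊c + τ⌋, by have := Int.floor_add_fract (c + τ); simp only; linarith⟩

theorem measurable_uncurry_flip {X Y Z : Type*} [MeasurableSpace X] [MeasurableSpace Y]
    [MeasurableSpace Z] {f : X → Y → Z} (hf : Measurable (Function.uncurry f)) :
    Measurable (Function.uncurry fun y x => f x y) :=
  hf.comp measurable_swap

/-! ### Symmetry of correlations after averaging over the clock -/

namespace Model

variable (S : Model)

instance : SFinite S.fibMeasure := by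
  unfold fibMeasure; infer_instance

instance : SFinite S.target := by
  change SFinite (Measure.sum fun N => Measure.map (Sigma.mk N)
    (((S.volV N).prod volume).withDensity _))
  infer_instance

/-- The value of `f` at `x` times the expected value of `g` at time `T` from `x`. -/
def corr (T : ℝ) (f g : S.Pos → ℝ≥0∞) (x : S.Phase) : ℝ≥0∞ :=
  f (S.toPos x) * ∫⁻ z, g (S.toPos z) ∂S.dyn T x

/-- The correlation of `f` at time `0` and `g` at time `T` when the clock starts at `c`. -/
def flux (T : ℝ) (f g : S.Pos → ℝ≥0∞) (c : ℝ) : ℝ≥0∞ :=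
  ∫⁻ y, S.corr T f g (S.emb c y) ∂S.fibMeasure

variable {f g : S.Pos → ℝ≥0∞}

theorem measurable_lintegral_dyn (T : ℝ) (hg : Measurable g) :
    Measurable fun x => ∫⁻ z, g (S.toPos z) ∂S.dyn T x :=
  measurable_lintegral_param (κ := fun x => S.dyn T x) (f := fun _ z => g (S.toPos z))
    (S.measurable_dyn.comp (measurable_const.prodMk measurable_id)) (fun _ => inferInstance)
    ((hg.comp S.measurable_toPos).comp measurable_snd)

theorem measurable_corr (T : ℝ) (hf : Measurable f) (hg : Measurable g) :
    Measurable (S.corr T f g) :=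
  (hf.comp S.measurable_toPos).mul (S.measurable_lintegral_dyn T hg)

theorem measurable_flux (T : ℝ) (hf : Measurable f) (hg : Measurable g) :
    Measurable (S.flux T f g) :=
  Measurable.lintegral_prod_right' (f := fun z : ℝ × S.Fib => S.corr T f g (S.emb z.1 z.2))
    ((S.measurable_corr T hf hg).comp S.measurable_emb)

/-- Turning around exchanges the covered and the remaining part of the interval. At `p_n = 0` it
fails in general, as `sgn 0 = 1` does not change under reversal. -/
theorem toPos_emb_rev (c : ℝ) {y : S.Fib} (hy : y.2.2.2 ≠ 0) :
    S.toPos (S.emb c (S.rev y)) = S.toPos (S.emb (1 - c) y) := by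
  obtain ⟨N, q, p, a⟩ := y
  rcases lt_or_gt_of_ne hy with ha | ha
  · have ha : a < 0 := ha
    rw [rev, S.emb_of_nonneg c _ _ (by linarith), S.emb_of_neg _ _ _ ha, sub_sub_eq_add_sub,
      add_sub_right_comm, add_sub_cancel_right]
    rfl
  · have ha : 0 < a := ha
    rw [rev, S.emb_of_neg c _ _ (by linarith), S.emb_of_nonneg _ _ _ ha.le, add_sub_assoc]
    rfl

theorem flux_eq {T c : ℝ} (hT : 0 ≤ T) (hc0 : 0 ≤ c) (hc1 : c < 1) (f : S.Pos → ℝ≥0∞)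
    (hg : Measurable g) :
    S.flux T f g c = ∫⁻ y, f (S.toPos (S.emb c y)) *
      ∫⁻ z, g (S.toPos (S.emb (Int.fract (c + T / S.mn)) z)) ∂S.clockKernel T c y
        ∂S.fibMeasure := by
  refine lintegral_congr_ae ?_
  filter_upwards [S.ae_dyn_emb hT hc0 hc1] with y hy
  rw [corr, hy, lintegral_map (f := fun z => g (S.toPos z)) (hg.comp S.measurable_toPos)
    (S.measurable_emb_right _)]

theorem flux_reverse {T c : ℝ} (hT : 0 ≤ T) (hc0 : 0 < c) (hc1 : c < 1)
    (hF : Int.fract (c + T / S.mn) ≠ 0) (hf : Measurable f) (hg : Measurable g) :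
    S.flux T f g c = S.flux T g f (1 - Int.fract (c + T / S.mn)) := by
  have hadj := S.revAdjoint_clockKernel hT hc0 hc1
  have hF0 : 0 < Int.fract (c + T / S.mn) := lt_of_le_of_ne (Int.fract_nonneg _) hF.symm
  have hF1 := Int.fract_lt_one (c + T / S.mn)
  have hrev := fract_reverse (τ := T / S.mn) hc0 hc1
  rw [S.flux_eq hT hc0.le hc1 f hg, S.flux_eq hT (by linarith) (by linarith) g hf, hrev,
    hadj (fun y => f (S.toPos (S.emb c y)))
      (fun z => g (S.toPos (S.emb (Int.fract (c + T / S.mn)) z)))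
      (hf.comp (S.measurable_toPos.comp (S.measurable_emb_right _)))
      (hg.comp (S.measurable_toPos.comp (S.measurable_emb_right _)))]
  -- Adjointness gives invariance, so `p_n ≠ 0` also holds almost surely at the end of the reversed
  -- run.
  have hadj' := S.revAdjoint_clockKernel hT (c := 1 - Int.fract (c + T / S.mn))
    (by linarith) (by linarith)
  refine lintegral_congr_ae ?_
  filter_upwards [S.ae_momentum_ne_zero, S.ae_ae_of_revAdjoint hadj' S.ae_momentum_ne_zero]
    with y hy hz
  rw [S.toPos_emb_rev _ hy]
  congr 1
  refine lintegral_congr_ae ?_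
  filter_upwards [hz] with z hz
  rw [S.toPos_emb_rev _ hz]

theorem setLIntegral_flux_comm {T : ℝ} (hT : 0 ≤ T) (hf : Measurable f) (hg : Measurable g) :
    ∫⁻ c in Ioo 0 1, S.flux T f g c = ∫⁻ c in Ioo 0 1, S.flux T g f c := by
  rw [← setLIntegral_fract_reverse (S.measurable_flux T hg hf) (T / S.mn)]
  refine setLIntegral_congr_fun_ae measurableSet_Ioo ?_
  filter_upwards [ae_fract_add_ne_zero (T / S.mn)] with c hc h
  exact S.flux_reverse hT h.1 h.2 hc hf hg

/-! ### From clock and fibre back to the target -/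

theorem setLIntegral_emb {F : S.Phase → ℝ≥0∞} (hF : Measurable F) (N : ℕ) (q : S.V N)
    (p : E (S.d N)) (a : ℝ) :
    ∫⁻ c in Ioo 0 1, F (S.emb c ⟨N, q, p, a⟩) =
      ∫⁻ n in Ico (N : ℝ) (N + 1), F ⟨N, q, p, n, a⟩ := by
  have hF' : Measurable fun n : ℝ => F ⟨N, q, p, n, a⟩ :=
    hF.comp ((measurable_sigmaMk N).comp (by fun_prop : Measurable fun n : ℝ => (q, p, n, a)))
  rw [← setLIntegral_congr Ioo_ae_eq_Ico]
  by_cases ha : a < 0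
  · simp only [S.emb_of_neg _ q p ha]
    have h := (Measure.measurePreserving_sub_left (volume : Measure ℝ)
      ((N : ℝ) + 1)).setLIntegral_comp_preimage (s := Ioo (N : ℝ) (N + 1)) measurableSet_Ioo hF'
    rw [← h]
    congr 2
    ext x
    simp only [mem_preimage, mem_Ioo]
    constructor <;> rintro ⟨h1, h2⟩ <;> constructor <;> linarith
  · simp only [S.emb_of_nonneg _ q p (not_lt.1 ha)]
    have h := (measurePreserving_add_left (volume : Measure ℝ)
      (N : ℝ)).setLIntegral_comp_preimage (s := Ioo (N : ℝ) (N + 1)) measurableSet_Ioo hF'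
    rw [← h]
    congr 2
    ext x
    simp only [mem_preimage, mem_Ioo]
    constructor <;> rintro ⟨h1, h2⟩ <;> constructor <;> linarith

theorem setLIntegral_flux (T : ℝ) (hf : Measurable f) (hg : Measurable g) :
    ∫⁻ c in Ioo 0 1, S.flux T f g c = ∑' N, ∫⁻ q, (∫⁻ ψ : E (S.d N) × ℝ,
      S.weight N q ψ.1 ψ.2 * ∫⁻ n in Ico (N : ℝ) (N + 1),
        S.corr T f g ⟨N, q, ψ.1, n, ψ.2⟩) ∂S.volV N := by
  have hc := S.measurable_corr T hf hg
  have hce : Measurable fun z : ℝ × S.Fib => S.corr T f g (S.emb z.1 z.2) :=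
    hc.comp S.measurable_emb
  have hG : Measurable fun y : S.Fib => ∫⁻ c in Ioo 0 1, S.corr T f g (S.emb c y) :=
    Measurable.lintegral_prod_left' (μ := volume.restrict (Ioo (0 : ℝ) 1)) hce
  unfold flux
  rw [lintegral_lintegral_swap (f := fun c y => S.corr T f g (S.emb c y)) hce.aemeasurable,
    fibMeasure, lintegral_sum_measure]
  refine tsum_congr fun N => ?_
  have hw : Measurable fun x : S.V N × E (S.d N) × ℝ => S.weight N x.1 x.2.1 x.2.2 :=
    S.measurable_weight (by fun_prop) (by fun_prop) (by fun_prop)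
  have hGN : Measurable fun x : S.V N × E (S.d N) × ℝ =>
      ∫⁻ c in Ioo 0 1, S.corr T f g (S.emb c ⟨N, x⟩) := hG.comp (measurable_sigmaMk N)
  rw [lintegral_map hG (measurable_sigmaMk N), lintegral_withDensity_eq_lintegral_mul _ hw hGN,
    lintegral_prod _ (hw.mul hGN).aemeasurable]
  refine lintegral_congr fun q => lintegral_congr fun ψ => ?_
  rw [Pi.mul_apply, S.setLIntegral_emb hc N q ψ.1 ψ.2]

theorem lintegral_target {F : S.Pos → ℝ≥0∞} (hF : Measurable F) :
    ∫⁻ x, F x ∂S.target = ∑' N, ∫⁻ q, (∫⁻ n in Ico (N : ℝ) (N + 1),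
      S.partition⁻¹ * ENNReal.ofReal (Real.exp (-S.β * S.U N q)) * F ⟨N, q, n⟩) ∂S.volV N := by
  rw [target, lintegral_sum_measure]
  refine tsum_congr fun N => ?_
  have hU : Measurable fun q : S.V N => S.U N q :=
    ((S.U_smooth N).continuousOn.domRestrict).measurable
  have hF' : Measurable fun x : S.V N × ℝ => F ⟨N, x⟩ := hF.comp (measurable_sigmaMk N)
  have hw : Measurable fun x : S.V N × ℝ =>
      S.partition⁻¹ * ENNReal.ofReal (Real.exp (-S.β * S.U N x.1)) *
        (Ico (N : ℝ) (N + 1)).indicator 1 x.2 := by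
    refine Measurable.mul ?_ ((measurable_one.indicator measurableSet_Ico).comp measurable_snd)
    have h1 : Measurable fun x : S.V N × ℝ => S.U N x.1 := hU.comp measurable_fst
    exact (h1.const_mul _).exp.ennreal_ofReal.const_mul _
  rw [lintegral_map hF (measurable_sigmaMk N), lintegral_withDensity_eq_lintegral_mul _ hw hF']
  refine (lintegral_prod _ (hw.mul hF').aemeasurable).trans ?_
  refine lintegral_congr fun q => ?_
  rw [← lintegral_indicator measurableSet_Ico]
  refine lintegral_congr fun n => ?_
  by_cases hn : n ∈ Ico (N : ℝ) (N + 1)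
  · simp [hn]
  · simp [hn]

/-- The logarithmic constant of `ham` contributes exactly the Gaussian normalization in dimension `d
N`, so the remaining factor does not depend on `N`. -/
theorem weight_eq (N : ℕ) (q p : E (S.d N)) (a : ℝ) :
    S.partition⁻¹ * ENNReal.ofReal (Real.exp (-S.β * S.U N q)) *
      (ENNReal.ofReal ((2 * S.m * Real.pi / S.β) ^ (-((S.d N : ℝ) / 2)) *
        Real.exp (-S.β * S.kin p)) *
      ENNReal.ofReal ((2 * S.mn / S.β)⁻¹ * Real.exp (-S.β * S.kinN a))) =
    S.partition⁻¹ * ENNReal.ofReal (2 * S.mn / S.β)⁻¹ * S.weight N q p a := by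
  have hβ := S.β_pos
  have hm := S.m_pos
  have hmn := S.mn_pos
  have hL : 0 < 2 * S.m * Real.pi / S.β := by positivity
  have hc : 0 ≤ (2 * S.mn / S.β)⁻¹ := by positivity
  rw [mul_assoc S.partition⁻¹, mul_assoc S.partition⁻¹, weight,
    ← ENNReal.ofReal_mul (by positivity),
    ← ENNReal.ofReal_mul (by positivity), ← ENNReal.ofReal_mul hc]
  congr 2
  rw [Real.rpow_def_of_pos hL]
  have h : Real.exp (-S.β * (S.ham N q p + S.kinN a)) = Real.exp (-S.β * S.U N q) *
      (Real.exp (Real.log (2 * S.m * Real.pi / S.β) * -((S.d N : ℝ) / 2)) *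
        Real.exp (-S.β * S.kin p) * Real.exp (-S.β * S.kinN a)) := by
    rw [← Real.exp_add, ← Real.exp_add, ← Real.exp_add, ham]
    congr 1
    field_simp
    ring
  rw [h]
  ring

theorem lintegral_idealStep (T : ℝ) (f : S.Pos → ℝ≥0∞) (hg : Measurable g) (N : ℕ) (q : S.V N)
    (n : ℝ) :
    S.partition⁻¹ * ENNReal.ofReal (Real.exp (-S.β * S.U N q)) *
      (f ⟨N, q, n⟩ * ∫⁻ z, g z ∂S.idealStep T ⟨N, q, n⟩) =
    S.partition⁻¹ * ENNReal.ofReal (2 * S.mn / S.β)⁻¹ * ∫⁻ ψ : E (S.d N) × ℝ,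
      S.weight N q ψ.1 ψ.2 * S.corr T f g ⟨N, q, ψ.1, n, ψ.2⟩ := by
  have hd := S.measurable_dyn_momentum T N q n
  have hg' : Measurable fun z => g (S.toPos z) := hg.comp S.measurable_toPos
  have hI : Measurable fun ψ : E (S.d N) × ℝ =>
      ∫⁻ z, g (S.toPos z) ∂S.dyn T ⟨N, q, ψ.1, n, ψ.2⟩ :=
    (S.measurable_lintegral_dyn T hg).comp ((measurable_sigmaMk N).comp (by fun_prop :
      Measurable fun x : E (S.d N) × ℝ => (q, x.1, n, x.2)))
  have hp : Measurable fun p : E (S.d N) => ENNReal.ofReal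
      ((2 * S.m * Real.pi / S.β) ^ (-((S.d N : ℝ) / 2)) * Real.exp (-S.β * S.kin p)) := by
    unfold kin; fun_prop
  have ha : Measurable fun a : ℝ => ENNReal.ofReal
      ((2 * S.mn / S.β)⁻¹ * Real.exp (-S.β * S.kinN a)) := by
    unfold kinN; fun_prop
  have hw : Measurable fun ψ : E (S.d N) × ℝ => S.weight N q ψ.1 ψ.2 :=
    S.measurable_weight (q := fun _ => q) (by fun_prop) (by fun_prop) (by fun_prop)
  have hpa : Measurable fun ψ : E (S.d N) × ℝ => ENNReal.ofReal
      ((2 * S.m * Real.pi / S.β) ^ (-((S.d N : ℝ) / 2)) * Real.exp (-S.β * S.kin ψ.1)) *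
      ENNReal.ofReal ((2 * S.mn / S.β)⁻¹ * Real.exp (-S.β * S.kinN ψ.2)) :=
    (hp.comp measurable_fst).mul (ha.comp measurable_snd)
  rw [idealStep, lintegral_map hg S.measurable_toPos, Measure.lintegral_bind hd.aemeasurable
    hg'.aemeasurable, pLaw, pnLaw, prod_withDensity hp ha,
    lintegral_withDensity_eq_lintegral_mul _ hpa hI, ← Measure.volume_eq_prod,
    ← lintegral_const_mul _ (hpa.mul hI), ← lintegral_const_mul _ ((hpa.mul hI).const_mul _)]
  have hC : Measurable fun ψ : E (S.d N) × ℝ =>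
      S.weight N q ψ.1 ψ.2 * S.corr T f g ⟨N, q, ψ.1, n, ψ.2⟩ :=
    hw.mul (hI.const_mul (f ⟨N, q, n⟩))
  rw [← lintegral_const_mul _ hC]
  refine lintegral_congr fun ψ => ?_
  rw [Pi.mul_apply, ← mul_assoc _ (S.weight N q ψ.1 ψ.2), ← S.weight_eq, corr, toPos]
  ring

/-! ### The kernels and their detailed balance -/

theorem measurable_uncurry_idealStep : Measurable (Function.uncurry S.idealStep) :=
  S.measurable_idealStep

/-- The transition kernel of the ideal algorithm with evolution time `T`. -/
def idealKernel (T : ℝ) : Kernel S.Pos S.Pos :=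
  ⟨S.idealStep T, S.measurable_uncurry_idealStep.of_uncurry_left⟩

instance (T : ℝ) : IsMarkovKernel (S.idealKernel T) :=
  ⟨fun x => inferInstanceAs (IsProbabilityMeasure (S.idealStep T x))⟩

theorem measurable_lintegral_idealStep (T : ℝ) (hg : Measurable g) :
    Measurable fun x => ∫⁻ z, g z ∂S.idealStep T x :=
  hg.lintegral_kernel (κ := S.idealKernel T)

/-- The right side is symmetric in `f` and `g` by `setLIntegral_flux_comm`; with indicator functions
this is detailed balance. -/
theorem lintegral_target_idealStep (T : ℝ) (hf : Measurable f) (hg : Measurable g) :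
    ∫⁻ x, f x * ∫⁻ z, g z ∂S.idealStep T x ∂S.target =
      S.partition⁻¹ * ENNReal.ofReal (2 * S.mn / S.β)⁻¹ * ∫⁻ c in Ioo 0 1, S.flux T f g c := by
  have hF : Measurable fun x => f x * ∫⁻ z, g z ∂S.idealStep T x :=
    hf.mul (S.measurable_lintegral_idealStep T hg)
  rw [S.lintegral_target hF, S.setLIntegral_flux T hf hg, ← ENNReal.tsum_mul_left]
  refine tsum_congr fun N => ?_
  have hK : Measurable fun z : (S.V N × E (S.d N) × ℝ) × ℝ =>
      S.corr T f g ⟨N, z.1.1, z.1.2.1, z.2, z.1.2.2⟩ :=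
    (S.measurable_corr T hf hg).comp ((measurable_sigmaMk N).comp (by fun_prop :
      Measurable fun z : (S.V N × E (S.d N) × ℝ) × ℝ => (z.1.1, z.1.2.1, z.2, z.1.2.2)))
  have hw : Measurable fun x : S.V N × E (S.d N) × ℝ => S.weight N x.1 x.2.1 x.2.2 :=
    S.measurable_weight (by fun_prop) (by fun_prop) (by fun_prop)
  have hn : Measurable fun x : S.V N × E (S.d N) × ℝ => ∫⁻ n in Ico (N : ℝ) (N + 1),
      S.corr T f g ⟨N, x.1, x.2.1, n, x.2.2⟩ :=
    Measurable.lintegral_prod_right' (ν := volume.restrict (Ico (N : ℝ) (N + 1))) hK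
  have hq : Measurable fun q : S.V N => ∫⁻ ψ : E (S.d N) × ℝ, S.weight N q ψ.1 ψ.2 *
      ∫⁻ n in Ico (N : ℝ) (N + 1), S.corr T f g ⟨N, q, ψ.1, n, ψ.2⟩ :=
    (hw.mul hn).lintegral_prod_right'
  rw [← lintegral_const_mul _ hq]
  refine lintegral_congr fun q => ?_
  have hKq : Measurable fun z : ℝ × (E (S.d N) × ℝ) => S.weight N q z.2.1 z.2.2 *
      S.corr T f g ⟨N, q, z.2.1, z.1, z.2.2⟩ := by
    have h1 : Measurable fun z : ℝ × (E (S.d N) × ℝ) => ((q, z.2), z.1) := by fun_prop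
    exact (S.measurable_weight (q := fun _ => q) (by fun_prop) (by fun_prop)
      (by fun_prop)).mul (hK.comp h1)
  have hn' : Measurable fun n : ℝ => ∫⁻ ψ : E (S.d N) × ℝ, S.weight N q ψ.1 ψ.2 *
      S.corr T f g ⟨N, q, ψ.1, n, ψ.2⟩ := hKq.lintegral_prod_right'
  have hswap := lintegral_lintegral_swap (μ := volume.restrict (Ico (N : ℝ) (N + 1)))
    (ν := (volume : Measure (E (S.d N) × ℝ)))
    (f := fun n ψ => S.weight N q ψ.1 ψ.2 * S.corr T f g ⟨N, q, ψ.1, n, ψ.2⟩) hKq.aemeasurable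
  refine (lintegral_congr fun n => S.lintegral_idealStep T f hg N q n).trans ?_
  rw [lintegral_const_mul _ hn', hswap]
  congr 1
  refine lintegral_congr fun ψ => ?_
  have h1 : Measurable fun n : ℝ => ((q, ψ), n) := by fun_prop
  exact lintegral_const_mul (f := fun n => S.corr T f g ⟨N, q, ψ.1, n, ψ.2⟩) _ (hK.comp h1)

theorem isReversible_idealKernel {T : ℝ} (hT : 0 ≤ T) :
    (S.idealKernel T).IsReversible S.target := by
  intro A B hA hB
  have h : ∀ A B : Set S.Pos, MeasurableSet A → MeasurableSet B →
      ∫⁻ x in A, S.idealKernel T x B ∂S.target =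
        ∫⁻ x, A.indicator 1 x * ∫⁻ z, B.indicator 1 z ∂S.idealStep T x ∂S.target := by
    intro A B hA hB
    rw [← lintegral_indicator hA]
    refine lintegral_congr fun x => ?_
    rw [lintegral_indicator_one hB]
    by_cases hx : x ∈ A <;> simp [hx, idealKernel]
  have hm : ∀ A : Set S.Pos, MeasurableSet A → Measurable (A.indicator (1 : S.Pos → ℝ≥0∞)) :=
    fun A hA => measurable_one.indicator hA
  rw [h A B hA hB, h B A hB hA, S.lintegral_target_idealStep T (hm A hA) (hm B hB),
    S.lintegral_target_idealStep T (hm B hB) (hm A hA),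
    S.setLIntegral_flux_comm hT (hm A hA) (hm B hB)]

/-- The transition kernel of the ideal algorithm with random evolution time. -/
def randomKernel {Tmin Tmax : ℝ} (h : Tmin < Tmax) : Kernel S.Pos S.Pos :=
  ⟨S.randomStep Tmin Tmax, by
    have : IsProbabilityMeasure (cond (volume : Measure ℝ) (Icc Tmin Tmax)) :=
      cond_isProbabilityMeasure_of_finite (by simp [h]) (by simp)
    exact measurable_bind_param (κ := fun _ : S.Pos => cond (volume : Measure ℝ) (Icc Tmin Tmax))
      (η := fun x T => S.idealStep T x) measurable_const (fun _ => this)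
      (measurable_uncurry_flip S.measurable_uncurry_idealStep)⟩

theorem isMarkovKernel_randomKernel {Tmin Tmax : ℝ} (h : Tmin < Tmax) :
    IsMarkovKernel (S.randomKernel h) := by
  have : IsProbabilityMeasure (cond (volume : Measure ℝ) (Icc Tmin Tmax)) :=
    cond_isProbabilityMeasure_of_finite (by simp [h]) (by simp)
  exact ⟨fun x => isProbabilityMeasure_bind (η := fun T => S.idealStep T x)
    S.measurable_uncurry_idealStep.of_uncurry_right fun _ => inferInstance⟩

/-- Detailed balance is linear in the kernel: by Tonelli it is averaged over `T`, and every `T` in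
the interval is nonnegative. -/
theorem isReversible_randomKernel {Tmin Tmax : ℝ} (h0 : 0 ≤ Tmin) (h : Tmin < Tmax) :
    (S.randomKernel h).IsReversible S.target := by
  have hP : IsProbabilityMeasure (cond (volume : Measure ℝ) (Icc Tmin Tmax)) :=
    cond_isProbabilityMeasure_of_finite (by simp [h]) (by simp)
  have hswap : ∀ A B : Set S.Pos, MeasurableSet B →
      ∫⁻ x in A, S.randomKernel h x B ∂S.target =
        ∫⁻ T, ∫⁻ x in A, S.idealKernel T x B ∂S.target
          ∂(cond (volume : Measure ℝ) (Icc Tmin Tmax)) := by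
    intro A B hB
    have hm : Measurable fun z : ℝ × S.Pos => S.idealStep z.1 z.2 B :=
      (Measure.measurable_coe hB).comp S.measurable_idealStep
    rw [lintegral_lintegral_swap (f := fun T x => S.idealKernel T x B) hm.aemeasurable]
    refine lintegral_congr fun x => ?_
    exact Measure.bind_apply hB S.measurable_uncurry_idealStep.of_uncurry_right.aemeasurable
  intro A B hA hB
  rw [hswap A B hB, hswap B A hA]
  refine lintegral_congr_ae ?_
  filter_upwards [ae_cond_mem measurableSet_Icc] with T hT
  exact S.isReversible_idealKernel (h0.trans hT.1) hA hB

end Model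

end DHMC

end

theorem theorem1 (S : DHMC.Model) :
    (∀ T : ℝ, 0 < T → ∃ Γ : Kernel S.Pos S.Pos,
      (∀ x, Γ x = S.idealStep T x) ∧ IsMarkovKernel Γ ∧ Γ.IsReversible S.target) ∧
    (∀ Tmin Tmax : ℝ, 0 ≤ Tmin → Tmin < Tmax → ∃ Γ : Kernel S.Pos S.Pos,
      (∀ x, Γ x = S.randomStep Tmin Tmax x) ∧ IsMarkovKernel Γ ∧ Γ.IsReversible S.target) := by
  refine ⟨fun T hT => ⟨S.idealKernel T, fun _ => rfl, inferInstance,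
    S.isReversible_idealKernel hT.le⟩, fun Tmin Tmax h0 h => ⟨S.randomKernel h, fun _ => rfl,
    S.isMarkovKernel_randomKernel h, S.isReversible_randomKernel h0 h⟩⟩
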